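/- Let $n > 1$ be an integer. Then there is a complete smooth Riemannian metric $g$ on $\mathbb{R}^n$ which has quadratic curvature decay and slow volume growth. That is, for every basepoint $m_0 \in \mathbb{R}^n$, writing $d$ for the Riemannian distance of $g$, $B_t$ for the metric ball of radius $t$ around $m_0$ and $\mathrm{vol}$ for the Riemannian volume of $g$: 1. there is a constant $C > 0$ such that for all $m \in \mathbb{R}^n$ with $m \neq m_0$ and all $2$-planes $P \subset T_m\mathbb{R}^n$ the sectional curvature satisfies $|K(P)| \le C / d(m_0, m)^2$; 2. $\displaystyle\liminf_{t \to \infty} \frac{\mathrm{vol}(B_t)}{t^n} = 0$. -/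

import Mathlib

open scoped Manifold ContDiff Bundle ENNReal
open Filter MeasureTheory

noncomputable section

/-! ### Riemannian metrics on a real vector space, and their distance -/

section Distance

variable (E : Type*) [NormedAddCommGroup E] [NormedSpace ℝ E]

/-- A smooth Riemannian metric on the manifold `E`. -/
abbrev SmoothMetric : Type _ :=
  Bundle.ContMDiffRiemannianMetric 𝓘(ℝ, E) ∞ E (fun x : E => TangentSpace 𝓘(ℝ, E) x)

variable {E}

/-- The inner product `g_x(u, v)`; each tangent space of `E` is identified with `E`. -/
def SmoothMetric.form (g : SmoothMetric E) (x u v : E) : ℝ :=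
  g.inner x (u : TangentSpace 𝓘(ℝ, E) x) (v : TangentSpace 𝓘(ℝ, E) x)

/-- The extended metric space structure on `E` given by the Riemannian distance of `g`,
the infimum of the `g`-lengths of the `C¹` paths between two points. -/
abbrev SmoothMetric.emetricSpace (g : SmoothMetric E) : EMetricSpace E :=
  letI : Bundle.RiemannianBundle (fun x : E => TangentSpace 𝓘(ℝ, E) x) :=
    ⟨g.toRiemannianMetric⟩
  haveI : IsContinuousRiemannianBundle E (fun x : E => TangentSpace 𝓘(ℝ, E) x) :=
    ⟨⟨g.inner, g.contMDiff.continuous, fun _ _ _ => rfl⟩⟩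
  EMetricSpace.ofRiemannianMetric 𝓘(ℝ, E) E

/-- The Riemannian distance of `g`, with values in `[0, ∞]`. -/
def SmoothMetric.edist (g : SmoothMetric E) (x y : E) : ℝ≥0∞ :=
  g.emetricSpace.edist x y

/-- The Riemannian distance of `g` as a real number (it is finite, as `E` is path connected). -/
def SmoothMetric.dist (g : SmoothMetric E) (x y : E) : ℝ :=
  (g.edist x y).toReal

/-- The open metric ball of radius `t` around `m₀`. -/
def SmoothMetric.ball (g : SmoothMetric E) (m₀ : E) (t : ℝ) : Set E :=
  {x | g.edist m₀ x < ENNReal.ofReal t}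

/-- Completeness of `g`: the Riemannian distance is complete. -/
def SmoothMetric.IsComplete (g : SmoothMetric E) : Prop :=
  @CompleteSpace E g.emetricSpace.toUniformSpace

end Distance

/-! ### Curvature and volume on `ℝⁿ`, in the standard coordinates -/

section Coordinates

variable {n : ℕ}

/-- The partial derivative `∂ᵢ f` at `x`. -/
def partialDeriv (i : Fin n) (f : EuclideanSpace ℝ (Fin n) → ℝ)
    (x : EuclideanSpace ℝ (Fin n)) : ℝ :=
  fderiv ℝ f x (EuclideanSpace.single i 1)

/-- The matrix `(gᵢⱼ(x))` of the metric. -/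
def SmoothMetric.gram (g : SmoothMetric (EuclideanSpace ℝ (Fin n)))
    (x : EuclideanSpace ℝ (Fin n)) : Matrix (Fin n) (Fin n) ℝ :=
  Matrix.of fun i j => g.form x (EuclideanSpace.single i 1) (EuclideanSpace.single j 1)

/-- The Christoffel symbol `Γᵏᵢⱼ` of the Levi-Civita connection:
`½ ∑ₗ gᵏˡ (∂ᵢ gⱼₗ + ∂ⱼ gᵢₗ - ∂ₗ gᵢⱼ)`. -/
def SmoothMetric.christoffel (g : SmoothMetric (EuclideanSpace ℝ (Fin n)))
    (k i j : Fin n) (x : EuclideanSpace ℝ (Fin n)) : ℝ :=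
  (1 / 2) * ∑ l, (g.gram x)⁻¹ k l *
    (partialDeriv i (fun y => g.gram y j l) x + partialDeriv j (fun y => g.gram y i l) x
      - partialDeriv l (fun y => g.gram y i j) x)

/-- The component along `∂ₗ` of
`R(∂ᵢ, ∂ⱼ) ∂ₖ = ∇_{∂ᵢ} ∇_{∂ⱼ} ∂ₖ - ∇_{∂ⱼ} ∇_{∂ᵢ} ∂ₖ`. -/
def SmoothMetric.riemann (g : SmoothMetric (EuclideanSpace ℝ (Fin n)))
    (l i j k : Fin n) (x : EuclideanSpace ℝ (Fin n)) : ℝ :=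
  partialDeriv i (g.christoffel l j k) x - partialDeriv j (g.christoffel l i k) x
    + ∑ m, (g.christoffel m j k x * g.christoffel l i m x
      - g.christoffel m i k x * g.christoffel l j m x)

/-- The vector `R(u, v) w` at `x`. -/
def SmoothMetric.curvatureOp (g : SmoothMetric (EuclideanSpace ℝ (Fin n)))
    (x u v w : EuclideanSpace ℝ (Fin n)) : EuclideanSpace ℝ (Fin n) :=
  WithLp.toLp 2 fun l => ∑ i, ∑ j, ∑ k, g.riemann l i j k x * u i * v j * w k

/-- The sectional curvature at `x` of the plane spanned by the linearly independent vectors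
`u` and `v`: `g(R(u, v) v, u) / (g(u, u) g(v, v) - g(u, v)²)`. -/
def SmoothMetric.sectionalCurvature (g : SmoothMetric (EuclideanSpace ℝ (Fin n)))
    (x u v : EuclideanSpace ℝ (Fin n)) : ℝ :=
  g.form x (g.curvatureOp x u v v) u / (g.form x u u * g.form x v v - g.form x u v ^ 2)

/-- The Riemannian volume measure `√(det gᵢⱼ) dx`. -/
def SmoothMetric.volume (g : SmoothMetric (EuclideanSpace ℝ (Fin n))) :
    Measure (EuclideanSpace ℝ (Fin n)) :=
  (MeasureTheory.volume : Measure (EuclideanSpace ℝ (Fin n))).withDensity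
    fun x => ENNReal.ofReal (Real.sqrt (g.gram x).det)

/-- Quadratic curvature decay with respect to the basepoint `m₀`: for some `C > 0`, every
2-plane `P` in the tangent space at `m` has `|K(P)| ≤ C / d(m₀, m)²`. At `m = m₀` the right-hand
side is infinite, so nothing is required there. -/
def SmoothMetric.HasQuadraticCurvatureDecay (g : SmoothMetric (EuclideanSpace ℝ (Fin n)))
    (m₀ : EuclideanSpace ℝ (Fin n)) : Prop :=
  ∃ C : ℝ, 0 < C ∧ ∀ m : EuclideanSpace ℝ (Fin n), m ≠ m₀ →
    ∀ u v : EuclideanSpace ℝ (Fin n), LinearIndependent ℝ ![u, v] →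
      |g.sectionalCurvature m u v| ≤ C / g.dist m₀ m ^ 2

/-- Slow volume growth with respect to the basepoint `m₀`:
`liminf_{t → ∞} vol(B_t(m₀)) / tⁿ = 0`, as a lower limit in `[0, ∞]`. -/
def SmoothMetric.HasSlowVolumeGrowth (g : SmoothMetric (EuclideanSpace ℝ (Fin n)))
    (m₀ : EuclideanSpace ℝ (Fin n)) : Prop :=
  liminf (fun t : ℝ => g.volume (g.ball m₀ t) / ENNReal.ofReal (t ^ n)) atTop = 0

end Coordinates

end

/-!
Write `ℝⁿ` as an increasing union of balls. The ball of level `k` is placed inside the thin tube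
around the core circle of level `k + 1`, where the metric of level `k + 1` is a product of a short
circle and a flat disc, hence agrees with the metric near the boundary of level `k`. Every level is
a rescaled copy of one model: the Euclidean metric in which the circles parallel to the core at
distance `√s` from it have been given length `2 π Φ(s)`, where `Φ(s) = s ^ n` down to a tube of
relative radius of order `ε`, and `Φ = ε ^ (2 n)` inside.

Where `Φ(s) = s ^ n` the metric is invariant, up to homothety, under anisotropic scalings, and
elsewhere the model is fixed, so compactness bounds the curvature of each level by a multiple of
`ρ⁻²`, where `ρ` is the sum of the radius of the tube and the distance to the core. Outside the ball
of the preceding level, the distance to the origin is at most a multiple of `ρ`. The tube of level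
`k` has radius `ε` and volume of order `ε ^ (2 n)` relative to the size of the level; since `ε → 0`
along the levels, the volume growth is slow along the radii of the tubes. Metric balls are contained
in compact balls of some level, whence completeness.
-/

noncomputable section

section TangentTrivialization

variable {E : Type*} [NormedAddCommGroup E] [NormedSpace ℝ E]

theorem trivializationAt_linear_snd (x y : E) (σ : TangentSpace 𝓘(ℝ, E) y →L[ℝ] ℝ) :
    (trivializationAt (E →L[ℝ] ℝ)
      (fun x : E ↦ TangentSpace 𝓘(ℝ, E) x →L[ℝ] ℝ) x ⟨y, σ⟩).2 = σ := by
  rw [hom_trivializationAt_apply]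
  ext v
  simp only [ContinuousLinearMap.inCoordinates, Bundle.Trivial.fiberBundle_trivializationAt',
    Bundle.Trivial.continuousLinearMapAt_trivialization, TangentBundle.symmL_model_space,
    ContinuousLinearMap.id_comp]
  rfl

theorem trivializationAt_bilinear_snd (x y : E)
    (σ : TangentSpace 𝓘(ℝ, E) y →L[ℝ] TangentSpace 𝓘(ℝ, E) y →L[ℝ] ℝ) :
    (trivializationAt (E →L[ℝ] E →L[ℝ] ℝ)
      (fun x : E ↦ TangentSpace 𝓘(ℝ, E) x →L[ℝ] TangentSpace 𝓘(ℝ, E) x →L[ℝ] ℝ) x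
        ⟨y, σ⟩).2 = σ := by
  rw [hom_trivializationAt_apply]
  ext v w
  simp only [ContinuousLinearMap.inCoordinates, TangentBundle.symmL_model_space,
    ContinuousLinearMap.comp_apply, Bundle.Trivialization.continuousLinearMapAt_apply]
  rw [Bundle.Trivialization.coe_linearMapAt_of_mem]
  · exact congrArg (fun L : E →L[ℝ] ℝ ↦ L w) (trivializationAt_linear_snd x y (σ v))
  · simp only [hom_trivializationAt_baseSet, TangentBundle.trivializationAt_baseSet,
      Bundle.Trivial.fiberBundle_trivializationAt', Bundle.Trivial.trivialization_baseSet,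
      Set.inter_univ]
    exact Set.mem_univ y

end TangentTrivialization

theorem exists_pos_mul_sq_le_of_posDef {E : Type*} [NormedAddCommGroup E] [NormedSpace ℝ E]
    [FiniteDimensional ℝ E] (B : E →L[ℝ] E →L[ℝ] ℝ) (hpos : ∀ u, u ≠ 0 → 0 < B u u) :
    ∃ c : ℝ, 0 < c ∧ ∀ u, c * ‖u‖ ^ 2 ≤ B u u := by
  have := FiniteDimensional.proper ℝ E
  rcases subsingleton_or_nontrivial E with hE | hE
  · exact ⟨1, one_pos, fun u ↦ by simp [Subsingleton.elim u 0]⟩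
  obtain ⟨u₀, hu₀, hmin⟩ := (isCompact_sphere (0 : E) 1).exists_isMinOn
    (NormedSpace.sphere_nonempty.2 zero_le_one)
    (f := fun u ↦ B u u) (B.continuous.clm_apply continuous_id).continuousOn
  refine ⟨B u₀ u₀, hpos _ (Metric.ne_of_mem_sphere hu₀ one_ne_zero), fun u ↦ ?_⟩
  rcases eq_or_ne u 0 with rfl | hu
  · simp
  have hnorm : 0 < ‖u‖ := norm_pos_iff.2 hu
  have hunit : B u₀ u₀ ≤ B (‖u‖⁻¹ • u) (‖u‖⁻¹ • u) :=
    hmin (by simp [norm_smul, hnorm.ne'])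
  calc B u₀ u₀ * ‖u‖ ^ 2 ≤ B (‖u‖⁻¹ • u) (‖u‖⁻¹ • u) * ‖u‖ ^ 2 := by gcongr
    _ = B u u := by simp; field_simp

theorem completeSpace_of_edist_ball_subset_compact {α : Type*} [PseudoEMetricSpace α] (x₀ : α)
    (hfin : ∀ x, edist x₀ x ≠ ⊤)
    (h : ∀ r : ℝ, ∃ K : Set α, IsCompact K ∧ {x | edist x₀ x < ENNReal.ofReal r} ⊆ K) :
    CompleteSpace α := by
  refine ⟨fun {f} hf ↦ ?_⟩
  obtain ⟨s, hs, hsd⟩ := (EMetric.cauchy_iff.1 hf).2 1 one_pos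
  have := hf.1
  obtain ⟨y, hy⟩ := nonempty_of_mem hs
  obtain ⟨K, hK, hsub⟩ := h ((edist x₀ y).toReal + 1)
  have hsK : s ⊆ K := fun z hz ↦ hsub <|
    calc edist x₀ z ≤ edist x₀ y + edist y z := edist_triangle _ _ _
      _ < edist x₀ y + 1 := ENNReal.add_lt_add_left (hfin y) (hsd y hy z hz)
      _ = ENNReal.ofReal ((edist x₀ y).toReal + 1) := by
        rw [ENNReal.ofReal_add ENNReal.toReal_nonneg zero_le_one, ENNReal.ofReal_toReal (hfin y),
          ENNReal.ofReal_one]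
  obtain ⟨z, -, hz⟩ := hK.isComplete f hf (le_principal_iff.2 (mem_of_superset hs hsK))
  exact ⟨z, hz⟩

namespace SmoothMetric

variable {E : Type*} [NormedAddCommGroup E] [NormedSpace ℝ E] (g : SmoothMetric E)

section Form

/-- The metric as a map from `E` to the bilinear forms on `E`, each tangent space being identified
with `E`; unlike `SmoothMetric.form` it can be differentiated as a whole. -/
def field (x : E) : E →L[ℝ] E →L[ℝ] ℝ :=
  g.inner x

theorem form_eq_field (x u v : E) : g.form x u v = g.field x u v := rfl

theorem form_comm (x u v : E) : g.form x u v = g.form x v u := g.symm x u v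

theorem form_self_pos (x : E) {u : E} (hu : u ≠ 0) : 0 < g.form x u u := g.pos x u hu

theorem form_self_nonneg (x u : E) : 0 ≤ g.form x u u := by
  rcases eq_or_ne u 0 with rfl | hu
  · simp [g.form_eq_field]
  · exact (g.form_self_pos x hu).le

theorem contDiff_field : ContDiff ℝ ∞ g.field := by
  rw [← contMDiff_iff_contDiff]
  intro x
  have h := g.contMDiff x
  rw [Bundle.contMDiffAt_section] at h
  exact h.congr_of_eventuallyEq
    (Eventually.of_forall fun y ↦ (trivializationAt_bilinear_snd x y (g.inner y)).symm)

theorem contDiff_form (u v : E) : ContDiff ℝ ∞ (fun x ↦ g.form x u v) := by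
  simp only [g.form_eq_field]
  exact (g.contDiff_field.clm_apply contDiff_const).clm_apply contDiff_const

theorem continuous_form_comp {X : Type*} [TopologicalSpace X] {x u v : X → E} (hx : Continuous x)
    (hu : Continuous u) (hv : Continuous v) : Continuous fun p ↦ g.form (x p) (u p) (v p) := by
  simp only [form_eq_field]
  exact ((g.contDiff_field.continuous.comp hx).clm_apply hu).clm_apply hv

/-- The smooth metric with a prescribed field of positive definite symmetric bilinear forms. -/
def ofField [FiniteDimensional ℝ E] (G : E → E →L[ℝ] E →L[ℝ] ℝ) (hG : ContDiff ℝ ∞ G)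
    (hsymm : ∀ x u v, G x u v = G x v u) (hpos : ∀ x u, u ≠ 0 → 0 < G x u u) :
    SmoothMetric E where
  inner x := G x
  symm x u v := hsymm x u v
  pos x u hu := hpos x u hu
  isVonNBounded x := by
    obtain ⟨c, hc, hle⟩ := exists_pos_mul_sq_le_of_posDef (G x) (hpos x)
    have hball : {v : E | G x v v < 1} ⊆ Metric.ball (0 : E) (Real.sqrt (1 / c)) := by
      intro v hv
      rw [mem_ball_zero_iff]
      apply Real.lt_sqrt_of_sq_lt
      rw [lt_div_iff₀ hc, mul_comm]
      exact (hle v).trans_lt hv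
    exact (NormedSpace.isVonNBounded_ball ℝ E _).subset hball
  contMDiff := by
    intro x
    have hsection : ContMDiffAt 𝓘(ℝ, E) (𝓘(ℝ, E).prod 𝓘(ℝ, E →L[ℝ] E →L[ℝ] ℝ)) ∞
        (fun b ↦ Bundle.TotalSpace.mk' (E →L[ℝ] E →L[ℝ] ℝ)
        (E := fun x : E ↦ TangentSpace 𝓘(ℝ, E) x →L[ℝ] TangentSpace 𝓘(ℝ, E) x →L[ℝ] ℝ)
        b (id (G b))) x := by
      rw [Bundle.contMDiffAt_section]
      exact ((contMDiff_iff_contDiff.2 hG) x).congr_of_eventuallyEq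
        (Eventually.of_forall fun y ↦ trivializationAt_bilinear_snd x y (id (G y)))
    exact hsection

end Form

section Length

/-- The `g`-length of a path `γ` parametrized by `[0, 1]`. -/
def pathLength (γ : ℝ → E) : ℝ≥0∞ :=
  ∫⁻ t in Set.Icc (0 : ℝ) 1, ENNReal.ofReal
    √(g.form (γ t) (derivWithin γ (Set.Icc 0 1) t) (derivWithin γ (Set.Icc 0 1) t))

theorem edist_le_pathLength {γ : ℝ → E} (hγ : ContDiffOn ℝ 1 γ (Set.Icc 0 1)) :
    g.edist (γ 0) (γ 1) ≤ g.pathLength γ := by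
  let _ : Bundle.RiemannianBundle (fun x : E ↦ TangentSpace 𝓘(ℝ, E) x) := ⟨g.toRiemannianMetric⟩
  refine (Manifold.riemannianEDist_le_pathELength (contMDiffOn_iff_contDiffOn.2 hγ) rfl rfl
    zero_le_one).trans_eq ?_
  simp only [Manifold.pathELength_eq_lintegral_mfderivWithin_Icc, ← ofReal_norm,
    norm_eq_sqrt_real_inner (F := TangentSpace 𝓘(ℝ, E) _), mfderivWithin_eq_fderivWithin]
  rfl

theorem exists_pathLength_lt {x y : E} {r : ℝ≥0∞} (h : g.edist x y < r) :
    ∃ γ : ℝ → E, γ 0 = x ∧ γ 1 = y ∧ ContDiffOn ℝ 1 γ (Set.Icc 0 1) ∧ g.pathLength γ < r := by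
  let _ : Bundle.RiemannianBundle (fun x : E ↦ TangentSpace 𝓘(ℝ, E) x) := ⟨g.toRiemannianMetric⟩
  obtain ⟨γ, h0, h1, hγ, hlen⟩ := Manifold.exists_lt_of_riemannianEDist_lt h
  refine ⟨γ, h0, h1, contMDiffOn_iff_contDiffOn.1 hγ, hlen.trans_eq' ?_⟩
  simp only [Manifold.pathELength_eq_lintegral_mfderivWithin_Icc, ← ofReal_norm,
    norm_eq_sqrt_real_inner (F := TangentSpace 𝓘(ℝ, E) _), mfderivWithin_eq_fderivWithin]
  rfl

theorem edist_le_of_path {γ : ℝ → E} (hγ : ContDiff ℝ 1 γ) {c : ℝ} (hc : 0 ≤ c)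
    (hspeed : ∀ t ∈ Set.Icc (0 : ℝ) 1, g.form (γ t) (deriv γ t) (deriv γ t) ≤ c ^ 2) :
    g.edist (γ 0) (γ 1) ≤ ENNReal.ofReal c := by
  have hderiv : ∀ t ∈ Set.Icc (0 : ℝ) 1, derivWithin γ (Set.Icc 0 1) t = deriv γ t := fun t ht ↦
    (hγ.differentiable one_ne_zero t).derivWithin (uniqueDiffOn_Icc zero_lt_one t ht)
  calc g.edist (γ 0) (γ 1) ≤ g.pathLength γ := g.edist_le_pathLength hγ.contDiffOn
    _ ≤ ∫⁻ _ in Set.Icc (0 : ℝ) 1, ENNReal.ofReal c := by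
      refine setLIntegral_mono' measurableSet_Icc fun t ht ↦ ENNReal.ofReal_le_ofReal ?_
      rw [hderiv t ht]
      exact Real.sqrt_le_iff.2 ⟨hc, hspeed t ht⟩
    _ = ENNReal.ofReal c := by simp

theorem edist_ne_top (x y : E) : g.edist x y ≠ ⊤ := by
  have hderiv (t : ℝ) : deriv (fun t : ℝ ↦ x + t • (y - x)) t = y - x := by
    simpa using (((hasDerivAt_id t).smul_const (y - x)).const_add x).deriv
  have hcont : Continuous fun t : ℝ ↦ g.form (x + t • (y - x)) (y - x) (y - x) :=
    (g.contDiff_form _ _).continuous.comp (by fun_prop)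
  obtain ⟨C, hC⟩ := (isCompact_Icc (a := (0 : ℝ)) (b := 1)).bddAbove_image hcont.continuousOn
  have hpath := g.edist_le_of_path (γ := fun t ↦ x + t • (y - x)) (c := √C) (by fun_prop)
    (Real.sqrt_nonneg C) fun t ht ↦ by
      have hle := hC (Set.mem_image_of_mem _ ht)
      rwa [hderiv, Real.sq_sqrt ((g.form_self_nonneg _ _).trans hle)]
  simp only [zero_smul, add_zero, one_smul, add_sub_cancel] at hpath
  exact ne_top_of_le_ne_top ENNReal.ofReal_ne_top hpath

theorem enorm_comp_sub_comp_le_mul_pathLength {h : E → ℝ} (hh : ContDiff ℝ 1 h) {c : ℝ}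
    (hc : 0 ≤ c) (hle : ∀ x u, (fderiv ℝ h x u) ^ 2 ≤ c ^ 2 * g.form x u u) {γ : ℝ → E}
    (hγ : ContDiffOn ℝ 1 γ (Set.Icc 0 1)) :
    ‖h (γ 1) - h (γ 0)‖ₑ ≤ ENNReal.ofReal c * g.pathLength γ := by
  refine (enorm_sub_le_lintegral_derivWithin_Icc_of_contDiffOn_Icc (hh.comp_contDiffOn hγ)
    zero_le_one).trans ?_
  rw [pathLength, ← lintegral_const_mul' _ _ ENNReal.ofReal_ne_top]
  refine setLIntegral_mono' measurableSet_Icc fun t ht ↦ ?_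
  have hchain : derivWithin (h ∘ γ) (Set.Icc 0 1) t
      = fderiv ℝ h (γ t) (derivWithin γ (Set.Icc 0 1) t) :=
    ((hh.differentiable one_ne_zero (γ t)).hasFDerivAt.comp_hasDerivWithinAt t
      (hγ.differentiableOn one_ne_zero t ht).hasDerivWithinAt).derivWithin
        (uniqueDiffOn_Icc zero_lt_one t ht)
  rw [hchain, ← ofReal_norm, ← ENNReal.ofReal_mul hc, Real.norm_eq_abs]
  refine ENNReal.ofReal_le_ofReal (abs_le_of_sq_le_sq ?_ (by positivity))
  rw [mul_pow, Real.sq_sqrt (g.form_self_nonneg _ _)]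
  exact hle _ _

theorem enorm_sub_le_mul_edist {h : E → ℝ} (hh : ContDiff ℝ 1 h) {c : ℝ} (hc : 0 ≤ c)
    (hle : ∀ x u, (fderiv ℝ h x u) ^ 2 ≤ c ^ 2 * g.form x u u) (x y : E) :
    ‖h y - h x‖ₑ ≤ ENNReal.ofReal c * g.edist x y := by
  have hneBot : (nhdsWithin (g.edist x y) (Set.Ioi (g.edist x y))).NeBot :=
    nhdsGT_neBot_of_exists_gt ⟨⊤, (g.edist_ne_top x y).lt_top⟩
  refine ge_of_tendsto (x := nhdsWithin (g.edist x y) (Set.Ioi (g.edist x y)))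
    (ENNReal.continuous_const_mul ENNReal.ofReal_ne_top).continuousWithinAt.tendsto
    (eventually_nhdsWithin_of_forall fun r hr ↦ ?_)
  obtain ⟨γ, rfl, rfl, hγ, hlen⟩ := g.exists_pathLength_lt hr
  exact (g.enorm_comp_sub_comp_le_mul_pathLength hh hc hle hγ).trans (by gcongr)

end Length

section Distance

theorem edist_triangle (x y z : E) : g.edist x z ≤ g.edist x y + g.edist y z :=
  @PseudoEMetricSpace.edist_triangle E g.emetricSpace.toPseudoEMetricSpace x y z

theorem dist_nonneg (x y : E) : 0 ≤ g.dist x y := ENNReal.toReal_nonneg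

theorem ofReal_dist (x y : E) : ENNReal.ofReal (g.dist x y) = g.edist x y :=
  ENNReal.ofReal_toReal (g.edist_ne_top x y)

theorem dist_le_of_edist_le {x y : E} {r : ℝ} (hr : 0 ≤ r) (h : g.edist x y ≤ ENNReal.ofReal r) :
    g.dist x y ≤ r :=
  ENNReal.toReal_le_of_le_ofReal hr h

theorem dist_triangle (x y z : E) : g.dist x z ≤ g.dist x y + g.dist y z := by
  refine g.dist_le_of_edist_le (add_nonneg (g.dist_nonneg x y) (g.dist_nonneg y z)) ?_
  rw [ENNReal.ofReal_add (g.dist_nonneg x y) (g.dist_nonneg y z), ofReal_dist, ofReal_dist]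
  exact g.edist_triangle x y z

theorem dist_pos {x y : E} (h : x ≠ y) : 0 < g.dist x y :=
  ENNReal.toReal_pos (fun h0 ↦ h (@EMetricSpace.eq_of_edist_eq_zero E g.emetricSpace x y h0))
    (g.edist_ne_top x y)

theorem ball_subset_ball {x y : E} {s t : ℝ} (hs : 0 ≤ s) (h : g.dist x y + s ≤ t) :
    g.ball y s ⊆ g.ball x t := fun z hz ↦
  calc g.edist x z ≤ g.edist x y + g.edist y z := g.edist_triangle x y z
    _ < g.edist x y + ENNReal.ofReal s := ENNReal.add_lt_add_left (g.edist_ne_top x y) hz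
    _ = ENNReal.ofReal (g.dist x y + s) := by
      rw [ENNReal.ofReal_add (g.dist_nonneg x y) hs, ofReal_dist]
    _ ≤ ENNReal.ofReal t := ENNReal.ofReal_le_ofReal h

theorem isComplete_of_ball_subset_compact (x₀ : E)
    (h : ∀ r : ℝ, ∃ K : Set E, IsCompact K ∧ g.ball x₀ r ⊆ K) : g.IsComplete :=
  @completeSpace_of_edist_ball_subset_compact E g.emetricSpace.toPseudoEMetricSpace x₀
    (g.edist_ne_top x₀) h

end Distance

end SmoothMetric

theorem contDiff_bilinear_iff {D E F G : Type*} [NormedAddCommGroup D] [NormedSpace ℝ D]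
    [NormedAddCommGroup E] [NormedSpace ℝ E] [FiniteDimensional ℝ E] [NormedAddCommGroup F]
    [NormedSpace ℝ F] [FiniteDimensional ℝ F] [NormedAddCommGroup G] [NormedSpace ℝ G]
    {A : D → E →L[ℝ] F →L[ℝ] G} {m : WithTop ℕ∞} :
    ContDiff ℝ m A ↔ ∀ u v, ContDiff ℝ m fun x ↦ A x u v := by
  rw [contDiff_clm_apply_iff]
  exact forall_congr' fun u ↦ contDiff_clm_apply_iff

section SecondDerivative

variable {E F G : Type*} [NormedAddCommGroup E] [NormedSpace ℝ E]
  [NormedAddCommGroup F] [NormedSpace ℝ F] [NormedAddCommGroup G] [NormedSpace ℝ G]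

theorem fderiv_fderiv_comm {f : E → F} (hf : ContDiff ℝ 2 f) (x u v : E) :
    fderiv ℝ (fderiv ℝ f) x u v = fderiv ℝ (fderiv ℝ f) x v u :=
  hf.contDiffAt.isSymmSndFDerivAt (by simp) u v

theorem fderiv_apply_const {A : E → F →L[ℝ] G} {x : E} (hA : DifferentiableAt ℝ A x)
    (v : F) (u : E) : fderiv ℝ (fun y ↦ A y v) x u = fderiv ℝ A x u v := by
  rw [fderiv_clm_apply hA (differentiableAt_const v)]
  simp

theorem fderiv_apply_apply {A : E → F →L[ℝ] F →L[ℝ] G} {a b : E → F} {x : E}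
    (hA : DifferentiableAt ℝ A x) (ha : DifferentiableAt ℝ a x) (hb : DifferentiableAt ℝ b x)
    (u : E) :
    fderiv ℝ (fun y ↦ A y (a y) (b y)) x u =
      fderiv ℝ A x u (a x) (b x) + A x (fderiv ℝ a x u) (b x) + A x (a x) (fderiv ℝ b x u) := by
  rw [fderiv_clm_apply (hA.clm_apply ha) hb, fderiv_clm_apply hA ha]
  simp only [add_apply, ContinuousLinearMap.comp_apply, ContinuousLinearMap.flip_apply]
  abel

theorem fderiv_apply_apply_const {A : E → F →L[ℝ] F →L[ℝ] G} {x : E}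
    (hA : DifferentiableAt ℝ A x) (v w : F) (u : E) :
    fderiv ℝ (fun y ↦ A y v w) x u = fderiv ℝ A x u v w := by
  rw [fderiv_apply_apply hA (differentiableAt_const v) (differentiableAt_const w)]
  simp

set_option synthInstance.maxHeartbeats 100000 in
-- Instance search through nested spaces of continuous linear maps is slow.
theorem differentiableAt_comp_apply_apply {A : F → F →L[ℝ] F →L[ℝ] G} {Ψ : E → F} {a b : E → F}
    {x : E} (hA : DifferentiableAt ℝ A (Ψ x)) (hΨ : DifferentiableAt ℝ Ψ x)
    (ha : DifferentiableAt ℝ a x) (hb : DifferentiableAt ℝ b x) :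
    DifferentiableAt ℝ (fun y ↦ A (Ψ y) (a y) (b y)) x :=
  ((hA.comp x hΨ).clm_apply ha).clm_apply hb

set_option synthInstance.maxHeartbeats 100000 in
-- Instance search through nested spaces of continuous linear maps is slow.
theorem fderiv_comp_apply_apply {A : F → F →L[ℝ] F →L[ℝ] G} {Ψ : E → F} {a b : E → F} {x : E}
    (hA : DifferentiableAt ℝ A (Ψ x)) (hΨ : DifferentiableAt ℝ Ψ x)
    (ha : DifferentiableAt ℝ a x) (hb : DifferentiableAt ℝ b x) (u : E) :
    fderiv ℝ (fun y ↦ A (Ψ y) (a y) (b y)) x u = fderiv ℝ A (Ψ x) (fderiv ℝ Ψ x u) (a x) (b x)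
      + A (Ψ x) (fderiv ℝ a x u) (b x) + A (Ψ x) (a x) (fderiv ℝ b x u) := by
  have hAΨ : DifferentiableAt ℝ (fun y ↦ A (Ψ y)) x :=
    DifferentiableAt.comp (G := F →L[ℝ] F →L[ℝ] G) x hA hΨ
  refine (fderiv_apply_apply hAΨ ha hb u).trans ?_
  rw [fderiv_fun_comp (G := F →L[ℝ] F →L[ℝ] G) x hA hΨ]
  rfl

end SecondDerivative

section LeviCivita

variable {E : Type*} [NormedAddCommGroup E] [NormedSpace ℝ E]

/-- `Γ` is the connection form of the Levi-Civita connection of the Riemannian metric `G`, that is,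
`∇ᵤ V = ∂ᵤ V + Γ(u, V)`. It is characterized by the Koszul formula, so no bases are needed. -/
structure IsLeviCivita (G : E → E →L[ℝ] E →L[ℝ] ℝ) (Γ : E → E →L[ℝ] E →L[ℝ] E) : Prop where
  contDiff_metric : ContDiff ℝ ∞ G
  contDiff : ContDiff ℝ ∞ Γ
  symm : ∀ x u v, G x u v = G x v u
  pos : ∀ x u, u ≠ 0 → 0 < G x u u
  koszul : ∀ x u v w, 2 * G x (Γ x u v) w =
    fderiv ℝ G x u v w + fderiv ℝ G x v u w - fderiv ℝ G x w u v

section Koszul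

variable {ι : Type*} (b : Module.Basis ι ℝ E)

theorem trilinear_ext_of_basis {A B : E →L[ℝ] E →L[ℝ] E →L[ℝ] ℝ}
    (h : ∀ i j k, A (b i) (b j) (b k) = B (b i) (b j) (b k)) : A = B :=
  ContinuousLinearMap.coe_injective <| b.ext fun i ↦ ContinuousLinearMap.coe_injective <|
    b.ext fun j ↦ ContinuousLinearMap.coe_injective <| b.ext fun k ↦ h i j k

set_option maxSynthPendingDepth 5 in
set_option synthInstance.maxHeartbeats 400000 in
-- Instance search through nested spaces of continuous linear maps is slow.
theorem koszul_of_basis {B : E →L[ℝ] E →L[ℝ] ℝ} {Γ : E →L[ℝ] E →L[ℝ] E}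
    {D : E →L[ℝ] E →L[ℝ] E →L[ℝ] ℝ}
    (h : ∀ i j k, 2 * B (Γ (b i) (b j)) (b k) =
      D (b i) (b j) (b k) + D (b j) (b i) (b k) - D (b k) (b i) (b j)) (u v w : E) :
    2 * B (Γ u v) w = D u v w + D v u w - D w u v := by
  have heq := trilinear_ext_of_basis b
    (A := (2 : ℝ) • (ContinuousLinearMap.compL ℝ _ _ _ B).comp Γ)
    (B := D + D.flip
      - (ContinuousLinearMap.flipₗᵢ ℝ _ _ _).toContinuousLinearEquiv.toContinuousLinearMap.comp
        D.flip) h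
  exact congrArg (fun A : E →L[ℝ] E →L[ℝ] E →L[ℝ] ℝ ↦ A u v w) heq

end Koszul

/-- The curvature tensor `R(u, v) w` of the connection `∇ᵤ V = ∂ᵤ V + Γ(u, V)`. -/
def connectionCurvature (Γ : E → E →L[ℝ] E →L[ℝ] E) (x u v w : E) : E :=
  fderiv ℝ Γ x u v w - fderiv ℝ Γ x v u w + Γ x u (Γ x v w) - Γ x v (Γ x u w)

/-- Near `x`, the map `Ψ` multiplies lengths by `c`, from the metric `H` to the metric `G`. -/
def IsHomothetyAt (H G : E → E →L[ℝ] E →L[ℝ] ℝ) (Ψ : E → E) (c : ℝ) (x : E) : Prop :=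
  ∀ᶠ y in nhds x, ∀ u v, G (Ψ y) (fderiv ℝ Ψ y u) (fderiv ℝ Ψ y v) = c ^ 2 * H y u v

namespace IsLeviCivita

variable {G H : E → E →L[ℝ] E →L[ℝ] ℝ} {Γ Γ' : E → E →L[ℝ] E →L[ℝ] E}

theorem differentiableAt_metric (h : IsLeviCivita G Γ) (x : E) : DifferentiableAt ℝ G x :=
  h.contDiff_metric.differentiable (by simp) x

theorem differentiableAt (h : IsLeviCivita G Γ) (x : E) : DifferentiableAt ℝ Γ x :=
  h.contDiff.differentiable (by simp) x

theorem fderiv_symm (h : IsLeviCivita G Γ) (x u v w : E) :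
    fderiv ℝ G x u v w = fderiv ℝ G x u w v := by
  rw [← fderiv_apply_apply_const (h.differentiableAt_metric x),
    ← fderiv_apply_apply_const (h.differentiableAt_metric x)]
  simp only [h.symm _ v w]

theorem fderiv_metric (h : IsLeviCivita G Γ) (x u v w : E) :
    fderiv ℝ G x u v w = G x (Γ x u v) w + G x v (Γ x u w) := by
  rw [h.symm x v]
  linarith [h.koszul x u v w, h.koszul x u w v, h.fderiv_symm x u v w, h.fderiv_symm x v u w,
    h.fderiv_symm x w u v]

theorem eq_of_forall_metric_eq (h : IsLeviCivita G Γ) (x : E) {u v : E}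
    (huv : ∀ w, G x u w = G x v w) : u = v := by
  by_contra hne
  have hpos := h.pos x (u - v) (sub_ne_zero.2 hne)
  simp [huv] at hpos

theorem fderiv_fderiv_metric_self (h : IsLeviCivita G Γ) (x u v w : E) :
    fderiv ℝ (fderiv ℝ (fun y ↦ G y w w)) x u v =
      2 * (G x (Γ x u (Γ x v w)) w + G x (Γ x v w) (Γ x u w) + G x (fderiv ℝ Γ x u v w) w) := by
  have hG := h.differentiableAt_metric x
  have hΓ : DifferentiableAt ℝ (fun y ↦ Γ y v w) x :=
    ((h.differentiableAt x).clm_apply (differentiableAt_const v)).clm_apply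
      (differentiableAt_const w)
  have hdiff : DifferentiableAt ℝ (fderiv ℝ (fun y ↦ G y w w)) x :=
    ((((h.contDiff_metric.clm_apply contDiff_const).clm_apply contDiff_const).fderiv_right
      (m := ∞) (by simp)).differentiable (by simp) x)
  have hfirst : (fun y ↦ fderiv ℝ (fun y ↦ G y w w) y v) = fun y ↦ 2 * G y (Γ y v w) w := by
    ext y
    rw [fderiv_apply_apply_const (h.differentiableAt_metric y), h.fderiv_metric, h.symm y w]
    ring
  rw [← fderiv_apply_const hdiff, hfirst,
    fderiv_const_mul ((hG.clm_apply hΓ).clm_apply (differentiableAt_const w)), smul_apply,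
    fderiv_apply_apply hG hΓ (differentiableAt_const w), h.fderiv_metric,
    fderiv_apply_apply_const (h.differentiableAt x)]
  simp

theorem metric_curvature_self (h : IsLeviCivita G Γ) (x u v w : E) :
    G x (connectionCurvature Γ x u v w) w = 0 := by
  have hsymm := fderiv_fderiv_comm (f := fun y ↦ G y w w)
    (((h.contDiff_metric.clm_apply contDiff_const).clm_apply contDiff_const).of_le
      ENat.LEInfty.out) x u v
  rw [h.fderiv_fderiv_metric_self, h.fderiv_fderiv_metric_self] at hsymm
  simp only [connectionCurvature, map_add, map_sub, add_apply, sub_apply]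
  linarith [h.symm x (Γ x v w) (Γ x u w)]

set_option synthInstance.maxHeartbeats 100000 in
-- Instance search through nested spaces of continuous linear maps is slow.
theorem metric_curvature_lincomb (h : IsLeviCivita G Γ) (x e f : E) (a b c : ℝ) :
    G x (connectionCurvature Γ x (a • e) (b • e + c • f) (b • e + c • f)) (a • e) =
      (a * c) ^ 2 * G x (connectionCurvature Γ x e f f) e := by
  have hcurv : connectionCurvature Γ x (a • e) (b • e + c • f) (b • e + c • f) =
      (a * c * b) • connectionCurvature Γ x e f e
        + (a * c * c) • connectionCurvature Γ x e f f := by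
    simp only [connectionCurvature, ContinuousLinearMap.map_add, ContinuousLinearMap.map_smul,
      add_apply, smul_apply]
    module
  rw [hcurv, map_add, map_smul, map_smul, map_smul, add_apply, smul_apply, smul_apply,
    h.metric_curvature_self]
  simp only [smul_eq_mul]
  ring

set_option synthInstance.maxHeartbeats 100000 in
-- Instance search through nested spaces of continuous linear maps is slow.
theorem continuous_curvature (h : IsLeviCivita G Γ) :
    Continuous fun p : E × E × E ↦ connectionCurvature Γ p.1 p.2.1 p.2.2 p.2.2 := by
  have hΓ : Continuous Γ := h.contDiff.continuous
  have hdΓ : Continuous (fderiv ℝ Γ) :=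
    (h.contDiff.fderiv_right (m := ∞) (by simp)).continuous
  unfold connectionCurvature
  fun_prop

variable {Ψ : E → E} {c : ℝ} {x : E}

theorem fderiv_metric_of_isHomothetyAt (hG : IsLeviCivita G Γ) (hH : IsLeviCivita H Γ')
    (hΨ : ContDiff ℝ 2 Ψ) (h : IsHomothetyAt H G Ψ c x) (u v w : E) :
    c ^ 2 * fderiv ℝ H x u v w =
      fderiv ℝ G (Ψ x) (fderiv ℝ Ψ x u) (fderiv ℝ Ψ x v) (fderiv ℝ Ψ x w)
      + G (Ψ x) (fderiv ℝ (fderiv ℝ Ψ) x u v) (fderiv ℝ Ψ x w)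
      + G (Ψ x) (fderiv ℝ Ψ x v) (fderiv ℝ (fderiv ℝ Ψ) x u w) := by
  have hdΨ : DifferentiableAt ℝ (fderiv ℝ Ψ) x :=
    (hΨ.fderiv_right (m := 1) (by norm_num)).differentiable one_ne_zero x
  have hconst (v : E) := hdΨ.clm_apply (differentiableAt_const v)
  have hpull : (fun y ↦ G (Ψ y) (fderiv ℝ Ψ y v) (fderiv ℝ Ψ y w)) =ᶠ[nhds x]
      fun y ↦ c ^ 2 * H y v w := h.mono fun y hy ↦ hy v w
  have hH' := hH.differentiableAt_metric x
  have hHvw : DifferentiableAt ℝ (fun y ↦ H y v w) x :=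
    (hH'.clm_apply (differentiableAt_const v)).clm_apply (differentiableAt_const w)
  rw [← fderiv_apply_const hdΨ, ← fderiv_apply_const hdΨ,
    ← fderiv_comp_apply_apply (hG.differentiableAt_metric _) (hΨ.differentiable two_ne_zero x)
      (hconst v) (hconst w), hpull.fderiv_eq, fderiv_const_mul hHvw, smul_apply,
    fderiv_apply_apply_const hH', smul_eq_mul]

theorem fderiv_injective_of_isHomothetyAt (hH : IsLeviCivita H Γ') (hc : c ≠ 0)
    (h : IsHomothetyAt H G Ψ c x) : Function.Injective (fderiv ℝ Ψ x) := by
  rw [injective_iff_map_eq_zero]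
  intro u hu
  by_contra hne
  have hpos : 0 < c ^ 2 * H x u u := mul_pos (by positivity) (hH.pos x u hne)
  simp [← h.self_of_nhds u u, hu] at hpos

variable [FiniteDimensional ℝ E]

theorem map_connection_of_isHomothetyAt (hG : IsLeviCivita G Γ) (hH : IsLeviCivita H Γ')
    (hΨ : ContDiff ℝ 2 Ψ) (hc : c ≠ 0) (h : IsHomothetyAt H G Ψ c x) (u v : E) :
    fderiv ℝ Ψ x (Γ' x u v) = Γ (Ψ x) (fderiv ℝ Ψ x u) (fderiv ℝ Ψ x v)
      + fderiv ℝ (fderiv ℝ Ψ) x u v := by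
  have hsurj : Function.Surjective (fderiv ℝ Ψ x) :=
    LinearMap.surjective_of_injective (f := (fderiv ℝ Ψ x : E →ₗ[ℝ] E))
      (hH.fderiv_injective_of_isHomothetyAt hc h)
  refine hG.eq_of_forall_metric_eq (Ψ x) fun w' ↦ ?_
  obtain ⟨w, rfl⟩ := hsurj w'
  rw [h.self_of_nhds, map_add, add_apply]
  have huvw := hG.fderiv_metric_of_isHomothetyAt hH hΨ h u v w
  have hvuw := hG.fderiv_metric_of_isHomothetyAt hH hΨ h v u w
  have hwuv := hG.fderiv_metric_of_isHomothetyAt hH hΨ h w u v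
  rw [fderiv_fderiv_comm hΨ x v u] at hvuw
  rw [fderiv_fderiv_comm hΨ x w u, fderiv_fderiv_comm hΨ x w v] at hwuv
  have hkoszul : c ^ 2 * (2 * H x (Γ' x u v) w) = c ^ 2 * fderiv ℝ H x u v w
      + c ^ 2 * fderiv ℝ H x v u w - c ^ 2 * fderiv ℝ H x w u v := by
    rw [hH.koszul x u v w]
    ring
  linarith [hG.koszul (Ψ x) (fderiv ℝ Ψ x u) (fderiv ℝ Ψ x v) (fderiv ℝ Ψ x w),
    hG.symm (Ψ x) (fderiv ℝ Ψ x v) (fderiv ℝ (fderiv ℝ Ψ) x u w)]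

theorem map_fderiv_connection_of_isHomothetyAt (hG : IsLeviCivita G Γ) (hH : IsLeviCivita H Γ')
    (hΨ : ContDiff ℝ 3 Ψ) (hc : c ≠ 0) (h : IsHomothetyAt H G Ψ c x) (u v w : E) :
    fderiv ℝ (fderiv ℝ Ψ) x u (Γ' x v w) + fderiv ℝ Ψ x (fderiv ℝ Γ' x u v w) =
      fderiv ℝ Γ (Ψ x) (fderiv ℝ Ψ x u) (fderiv ℝ Ψ x v) (fderiv ℝ Ψ x w)
      + Γ (Ψ x) (fderiv ℝ (fderiv ℝ Ψ) x u v) (fderiv ℝ Ψ x w)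
      + Γ (Ψ x) (fderiv ℝ Ψ x v) (fderiv ℝ (fderiv ℝ Ψ) x u w)
      + fderiv ℝ (fderiv ℝ (fderiv ℝ Ψ)) x u v w := by
  have hΨ₁ : ContDiff ℝ 2 (fderiv ℝ Ψ) := hΨ.fderiv_right (by norm_num)
  have hdΨ : DifferentiableAt ℝ Ψ x := hΨ.differentiable three_ne_zero x
  have hdΨ₁ : DifferentiableAt ℝ (fderiv ℝ Ψ) x := hΨ₁.differentiable two_ne_zero x
  have hdΨ₂ : DifferentiableAt ℝ (fderiv ℝ (fderiv ℝ Ψ)) x :=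
    (hΨ₁.fderiv_right (m := 1) (by norm_num)).differentiable one_ne_zero x
  have hconst (v : E) := hdΨ₁.clm_apply (differentiableAt_const v)
  have hΓ'vw : DifferentiableAt ℝ (fun y ↦ Γ' y v w) x :=
    ((hH.differentiableAt x).clm_apply (differentiableAt_const v)).clm_apply
      (differentiableAt_const w)
  have hΓvw : DifferentiableAt ℝ (fun y ↦ Γ (Ψ y) (fderiv ℝ Ψ y v) (fderiv ℝ Ψ y w)) x :=
    differentiableAt_comp_apply_apply (hG.differentiableAt (Ψ x)) hdΨ (hconst v) (hconst w)
  have hmap : (fun y ↦ fderiv ℝ Ψ y (Γ' y v w)) =ᶠ[nhds x]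
      fun y ↦ Γ (Ψ y) (fderiv ℝ Ψ y v) (fderiv ℝ Ψ y w) + fderiv ℝ (fderiv ℝ Ψ) y v w :=
    h.eventually_nhds.mono fun y hy ↦
      hG.map_connection_of_isHomothetyAt hH (hΨ.of_le (by norm_num)) hc hy v w
  have hderiv := congrArg (fun L : E →L[ℝ] E ↦ L u) hmap.fderiv_eq
  simp only [fderiv_clm_apply hdΨ₁ hΓ'vw, add_apply, ContinuousLinearMap.comp_apply,
    ContinuousLinearMap.flip_apply, fderiv_apply_apply_const (hH.differentiableAt x),
    fderiv_fun_add hΓvw ((hdΨ₂.clm_apply (differentiableAt_const v)).clm_apply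
      (differentiableAt_const w)), fderiv_apply_apply_const hdΨ₂,
    fderiv_comp_apply_apply (hG.differentiableAt (Ψ x)) hdΨ (hconst v) (hconst w),
    fderiv_apply_const hdΨ₁] at hderiv
  rw [add_comm, hderiv]

theorem map_curvature_of_isHomothetyAt (hG : IsLeviCivita G Γ) (hH : IsLeviCivita H Γ')
    (hΨ : ContDiff ℝ 3 Ψ) (hc : c ≠ 0) (h : IsHomothetyAt H G Ψ c x) (u v w : E) :
    fderiv ℝ Ψ x (connectionCurvature Γ' x u v w) =
      connectionCurvature Γ (Ψ x) (fderiv ℝ Ψ x u) (fderiv ℝ Ψ x v) (fderiv ℝ Ψ x w) := by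
  have hΨ₁ : ContDiff ℝ 2 (fderiv ℝ Ψ) := hΨ.fderiv_right (by norm_num)
  have hmap := hG.map_connection_of_isHomothetyAt hH (hΨ.of_le (by norm_num)) hc h
  have huv := hG.map_fderiv_connection_of_isHomothetyAt hH hΨ hc h u v w
  have hvu := hG.map_fderiv_connection_of_isHomothetyAt hH hΨ hc h v u w
  rw [fderiv_fderiv_comm (hΨ.of_le (by norm_num)) x u v,
    fderiv_fderiv_comm hΨ₁ x u v] at huv
  simp only [connectionCurvature, map_add, map_sub]
  rw [eq_sub_of_add_eq' huv, eq_sub_of_add_eq' hvu, hmap u, hmap v, hmap v, hmap u]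
  simp only [map_add]
  abel

end IsLeviCivita

end LeviCivita

section OrthonormalPair

variable {F : Type*} [NormedAddCommGroup F] [InnerProductSpace ℝ F]

theorem exists_orthonormal_pair_of_linearIndependent {u v : F}
    (h : LinearIndependent ℝ ![u, v]) :
    ∃ e f : F, ‖e‖ = 1 ∧ ‖f‖ = 1 ∧ inner ℝ e f = 0 ∧
      ∃ a b c : ℝ, a ≠ 0 ∧ c ≠ 0 ∧ u = a • e ∧ v = b • e + c • f := by
  have hu : u ≠ 0 := h.ne_zero 0
  set e := ‖u‖⁻¹ • u with he
  have he1 : ‖e‖ = 1 := norm_smul_inv_norm (𝕜 := ℝ) hu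
  set w := v - (inner ℝ e v : ℝ) • e with hw
  have hw0 : w ≠ 0 := by
    intro h0
    have hcoeff := LinearIndependent.pair_iff.1 h (-(inner ℝ e v : ℝ) * ‖u‖⁻¹) 1 (by
      rw [mul_smul, ← he, one_smul, ← h0, hw]; module)
    exact one_ne_zero hcoeff.2
  refine ⟨e, ‖w‖⁻¹ • w, he1, norm_smul_inv_norm (𝕜 := ℝ) hw0, ?_, ‖u‖, inner ℝ e v, ‖w‖,
    norm_ne_zero_iff.2 hu, norm_ne_zero_iff.2 hw0, ?_, ?_⟩
  · rw [inner_smul_right, hw, inner_sub_right, inner_smul_right, real_inner_self_eq_norm_sq, he1]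
    ring
  · rw [he, smul_inv_smul₀ (norm_ne_zero_iff.2 hu)]
  · rw [smul_inv_smul₀ (norm_ne_zero_iff.2 hw0), hw]
    abel

theorem linearIndependent_pair_of_inner_eq_zero {e f : F} (he : ‖e‖ = 1) (hf : ‖f‖ = 1)
    (hef : inner ℝ e f = 0) : LinearIndependent ℝ ![e, f] := by
  apply Orthonormal.linearIndependent (𝕜 := ℝ)
  constructor
  · intro i; fin_cases i <;> simp [he, hf]
  · intro i j hij
    fin_cases i <;> fin_cases j <;> simp_all [real_inner_comm]

end OrthonormalPair

section Coordinates

variable {n : ℕ}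

theorem sum_smul_single (u : EuclideanSpace ℝ (Fin n)) :
    ∑ i, u i • EuclideanSpace.single i (1 : ℝ) = u := by
  simpa using (EuclideanSpace.basisFun (Fin n) ℝ).sum_repr u

theorem fderiv_apply_eq_sum_partialDeriv (f : EuclideanSpace ℝ (Fin n) → ℝ)
    (x u : EuclideanSpace ℝ (Fin n)) : fderiv ℝ f x u = ∑ i, u i * partialDeriv i f x := by
  conv_lhs => rw [← sum_smul_single u]
  simp [partialDeriv]

theorem contDiff_partialDeriv (i : Fin n) {f : EuclideanSpace ℝ (Fin n) → ℝ}
    (hf : ContDiff ℝ ∞ f) : ContDiff ℝ ∞ (partialDeriv i f) :=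
  (hf.fderiv_right (m := ∞) (by simp)).clm_apply contDiff_const

namespace SmoothMetric

variable (g : SmoothMetric (EuclideanSpace ℝ (Fin n)))

section Gram

theorem form_eq_dotProduct (x u v : EuclideanSpace ℝ (Fin n)) :
    g.form x u v = u.ofLp ⬝ᵥ Matrix.mulVec (g.gram x) v.ofLp := by
  conv_lhs => rw [← sum_smul_single u, ← sum_smul_single v]
  simp only [form_eq_field, map_sum, map_smul, sum_apply, smul_apply, smul_eq_mul, gram,
    Matrix.of_apply, Matrix.mulVec, dotProduct, Finset.mul_sum]
  rw [Finset.sum_comm]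
  exact Finset.sum_congr rfl fun i _ ↦ Finset.sum_congr rfl fun j _ ↦ by ring

theorem contDiff_gram (i j : Fin n) : ContDiff ℝ ∞ (fun x ↦ g.gram x i j) :=
  g.contDiff_form _ _

theorem det_gram_ne_zero (x : EuclideanSpace ℝ (Fin n)) : (g.gram x).det ≠ 0 := by
  intro h
  obtain ⟨v, hv, hv0⟩ := Matrix.exists_mulVec_eq_zero_iff.2 h
  have hpos := g.form_self_pos x (u := WithLp.toLp 2 v) (by simpa using hv)
  simp [form_eq_dotProduct, hv0] at hpos

theorem contDiff_gram_inv (i j : Fin n) : ContDiff ℝ ∞ (fun x ↦ (g.gram x)⁻¹ i j) := by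
  have hinv : (fun x ↦ (g.gram x)⁻¹ i j) =
      fun x ↦ ((g.gram x).det)⁻¹ * (g.gram x).adjugate i j := by
    ext x
    simp [Matrix.inv_def, Ring.inverse_eq_inv']
  have hdet : ContDiff ℝ ∞ (fun x ↦ (g.gram x).det) := by
    simp only [Matrix.det_apply']
    exact ContDiff.sum fun σ _ ↦ contDiff_const.mul (contDiff_prod fun i _ ↦ g.contDiff_gram _ _)
  rw [hinv]
  refine (hdet.inv g.det_gram_ne_zero).mul ?_
  simp only [Matrix.adjugate_apply, Matrix.det_apply']
  refine ContDiff.sum fun σ _ ↦ contDiff_const.mul (contDiff_prod fun k _ ↦ ?_)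
  by_cases hk : σ k = j
  · simp only [hk, Matrix.updateRow_self]
    exact contDiff_const
  · simp only [Matrix.updateRow_ne hk]
    exact g.contDiff_gram _ _

end Gram

section Christoffel

theorem contDiff_christoffel (k i j : Fin n) : ContDiff ℝ ∞ (g.christoffel k i j) :=
  contDiff_const.mul <| ContDiff.sum fun _ _ ↦ (g.contDiff_gram_inv _ _).mul <|
    ((contDiff_partialDeriv _ (g.contDiff_gram _ _)).add
      (contDiff_partialDeriv _ (g.contDiff_gram _ _))).sub
      (contDiff_partialDeriv _ (g.contDiff_gram _ _))

theorem gram_mulVec_christoffel (x : EuclideanSpace ℝ (Fin n)) (i j : Fin n) :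
    Matrix.mulVec (g.gram x) (fun k ↦ g.christoffel k i j x) = (1 / 2 : ℝ) • fun l ↦
      partialDeriv i (fun y ↦ g.gram y j l) x + partialDeriv j (fun y ↦ g.gram y i l) x
        - partialDeriv l (fun y ↦ g.gram y i j) x := by
  have hinv : g.gram x * (g.gram x)⁻¹ = 1 :=
    Matrix.mul_nonsing_inv _ (isUnit_iff_ne_zero.2 (g.det_gram_ne_zero x))
  have hchristoffel : (fun k ↦ g.christoffel k i j x) =
      (1 / 2 : ℝ) • Matrix.mulVec (g.gram x)⁻¹ fun l ↦
        partialDeriv i (fun y ↦ g.gram y j l) x + partialDeriv j (fun y ↦ g.gram y i l) x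
          - partialDeriv l (fun y ↦ g.gram y i j) x := rfl
  rw [hchristoffel, Matrix.mulVec_smul, Matrix.mulVec_mulVec, hinv, Matrix.one_mulVec]

/-- The Christoffel symbols as a field of bilinear maps: `Γ(u, v) = ∑ Γᵏᵢⱼ uⁱ vʲ ∂ₖ`. -/
def christoffelMap (x : EuclideanSpace ℝ (Fin n)) :
    EuclideanSpace ℝ (Fin n) →L[ℝ] EuclideanSpace ℝ (Fin n) →L[ℝ] EuclideanSpace ℝ (Fin n) :=
  ∑ k, ∑ i, ∑ j, g.christoffel k i j x •
    (EuclideanSpace.proj i : EuclideanSpace ℝ (Fin n) →L[ℝ] ℝ).smulRight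
      ((EuclideanSpace.proj j : EuclideanSpace ℝ (Fin n) →L[ℝ] ℝ).smulRight
        (EuclideanSpace.single k (1 : ℝ)))

theorem christoffelMap_apply (x u v : EuclideanSpace ℝ (Fin n)) (k : Fin n) :
    g.christoffelMap x u v k = ∑ i, ∑ j, g.christoffel k i j x * u i * v j := by
  simp [christoffelMap, Finset.sum_apply, Pi.single_apply, Finset.sum_ite_eq, mul_assoc]

theorem contDiff_christoffelMap : ContDiff ℝ ∞ g.christoffelMap := by
  refine contDiff_bilinear_iff.2 fun u v ↦ contDiff_euclidean.2 fun k ↦ ?_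
  simp only [christoffelMap_apply]
  exact ContDiff.sum fun i _ ↦ ContDiff.sum fun j _ ↦
    ((g.contDiff_christoffel k i j).mul contDiff_const).mul contDiff_const

theorem christoffelMap_single (x : EuclideanSpace ℝ (Fin n)) (i j : Fin n) :
    g.christoffelMap x (EuclideanSpace.single i 1) (EuclideanSpace.single j 1) =
      WithLp.toLp 2 fun k ↦ g.christoffel k i j x := by
  ext k
  simp [christoffelMap_apply]

theorem two_mul_form_christoffelMap_single (x : EuclideanSpace ℝ (Fin n)) (i j l : Fin n) :
    2 * g.form x (g.christoffelMap x (EuclideanSpace.single i 1) (EuclideanSpace.single j 1))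
      (EuclideanSpace.single l 1) =
    partialDeriv i (fun y ↦ g.gram y j l) x + partialDeriv j (fun y ↦ g.gram y i l) x
      - partialDeriv l (fun y ↦ g.gram y i j) x := by
  rw [g.form_comm, form_eq_dotProduct, christoffelMap_single, gram_mulVec_christoffel]
  simp

theorem partialDeriv_gram (x : EuclideanSpace ℝ (Fin n)) (i j k : Fin n) :
    partialDeriv k (fun y ↦ g.gram y i j) x = fderiv ℝ g.field x (EuclideanSpace.single k 1)
      (EuclideanSpace.single i 1) (EuclideanSpace.single j 1) :=
  fderiv_apply_apply_const (g.contDiff_field.differentiable (by simp) x) _ _ _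

theorem isLeviCivita : IsLeviCivita g.field g.christoffelMap where
  contDiff_metric := g.contDiff_field
  contDiff := g.contDiff_christoffelMap
  symm := g.form_comm
  pos x u hu := g.form_self_pos x hu
  koszul x := koszul_of_basis (EuclideanSpace.basisFun (Fin n) ℝ).toBasis fun i j k ↦ by
    simp only [OrthonormalBasis.coe_toBasis, EuclideanSpace.basisFun_apply, ← partialDeriv_gram]
    exact g.two_mul_form_christoffelMap_single x i j k

end Christoffel

section CurvatureOp

theorem fderiv_christoffelMap_apply (x u v w : EuclideanSpace ℝ (Fin n)) (l : Fin n) :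
    fderiv ℝ g.christoffelMap x u v w l =
      ∑ i, ∑ j, ∑ k, partialDeriv i (g.christoffel l j k) x * u i * v j * w k := by
  have hvw : DifferentiableAt ℝ (fun y ↦ g.christoffelMap y v w) x :=
    ((g.contDiff_christoffelMap.clm_apply contDiff_const).clm_apply
      contDiff_const).differentiable (by simp) x
  have hcoord : fderiv ℝ g.christoffelMap x u v w l =
      fderiv ℝ (fun y ↦ g.christoffelMap y v w l) x u := by
    rw [← fderiv_apply_apply_const (g.isLeviCivita.differentiableAt x)]
    exact congrArg (fun L : EuclideanSpace ℝ (Fin n) →L[ℝ] ℝ ↦ L u)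
      ((EuclideanSpace.proj l : EuclideanSpace ℝ (Fin n) →L[ℝ] ℝ).hasFDerivAt.comp x
        hvw.hasFDerivAt).fderiv.symm
  have hd (j k : Fin n) := (g.contDiff_christoffel l j k).differentiable (by simp) x
  have hdjk (j k : Fin n) := ((hd j k).mul_const (v j)).mul_const (w k)
  have hterm (j k : Fin n) : fderiv ℝ (fun y ↦ g.christoffel l j k y * v j * w k) x u =
      ∑ i, partialDeriv i (g.christoffel l j k) x * u i * v j * w k := by
    rw [fderiv_mul_const ((hd j k).mul_const _), fderiv_mul_const (hd j k), smul_apply, smul_apply,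
      fderiv_apply_eq_sum_partialDeriv, smul_eq_mul, smul_eq_mul, Finset.mul_sum, Finset.mul_sum]
    exact Finset.sum_congr rfl fun i _ ↦ by ring
  simp only [hcoord, christoffelMap_apply]
  rw [fderiv_fun_sum fun j _ ↦ DifferentiableAt.fun_sum fun k _ ↦ hdjk j k, sum_apply,
    Finset.sum_comm]
  refine Finset.sum_congr rfl fun j _ ↦ ?_
  rw [fderiv_fun_sum fun k _ ↦ hdjk j k, sum_apply, Finset.sum_comm]
  exact Finset.sum_congr rfl fun k _ ↦ hterm j k

theorem christoffelMap_christoffelMap_apply (x u v w : EuclideanSpace ℝ (Fin n)) (l : Fin n) :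
    g.christoffelMap x u (g.christoffelMap x v w) l =
      ∑ i, ∑ j, ∑ k, (∑ m, g.christoffel m j k x * g.christoffel l i m x) * u i * v j * w k := by
  simp only [christoffelMap_apply, Finset.mul_sum, Finset.sum_mul]
  refine Finset.sum_congr rfl fun i _ ↦ ?_
  rw [Finset.sum_comm]
  refine Finset.sum_congr rfl fun j _ ↦ ?_
  rw [Finset.sum_comm]
  exact Finset.sum_congr rfl fun k _ ↦ Finset.sum_congr rfl fun m _ ↦ by ring

theorem curvatureOp_eq_connectionCurvature (x u v w : EuclideanSpace ℝ (Fin n)) :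
    g.curvatureOp x u v w = connectionCurvature g.christoffelMap x u v w := by
  ext l
  simp only [curvatureOp, connectionCurvature, PiLp.sub_apply, PiLp.add_apply,
    fderiv_christoffelMap_apply, christoffelMap_christoffelMap_apply]
  rw [Finset.sum_comm
      (f := fun i j ↦ ∑ k, partialDeriv i (g.christoffel l j k) x * v i * u j * w k),
    Finset.sum_comm (f := fun i j ↦ ∑ k, (∑ m, g.christoffel m j k x * g.christoffel l i m x)
      * v i * u j * w k)]
  simp only [← Finset.sum_sub_distrib, ← Finset.sum_add_distrib]
  refine Finset.sum_congr rfl fun i _ ↦ Finset.sum_congr rfl fun j _ ↦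
    Finset.sum_congr rfl fun k _ ↦ ?_
  simp only [riemann, Finset.sum_sub_distrib]
  ring

end CurvatureOp

section SectionalCurvature

theorem sectionalCurvature_lincomb (x e f : EuclideanSpace ℝ (Fin n)) {a b c : ℝ}
    (ha : a ≠ 0) (hc : c ≠ 0) :
    g.sectionalCurvature x (a • e) (b • e + c • f) = g.sectionalCurvature x e f := by
  have hden : g.form x (a • e) (a • e) * g.form x (b • e + c • f) (b • e + c • f)
      - g.form x (a • e) (b • e + c • f) ^ 2 =
      (a * c) ^ 2 * (g.form x e e * g.form x f f - g.form x e f ^ 2) := by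
    have hcomm : g.field x f e = g.field x e f := g.form_comm x f e
    simp only [form_eq_field, map_add, map_smul, add_apply, smul_apply, smul_eq_mul, hcomm]
    ring
  simp only [sectionalCurvature, curvatureOp_eq_connectionCurvature, hden]
  rw [g.form_eq_field, g.isLeviCivita.metric_curvature_lincomb,
    mul_div_mul_left _ _ (by positivity)]
  rfl

theorem form_sq_lt_of_linearIndependent (x : EuclideanSpace ℝ (Fin n))
    {u v : EuclideanSpace ℝ (Fin n)} (h : LinearIndependent ℝ ![u, v]) :
    g.form x u v ^ 2 < g.form x u u * g.form x v v := by
  have hu : 0 < g.form x u u := g.form_self_pos x (h.ne_zero 0)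
  have hw : g.form x u u • v - g.form x u v • u ≠ 0 := by
    intro h0
    have hcoeff := LinearIndependent.pair_iff.1 h (-g.form x u v) (g.form x u u) (by
      rw [← h0]; module)
    exact hu.ne' hcoeff.2
  have hself : g.form x (g.form x u u • v - g.form x u v • u)
      (g.form x u u • v - g.form x u v • u)
      = g.form x u u * (g.form x u u * g.form x v v - g.form x u v ^ 2) := by
    have hcomm : g.field x v u = g.field x u v := g.form_comm x v u
    simp only [form_eq_field, map_sub, map_smul, sub_apply, smul_apply, smul_eq_mul, hcomm]
    ring
  exact sub_pos.1 (pos_of_mul_pos_right (hself ▸ g.form_self_pos x hw) hu.le)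

theorem continuousOn_sectionalCurvature :
    ContinuousOn (fun p : EuclideanSpace ℝ (Fin n) × EuclideanSpace ℝ (Fin n) ×
      EuclideanSpace ℝ (Fin n) ↦ g.sectionalCurvature p.1 p.2.1 p.2.2)
      {p | LinearIndependent ℝ ![p.2.1, p.2.2]} := by
  have hu : Continuous fun p : EuclideanSpace ℝ (Fin n) × EuclideanSpace ℝ (Fin n) ×
      EuclideanSpace ℝ (Fin n) ↦ p.2.1 := by fun_prop
  have hv : Continuous fun p : EuclideanSpace ℝ (Fin n) × EuclideanSpace ℝ (Fin n) ×
      EuclideanSpace ℝ (Fin n) ↦ p.2.2 := by fun_prop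
  simp only [sectionalCurvature, curvatureOp_eq_connectionCurvature]
  exact (g.continuous_form_comp continuous_fst g.isLeviCivita.continuous_curvature
    hu).continuousOn.div (((g.continuous_form_comp continuous_fst hu hu).mul
      (g.continuous_form_comp continuous_fst hv hv)).sub
      ((g.continuous_form_comp continuous_fst hu hv).pow 2)).continuousOn
    fun p hp ↦ (sub_pos.2 (g.form_sq_lt_of_linearIndependent p.1 hp)).ne'

theorem exists_sectionalCurvature_bound {K : Set (EuclideanSpace ℝ (Fin n))} (hK : IsCompact K) :
    ∃ C : ℝ, 0 < C ∧ ∀ x ∈ K, ∀ u v : EuclideanSpace ℝ (Fin n),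
      LinearIndependent ℝ ![u, v] → |g.sectionalCurvature x u v| ≤ C := by
  let S : Set (EuclideanSpace ℝ (Fin n) × EuclideanSpace ℝ (Fin n) × EuclideanSpace ℝ (Fin n)) :=
    K ×ˢ ((Metric.sphere 0 1 ×ˢ Metric.sphere 0 1) ∩ {p | (inner ℝ p.1 p.2 : ℝ) = 0})
  have hS : IsCompact S :=
    hK.prod (((isCompact_sphere 0 1).prod (isCompact_sphere 0 1)).inter_right
      (isClosed_eq (by fun_prop) continuous_const))
  have hindep : ∀ p ∈ S, LinearIndependent ℝ ![p.2.1, p.2.2] := by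
    rintro ⟨x, e, f⟩ ⟨-, ⟨he, hf⟩, hef⟩
    exact linearIndependent_pair_of_inner_eq_zero (by simpa using he) (by simpa using hf) hef
  obtain ⟨C, hC⟩ := hS.exists_bound_of_continuousOn (g.continuousOn_sectionalCurvature.mono hindep)
  refine ⟨max C 1, by positivity, fun x hx u v huv ↦ le_max_of_le_left ?_⟩
  obtain ⟨e, f, he, hf, hef, a, b, c, ha, hc, rfl, rfl⟩ :=
    exists_orthonormal_pair_of_linearIndependent huv
  rw [g.sectionalCurvature_lincomb x e f ha hc]
  exact hC (x, e, f) ⟨hx, ⟨by simpa using he, by simpa using hf⟩, hef⟩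

theorem sectionalCurvature_of_isHomothetyAt {g h : SmoothMetric (EuclideanSpace ℝ (Fin n))}
    {Ψ : EuclideanSpace ℝ (Fin n) → EuclideanSpace ℝ (Fin n)} (hΨ : ContDiff ℝ 3 Ψ)
    {c : ℝ} (hc : c ≠ 0) {x : EuclideanSpace ℝ (Fin n)}
    (hiso : IsHomothetyAt h.field g.field Ψ c x) (u v : EuclideanSpace ℝ (Fin n)) :
    g.sectionalCurvature (Ψ x) (fderiv ℝ Ψ x u) (fderiv ℝ Ψ x v)
      = h.sectionalCurvature x u v / c ^ 2 := by
  have hcurv := g.isLeviCivita.map_curvature_of_isHomothetyAt h.isLeviCivita hΨ hc hiso u v v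
  have hform (u v : EuclideanSpace ℝ (Fin n)) :
      g.form (Ψ x) (fderiv ℝ Ψ x u) (fderiv ℝ Ψ x v) = c ^ 2 * h.form x u v :=
    hiso.self_of_nhds u v
  simp only [sectionalCurvature, curvatureOp_eq_connectionCurvature, ← hcurv, hform]
  field_simp

end SectionalCurvature

end SmoothMetric

end Coordinates

section PerturbationOfIdentity

section Cutoff

variable (E : Type*) [NormedAddCommGroup E] [InnerProductSpace ℝ E] [FiniteDimensional ℝ E]

theorem exists_cutoff_norm_fderiv_le : ∃ C : ℝ, 0 ≤ C ∧ ∀ δ : ℝ, 0 < δ → ∃ ψ : E → ℝ,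
    ContDiff ℝ ∞ ψ ∧ (∀ y, ‖y‖ ≤ δ → ψ y = 1) ∧ (∀ y, 2 * δ ≤ ‖y‖ → ψ y = 0) ∧
      (∀ y, ‖ψ y‖ ≤ 1) ∧ ∀ y, ‖fderiv ℝ ψ y‖ ≤ C / δ := by
  let χ : ContDiffBump (0 : E) := ⟨1, 2, one_pos, one_lt_two⟩
  have hχ : ContDiff ℝ ∞ χ := χ.contDiff
  obtain ⟨C, hC⟩ := (χ.hasCompactSupport.fderiv (𝕜 := ℝ)).exists_bound_of_continuous
    (hχ.continuous_fderiv (by simp))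
  refine ⟨C, (norm_nonneg _).trans (hC 0), fun δ hδ ↦ ⟨fun y ↦ χ (δ⁻¹ • y),
    hχ.comp (contDiff_const_smul _), fun y hy ↦ ?_, fun y hy ↦ ?_, fun y ↦ ?_, fun y ↦ ?_⟩⟩
  · apply χ.one_of_mem_closedBall
    rw [mem_closedBall_zero_iff, norm_smul, Real.norm_of_nonneg (by positivity)]
    exact inv_mul_le_one_of_le₀ hy hδ.le
  · apply χ.zero_of_le_dist
    rwa [dist_zero_right, norm_smul, Real.norm_of_nonneg (by positivity), ← div_eq_inv_mul,
      le_div_iff₀ hδ]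
  · rw [Real.norm_of_nonneg χ.nonneg]
    exact χ.le_one
  · have hscale : fderiv ℝ (fun y ↦ χ (δ⁻¹ • y)) y = δ⁻¹ • fderiv ℝ χ (δ⁻¹ • y) :=
      fderiv_comp_smul _
    rw [hscale, norm_smul, Real.norm_of_nonneg (by positivity), div_eq_inv_mul]
    gcongr
    exact hC _

end Cutoff

section SmallExtension

variable {E F : Type*} [NormedAddCommGroup E] [NormedAddCommGroup F] [NormedSpace ℝ F]

theorem exists_norm_fderiv_le_norm_le_of_fderiv_eq_zero [NormedSpace ℝ E] {R : E → F}
    (hR : ContDiff ℝ 1 R) (h0 : R 0 = 0) (hd0 : fderiv ℝ R 0 = 0) {κ : ℝ} (hκ : 0 < κ) :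
    ∃ δ > 0, ∀ y, ‖y‖ < δ → ‖fderiv ℝ R y‖ ≤ κ ∧ ‖R y‖ ≤ κ * ‖y‖ := by
  obtain ⟨δ, hδ, hball⟩ := Metric.continuousAt_iff.1
    ((hR.continuous_fderiv one_ne_zero).continuousAt (x := 0)) κ hκ
  have hfderiv (y : E) (hy : ‖y‖ < δ) : ‖fderiv ℝ R y‖ ≤ κ := by
    have := hball (x := y) (by simpa using hy)
    rw [hd0, dist_zero_right] at this
    exact this.le
  refine ⟨δ, hδ, fun y hy ↦ ⟨hfderiv y hy, ?_⟩⟩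
  simpa [h0] using (convex_ball (0 : E) δ).norm_image_sub_le_of_norm_fderiv_le (f := R) (𝕜 := ℝ)
    (fun z _ ↦ hR.differentiable one_ne_zero z) (fun z hz ↦ hfderiv z (by simpa using hz))
    (Metric.mem_ball_self hδ) (by simpa using hy : y ∈ Metric.ball 0 δ)

theorem exists_extension_norm_fderiv_le [InnerProductSpace ℝ E] [FiniteDimensional ℝ E]
    {R : E → F} (hR : ContDiff ℝ ∞ R) (h0 : R 0 = 0) (hd0 : fderiv ℝ R 0 = 0) {c ρ : ℝ}
    (hc : 0 < c) (hρ : 0 < ρ) :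
    ∃ (S : E → F) (r : ℝ), 0 < r ∧ ContDiff ℝ ∞ S ∧ (∀ y, ‖y‖ < r → S y = R y) ∧
      (∀ y, ρ ≤ ‖y‖ → S y = 0) ∧ ∀ y, ‖fderiv ℝ S y‖ ≤ c := by
  obtain ⟨C, hC, hcutoff⟩ := exists_cutoff_norm_fderiv_le E
  obtain ⟨δ₁, hδ₁, hsmall⟩ := exists_norm_fderiv_le_norm_le_of_fderiv_eq_zero
    (hR.of_le (by simp)) h0 hd0 (κ := c / (1 + 2 * C)) (by positivity)
  obtain ⟨δ, hδ, hδδ₁, hδρ⟩ : ∃ δ : ℝ, 0 < δ ∧ 2 * δ < δ₁ ∧ 2 * δ ≤ ρ :=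
    ⟨min δ₁ ρ / 4, by positivity, by linarith [min_le_left δ₁ ρ],
      by linarith [min_le_right δ₁ ρ, lt_min hδ₁ hρ]⟩
  obtain ⟨ψ, hψ, hψ1, hψ0, hψle, hdψ⟩ := hcutoff δ hδ
  have hfar (y : E) (hy : 2 * δ ≤ ‖y‖) : ψ y • R y = 0 := by rw [hψ0 y hy, zero_smul]
  refine ⟨fun y ↦ ψ y • R y, δ, hδ, hψ.smul hR, fun y hy ↦ by simp [hψ1 y hy.le],
    fun y hy ↦ hfar y (hδρ.trans hy), fun y ↦ ?_⟩
  rcases le_or_gt ‖y‖ (2 * δ) with hy | hy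
  · obtain ⟨hdR, hRle⟩ := hsmall y (hy.trans_lt hδδ₁)
    rw [fderiv_fun_smul (hψ.differentiable (by simp) y) (hR.differentiable (by simp) y)]
    calc ‖ψ y • fderiv ℝ R y + (fderiv ℝ ψ y).smulRight (R y)‖
        ≤ ‖ψ y‖ * ‖fderiv ℝ R y‖ + ‖fderiv ℝ ψ y‖ * ‖R y‖ := by
          rw [← norm_smul, ← ContinuousLinearMap.norm_smulRight_apply]
          exact norm_add_le _ _
      _ ≤ 1 * (c / (1 + 2 * C)) + C / δ * (c / (1 + 2 * C) * (2 * δ)) := by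
          gcongr
          · exact hψle y
          · exact hdψ y
          · exact hRle.trans (by gcongr)
      _ = c := by field_simp
  · have hzero : (fun y ↦ ψ y • R y) =ᶠ[nhds y] fun _ ↦ 0 := by
      filter_upwards [continuous_norm.continuousAt.eventually (lt_mem_nhds hy)] with z hz
        using hfar z hz.le
    simpa [hzero.fderiv_eq] using hc.le

end SmallExtension

section Inverse

variable {E : Type*} [NormedAddCommGroup E] [NormedSpace ℝ E] [CompleteSpace E]

/-- The homeomorphism `y ↦ y + S y` of a Banach space, for a contraction `S`. -/
def homeomorphIdAdd {S : E → E} {c : NNReal} (hc : c < 1) (hS : LipschitzWith c S) : E ≃ₜ E :=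
  ApproximatesLinearOn.toHomeomorph (f := fun y ↦ y + S y)
    (f' := ContinuousLinearEquiv.refl ℝ E) (c := c)
    (fun x _ y _ ↦ by
      simpa [add_sub_add_comm] using hS.norm_sub_le x y)
    (by
      rcases subsingleton_or_nontrivial E with h | h
      · exact Or.inl h
      · right
        simpa using hc)

theorem homeomorphIdAdd_apply {S : E → E} {c : NNReal} (hc : c < 1) (hS : LipschitzWith c S)
    (y : E) : homeomorphIdAdd hc hS y = y + S y := rfl

theorem contDiff_homeomorphIdAdd_symm {S : E → E} {c : NNReal} (hc : c < 1)
    (hS : LipschitzWith c S) {k : WithTop ℕ∞} (hk : k ≠ 0) (hSk : ContDiff ℝ k S) :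
    ContDiff ℝ k (homeomorphIdAdd hc hS).symm := by
  have hnorm (y : E) : ‖-fderiv ℝ S y‖ < 1 := by
    rw [norm_neg]
    exact (norm_fderiv_le_of_lipschitz ℝ hS).trans_lt hc
  refine Homeomorph.contDiff_symm _ (f₀' := fun y ↦
    ContinuousLinearEquiv.ofUnit (Units.oneSub (-fderiv ℝ S y) (hnorm y))) (fun y ↦ ?_)
    (contDiff_id.add hSk)
  convert (hasFDerivAt_id y).add (hSk.differentiable hk y).hasFDerivAt using 1
  · rfl
  · exact sub_neg_eq_add (ContinuousLinearMap.id ℝ E) (fderiv ℝ S y)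

end Inverse

end PerturbationOfIdentity

section Profile

/-- A smooth function equal to `1` for `s ≤ 1` and to `s ^ p` for `s ≥ 4`. -/
def powerProfile (p : ℕ) (s : ℝ) : ℝ := 1 + Real.smoothTransition ((s - 1) / 3) * (s ^ p - 1)

theorem contDiff_powerProfile (p : ℕ) : ContDiff ℝ ∞ (powerProfile p) := by
  have hcut : ContDiff ℝ ∞ fun s : ℝ ↦ Real.smoothTransition ((s - 1) / 3) :=
    Real.smoothTransition.contDiff.comp (by fun_prop)
  exact contDiff_const.add (hcut.mul (by fun_prop))

theorem powerProfile_of_le_one (p : ℕ) {s : ℝ} (hs : s ≤ 1) : powerProfile p s = 1 := by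
  simp [powerProfile, Real.smoothTransition.zero_of_nonpos (show (s - 1) / 3 ≤ 0 by linarith)]

theorem powerProfile_of_four_le (p : ℕ) {s : ℝ} (hs : 4 ≤ s) : powerProfile p s = s ^ p := by
  simp [powerProfile, Real.smoothTransition.one_of_one_le (show 1 ≤ (s - 1) / 3 by linarith)]

theorem one_le_powerProfile (p : ℕ) (s : ℝ) : 1 ≤ powerProfile p s := by
  rcases le_total s 1 with h | h
  · rw [powerProfile_of_le_one p h]
  · exact le_add_of_nonneg_right (mul_nonneg (Real.smoothTransition.nonneg _)
      (sub_nonneg.2 (one_le_pow₀ h)))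

theorem powerProfile_le (p : ℕ) {s : ℝ} (hs : 0 ≤ s) : powerProfile p s ≤ (1 + s) ^ p := by
  rcases le_total s 1 with h | h
  · rw [powerProfile_of_le_one p h]
    exact one_le_pow₀ (by linarith)
  · calc powerProfile p s ≤ 1 + 1 * (s ^ p - 1) := by
          unfold powerProfile
          gcongr
          · exact sub_nonneg.2 (one_le_pow₀ h)
          · exact Real.smoothTransition.le_one _
      _ = s ^ p := by ring
      _ ≤ (1 + s) ^ p := by gcongr; linarith

/-- The length, up to `2 π`, of the collapsed circles at squared distance `s` from the core: it is
`s ^ p` away from the core and levels off at `(ε ^ 2) ^ p`, so that the core is a product. -/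
def circleProfile (p : ℕ) (ε s : ℝ) : ℝ := (ε ^ 2) ^ p * powerProfile p (s / ε ^ 2)

theorem contDiff_circleProfile (p : ℕ) (ε : ℝ) : ContDiff ℝ ∞ (circleProfile p ε) :=
  contDiff_const.mul ((contDiff_powerProfile p).comp (by fun_prop))

theorem circleProfile_pos (p : ℕ) {ε : ℝ} (hε : 0 < ε) (s : ℝ) : 0 < circleProfile p ε s :=
  mul_pos (by positivity) (one_pos.trans_le (one_le_powerProfile p _))

theorem circleProfile_of_le (p : ℕ) {ε s : ℝ} (hε : 0 < ε) (hs : s ≤ ε ^ 2) :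
    circleProfile p ε s = (ε ^ 2) ^ p := by
  rw [circleProfile, powerProfile_of_le_one p ((div_le_one (by positivity)).2 hs), mul_one]

theorem circleProfile_of_ge (p : ℕ) {ε s : ℝ} (hε : 0 < ε) (hs : 4 * ε ^ 2 ≤ s) :
    circleProfile p ε s = s ^ p := by
  rw [circleProfile, powerProfile_of_four_le p ((le_div_iff₀ (by positivity)).2 hs), ← mul_pow,
    mul_div_cancel₀ _ (by positivity)]

theorem circleProfile_le {p : ℕ} (hp : p ≠ 0) {ε s : ℝ} (hε : 0 < ε) (hs : 0 ≤ s)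
    (hs1 : ε ^ 2 + s ≤ 1) : circleProfile p ε s ≤ ε ^ 2 + s := by
  calc circleProfile p ε s ≤ (ε ^ 2) ^ p * (1 + s / ε ^ 2) ^ p := by
        unfold circleProfile
        gcongr
        exact powerProfile_le p (by positivity)
    _ = (ε ^ 2 + s) ^ p := by
        rw [← mul_pow, mul_add, mul_one, mul_div_cancel₀ _ (by positivity)]
    _ ≤ ε ^ 2 + s := pow_le_of_le_one (by positivity) hs1 hp

/-- The smooth cutoff, as a function of the squared distance to the unit circle, that localizes the
collapse: it equals `1` for `s ≤ 1 / 64` and `0` for `1 / 16 ≤ s`. -/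
def ringCutoff (s : ℝ) : ℝ := Real.smoothTransition ((1 / 16 - s) * (64 / 3))

theorem contDiff_ringCutoff : ContDiff ℝ ∞ ringCutoff :=
  Real.smoothTransition.contDiff.comp (by fun_prop)

theorem ringCutoff_of_le {s : ℝ} (hs : s ≤ 1 / 64) : ringCutoff s = 1 :=
  Real.smoothTransition.one_of_one_le (by linarith)

theorem ringCutoff_of_ge {s : ℝ} (hs : 1 / 16 ≤ s) : ringCutoff s = 0 :=
  Real.smoothTransition.zero_of_nonpos (by linarith)

end Profile

section Ring

/-- Euclidean space of dimension `d + 2`. -/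
abbrev Euc (d : ℕ) : Type := EuclideanSpace ℝ (Fin (d + 2))

variable {d : ℕ}

namespace Euc

theorem inner_single_right (u : Euc d) (i : Fin (d + 2)) :
    inner ℝ u (EuclideanSpace.single i (1 : ℝ)) = u i := by
  simp [EuclideanSpace.inner_single_right]

theorem inner_single_left (u : Euc d) (i : Fin (d + 2)) :
    inner ℝ (EuclideanSpace.single i (1 : ℝ)) u = u i := by
  rw [real_inner_comm, inner_single_right]

theorem coord_sq_add_coord_sq_le (m : Euc d) : m 0 ^ 2 + m 1 ^ 2 ≤ ‖m‖ ^ 2 := by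
  rw [EuclideanSpace.norm_sq_eq, Fin.sum_univ_succ, Fin.sum_univ_succ]
  have hrest : 0 ≤ ∑ i : Fin d, ‖m i.succ.succ‖ ^ 2 := Finset.sum_nonneg fun i _ ↦ sq_nonneg _
  simpa [← add_assoc] using hrest

/-- The squared distance to the axis `ℝ e₀`. -/
def tubeSq (y : Euc d) : ℝ := ‖y‖ ^ 2 - y 0 ^ 2

theorem coord_one_sq_le_tubeSq (y : Euc d) : y 1 ^ 2 ≤ tubeSq y := by
  have := coord_sq_add_coord_sq_le y
  unfold tubeSq; linarith

theorem tubeSq_nonneg (y : Euc d) : 0 ≤ tubeSq y :=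
  (sq_nonneg _).trans (coord_one_sq_le_tubeSq y)

theorem contDiff_coord (i : Fin (d + 2)) : ContDiff ℝ ∞ (fun y : Euc d ↦ y i) := by
  fun_prop

theorem contDiff_tubeSq : ContDiff ℝ ∞ (tubeSq (d := d)) :=
  (contDiff_norm_sq ℝ).sub ((contDiff_coord 0).pow 2)

/-- The diagonal map with entries `a, b, …, b`. -/
def axisScale (a b : ℝ) : Euc d →L[ℝ] Euc d :=
  b • ContinuousLinearMap.id ℝ (Euc d) +
    (a - b) • (EuclideanSpace.proj 0 : Euc d →L[ℝ] ℝ).smulRight (EuclideanSpace.single 0 1)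

theorem axisScale_apply_zero (a b : ℝ) (x : Euc d) : axisScale a b x 0 = a * x 0 := by
  simp [axisScale]; ring

theorem axisScale_apply_of_ne (a b : ℝ) (x : Euc d) {i : Fin (d + 2)} (hi : i ≠ 0) :
    axisScale a b x i = b * x i := by
  simp [axisScale, hi]

theorem axisScale_axisScale (a b a' b' : ℝ) (x : Euc d) :
    axisScale a b (axisScale a' b' x) = axisScale (a * a') (b * b') x := by
  ext i
  by_cases hi : i = 0
  · subst hi; simp only [axisScale_apply_zero]; ring
  · simp only [axisScale_apply_of_ne _ _ _ hi]; ring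

theorem axisScale_one_one (x : Euc d) : axisScale 1 1 x = x := by
  ext i
  by_cases hi : i = 0
  · subst hi; rw [axisScale_apply_zero, one_mul]
  · rw [axisScale_apply_of_ne _ _ _ hi, one_mul]

theorem inner_axisScale_axisScale (a b : ℝ) (x y : Euc d) :
    inner ℝ (axisScale a b x) (axisScale a b y) =
      b ^ 2 * inner ℝ x y + (a ^ 2 - b ^ 2) * (x 0 * y 0) := by
  have hdecomp (x : Euc d) :
      axisScale a b x = b • x + ((a - b) * x 0) • EuclideanSpace.single 0 (1 : ℝ) := by
    simp [axisScale, smul_smul]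
  simp only [hdecomp, inner_add_left, inner_add_right, real_inner_smul_left,
    real_inner_smul_right, inner_single_right, inner_single_left, PiLp.single_eq_same]
  ring

theorem tubeSq_axisScale (a b : ℝ) (x : Euc d) : tubeSq (axisScale a b x) = b ^ 2 * tubeSq x := by
  simp only [tubeSq, ← real_inner_self_eq_norm_sq, inner_axisScale_axisScale, axisScale_apply_zero]
  ring

/-- The radius in the plane of the first two coordinates. -/
def radius (m : Euc d) : ℝ := √(m 0 ^ 2 + m 1 ^ 2)

theorem radius_sq (m : Euc d) : radius m ^ 2 = m 0 ^ 2 + m 1 ^ 2 :=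
  Real.sq_sqrt (by positivity)

theorem contDiffAt_radius {m : Euc d} (h : radius m ≠ 0) : ContDiffAt ℝ ∞ (radius (d := d)) m := by
  unfold radius
  refine ContDiffAt.sqrt ?_ ?_
  · exact (((contDiff_coord 0).pow 2).add ((contDiff_coord 1).pow 2)).contDiffAt
  · rw [← radius_sq]; positivity

theorem continuous_radius : Continuous (radius (d := d)) := by
  unfold radius; fun_prop

/-- The squared distance to the unit circle of the plane of the first two coordinates. -/
def ringSq (m : Euc d) : ℝ := ‖m‖ ^ 2 - 2 * radius m + 1

theorem continuous_ringSq : Continuous (ringSq (d := d)) := by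
  have := continuous_radius (d := d)
  unfold ringSq; fun_prop

theorem contDiffAt_ringSq {m : Euc d} (h : radius m ≠ 0) : ContDiffAt ℝ ∞ (ringSq (d := d)) m :=
  (((contDiff_norm_sq ℝ).contDiffAt).sub (contDiffAt_const.mul (contDiffAt_radius h))).add
    contDiffAt_const

theorem sq_le_ringSq (m : Euc d) : (radius m - 1) ^ 2 ≤ ringSq m := by
  have := coord_sq_add_coord_sq_le m
  have := radius_sq m
  unfold ringSq; nlinarith

theorem ringSq_nonneg (m : Euc d) : 0 ≤ ringSq m := (sq_nonneg _).trans (sq_le_ringSq m)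

theorem radius_gt_of_ringSq_lt {m : Euc d} (h : ringSq m < 1 / 16) : 3 / 4 < radius m := by
  have := sq_le_ringSq m
  nlinarith

theorem ringSq_of_norm_ge {m : Euc d} (h : 2 ≤ ‖m‖) : 1 ≤ ringSq m := by
  have hradius : radius m ≤ ‖m‖ :=
    Real.sqrt_le_iff.2 ⟨norm_nonneg _, coord_sq_add_coord_sq_le m⟩
  unfold ringSq; nlinarith

/-- The form `m₁ dm₀ - m₀ dm₁`. -/
def angularForm (m : Euc d) : Euc d →L[ℝ] ℝ :=
  m 1 • (EuclideanSpace.proj 0 : Euc d →L[ℝ] ℝ) - m 0 • (EuclideanSpace.proj 1 : Euc d →L[ℝ] ℝ)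

theorem angularForm_apply (m u : Euc d) : angularForm m u = m 1 * u 0 - m 0 * u 1 := by
  simp [angularForm]

theorem angularForm_sq_le (m u : Euc d) : angularForm m u ^ 2 ≤ radius m ^ 2 * ‖u‖ ^ 2 := by
  rw [angularForm_apply, radius_sq]
  calc (m 1 * u 0 - m 0 * u 1) ^ 2 ≤ (m 0 ^ 2 + m 1 ^ 2) * (u 0 ^ 2 + u 1 ^ 2) := by
        nlinarith [sq_nonneg (m 0 * u 0 + m 1 * u 1)]
    _ ≤ (m 0 ^ 2 + m 1 ^ 2) * ‖u‖ ^ 2 := by gcongr; exact coord_sq_add_coord_sq_le u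

/-- The coefficient of `angularForm ⊗ angularForm` that turns the Euclidean length `radius m` of the
circle through `m` into `circleProfile (d + 2) ε (ringSq m)` near the unit circle. -/
def ringCoeff (ε : ℝ) (m : Euc d) : ℝ :=
  ringCutoff (ringSq m) * (circleProfile (d + 2) ε (ringSq m) ^ 2 - radius m ^ 2) / radius m ^ 4

theorem ringCoeff_of_ge (ε : ℝ) {m : Euc d} (h : 1 / 16 ≤ ringSq m) : ringCoeff ε m = 0 := by
  simp [ringCoeff, ringCutoff_of_ge h]

theorem contDiff_ringCoeff (ε : ℝ) : ContDiff ℝ ∞ (ringCoeff (d := d) ε) := by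
  rw [contDiff_iff_contDiffAt]
  intro m
  by_cases h : radius m = 0
  · have hfar : 1 / 16 < ringSq m := by
      have := sq_le_ringSq m
      rw [h] at this
      linarith
    have hzero : ringCoeff (d := d) ε =ᶠ[nhds m] fun _ ↦ 0 := by
      filter_upwards [continuous_ringSq.continuousAt.eventually (lt_mem_nhds hfar)] with y hy
      exact ringCoeff_of_ge ε hy.le
    exact contDiffAt_const.congr_of_eventuallyEq hzero
  · unfold ringCoeff
    have hs := contDiffAt_ringSq h
    have hr := contDiffAt_radius h
    exact ((contDiff_ringCutoff.contDiffAt.comp m hs).mul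
      ((((contDiff_circleProfile (d + 2) ε).contDiffAt.comp m hs).pow 2).sub (hr.pow 2))).div
      (hr.pow 4) (by positivity)

theorem ringCoeff_mul_radius_sq_mem_Ioc {ε : ℝ} (hε : 0 < ε) (hε' : ε ≤ 1 / 32) (m : Euc d) :
    ringCoeff ε m * radius m ^ 2 ∈ Set.Ioc (-1) 0 := by
  rcases le_or_gt (1 / 16) (ringSq m) with h | h
  · simp [ringCoeff_of_ge ε h]
  have hr := radius_gt_of_ringSq_lt h
  have hε2 : ε ^ 2 ≤ 1 / 1024 := by nlinarith
  have hf := circleProfile_le (p := d + 2) (by simp) hε (ringSq_nonneg m) (by linarith)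
  have hf0 := circleProfile_pos (d + 2) hε (ringSq m)
  have hcoeff : ringCoeff ε m * radius m ^ 2 = ringCutoff (ringSq m) *
      (circleProfile (d + 2) ε (ringSq m) ^ 2 / radius m ^ 2 - 1) := by
    have : radius m ≠ 0 := by linarith
    unfold ringCoeff; field_simp
  have hcut0 : 0 ≤ ringCutoff (ringSq m) := Real.smoothTransition.nonneg _
  have hcut1 : ringCutoff (ringSq m) ≤ 1 := Real.smoothTransition.le_one _
  have hq0 : 0 < circleProfile (d + 2) ε (ringSq m) ^ 2 / radius m ^ 2 := by positivity
  have hq1 : circleProfile (d + 2) ε (ringSq m) ^ 2 / radius m ^ 2 ≤ 1 := by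
    rw [div_le_one (by positivity)]
    exact pow_le_pow_left₀ hf0.le (by linarith) 2
  rw [hcoeff]
  constructor <;> nlinarith

/-- The Euclidean inner product as a continuous bilinear form. -/
def innerForm : Euc d →L[ℝ] Euc d →L[ℝ] ℝ := innerSL ℝ

theorem innerForm_apply (u v : Euc d) : innerForm u v = inner ℝ u v := rfl

/-- The Euclidean metric, with the circles in the first coordinate plane shrunk near the unit
circle. -/
def ringForm (ε : ℝ) (m : Euc d) : Euc d →L[ℝ] Euc d →L[ℝ] ℝ :=
  innerForm + ringCoeff ε m • (angularForm m).smulRight (angularForm m)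

theorem ringForm_apply (ε : ℝ) (m u v : Euc d) : ringForm ε m u v =
    inner ℝ u v + ringCoeff ε m * (angularForm m u * angularForm m v) := by
  simp [ringForm, innerForm_apply]

theorem ringForm_symm (ε : ℝ) (m u v : Euc d) : ringForm ε m u v = ringForm ε m v u := by
  simp only [ringForm_apply, real_inner_comm, mul_comm]

theorem contDiff_ringForm (ε : ℝ) : ContDiff ℝ ∞ (ringForm (d := d) ε) := by
  rw [contDiff_bilinear_iff]
  intro u v
  simp only [ringForm_apply, angularForm_apply]
  have := contDiff_ringCoeff (d := d) ε
  fun_prop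

theorem ringForm_self_pos {ε : ℝ} (hε : 0 < ε) (hε' : ε ≤ 1 / 32) (m : Euc d) {u : Euc d}
    (hu : u ≠ 0) : 0 < ringForm ε m u u := by
  obtain ⟨hlower, -⟩ := ringCoeff_mul_radius_sq_mem_Ioc hε hε' m
  have hn : 0 < ‖u‖ ^ 2 := by positivity
  rw [ringForm_apply, real_inner_self_eq_norm_sq]
  rcases le_or_gt 0 (ringCoeff ε m) with hc | hc
  · exact add_pos_of_pos_of_nonneg hn (mul_nonneg hc (mul_self_nonneg _))
  · have : ringCoeff ε m * (radius m ^ 2 * ‖u‖ ^ 2) ≤ ringCoeff ε m * angularForm m u ^ 2 :=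
      mul_le_mul_of_nonpos_left (angularForm_sq_le m u) hc.le
    nlinarith

theorem ringForm_self_le {ε : ℝ} (hε : 0 < ε) (hε' : ε ≤ 1 / 32) (m u : Euc d) :
    ringForm ε m u u ≤ ‖u‖ ^ 2 := by
  obtain ⟨-, hupper⟩ := ringCoeff_mul_radius_sq_mem_Ioc hε hε' m
  rw [ringForm_apply, real_inner_self_eq_norm_sq]
  rcases lt_or_ge 0 (ringCoeff ε m) with hc | hc
  · have hr : radius m ^ 2 ≤ 0 := by
      by_contra h
      exact (mul_pos hc (not_le.1 h)).not_ge hupper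
    have hangle : angularForm m u ^ 2 ≤ 0 := (angularForm_sq_le m u).trans
      (mul_nonpos_of_nonpos_of_nonneg hr (sq_nonneg _))
    nlinarith
  · exact add_le_of_nonpos_right (mul_nonpos_of_nonpos_of_nonneg hc (mul_self_nonneg _))

theorem ringForm_of_ge (ε : ℝ) {m : Euc d} (h : 1 / 16 ≤ ringSq m) (u v : Euc d) :
    ringForm ε m u v = inner ℝ u v := by
  simp [ringForm_apply, ringCoeff_of_ge ε h]

theorem ringForm_eq_of_ge {ε ε' : ℝ} (hε0 : 0 < ε) (hε : ε ≤ 1 / 32) (hε0' : 0 < ε')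
    (hε' : ε' ≤ 1 / 32) {m : Euc d} (h : 1 / 256 ≤ ringSq m) :
    ringForm ε m = ringForm ε' m := by
  have hcoeff : ringCoeff ε m = ringCoeff ε' m := by
    unfold ringCoeff
    rw [circleProfile_of_ge _ hε0 (by nlinarith), circleProfile_of_ge _ hε0' (by nlinarith)]
  ext u v
  simp [ringForm_apply, hcoeff]

end Euc

end Ring

section RingParam

variable {d : ℕ}

namespace Euc

/-- Tubular coordinates around the unit circle: the coordinate `y₀` is the angle, and
`1 + y₁` is the radius. -/
def ringParam (y : Euc d) : Euc d :=
  y + ((1 + y 1) * Real.sin (y 0) - y 0) • EuclideanSpace.single 0 (1 : ℝ)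
    + ((1 + y 1) * Real.cos (y 0) - y 1) • EuclideanSpace.single 1 (1 : ℝ)

theorem ringParam_apply_zero (y : Euc d) : ringParam y 0 = (1 + y 1) * Real.sin (y 0) := by
  simp [ringParam]

theorem ringParam_apply_one (y : Euc d) : ringParam y 1 = (1 + y 1) * Real.cos (y 0) := by
  simp [ringParam]

theorem ringParam_apply_of_ne (y : Euc d) {i : Fin (d + 2)} (h0 : i ≠ 0) (h1 : i ≠ 1) :
    ringParam y i = y i := by
  simp [ringParam, h0, h1]

theorem ringParam_zero : ringParam (0 : Euc d) = EuclideanSpace.single 1 (1 : ℝ) := by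
  simp [ringParam]

theorem contDiff_ringParam : ContDiff ℝ ∞ (ringParam (d := d)) := by
  have h0 := contDiff_coord (d := d) 0
  have h1 := contDiff_coord (d := d) 1
  exact (contDiff_id.add ((((contDiff_const.add h1).mul h0.sin).sub h0).smul contDiff_const)).add
    ((((contDiff_const.add h1).mul h0.cos).sub h1).smul contDiff_const)

theorem fderiv_ringParam (y u : Euc d) : fderiv ℝ ringParam y u =
    u + (u 1 * Real.sin (y 0) + (1 + y 1) * Real.cos (y 0) * u 0 - u 0) •
        EuclideanSpace.single 0 (1 : ℝ)
      + (u 1 * Real.cos (y 0) - (1 + y 1) * Real.sin (y 0) * u 0 - u 1) •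
        EuclideanSpace.single 1 (1 : ℝ) := by
  have h0 : HasFDerivAt (fun y : Euc d ↦ y 0) (EuclideanSpace.proj 0 : Euc d →L[ℝ] ℝ) y :=
    (EuclideanSpace.proj 0 : Euc d →L[ℝ] ℝ).hasFDerivAt
  have h1 : HasFDerivAt (fun y : Euc d ↦ y 1) (EuclideanSpace.proj 1 : Euc d →L[ℝ] ℝ) y :=
    (EuclideanSpace.proj 1 : Euc d →L[ℝ] ℝ).hasFDerivAt
  have hsin := (((h1.const_add 1).mul h0.sin).sub h0).smul_const
    (EuclideanSpace.single 0 (1 : ℝ) : Euc d)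
  have hcos := (((h1.const_add 1).mul h0.cos).sub h1).smul_const
    (EuclideanSpace.single 1 (1 : ℝ) : Euc d)
  refine (DFunLike.congr_fun (((hasFDerivAt_id y).add hsin).add hcos).fderiv u).trans ?_
  simp only [add_apply, ContinuousLinearMap.id_apply, ContinuousLinearMap.smulRight_apply,
    sub_apply, smul_apply, PiLp.proj_apply, smul_eq_mul, neg_mul, mul_neg]
  ring_nf

theorem inner_fderiv_ringParam (y u v : Euc d) :
    inner ℝ (fderiv ℝ ringParam y u) (fderiv ℝ ringParam y v) =
      inner ℝ u v + ((1 + y 1) ^ 2 - 1) * (u 0 * v 0) := by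
  simp only [fderiv_ringParam, inner_add_left, inner_add_right, real_inner_smul_left,
    real_inner_smul_right, inner_single_right, inner_single_left]
  simp only [PiLp.single_eq_same, mul_one, ne_eq, zero_ne_one, not_false_eq_true,
    PiLp.single_eq_of_ne, mul_zero, add_zero, one_ne_zero]
  linear_combination
    (u 1 * v 1 + (1 + y 1) ^ 2 * (u 0 * v 0)) * Real.sin_sq_add_cos_sq (y 0)

theorem angularForm_fderiv_ringParam (y u : Euc d) :
    angularForm (ringParam y) (fderiv ℝ ringParam y u) = (1 + y 1) ^ 2 * u 0 := by
  rw [angularForm_apply, ringParam_apply_zero, ringParam_apply_one, fderiv_ringParam]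
  simp only [PiLp.add_apply, PiLp.smul_apply, PiLp.single_eq_same, smul_eq_mul, mul_one, ne_eq,
    add_sub_cancel, zero_ne_one, not_false_eq_true, PiLp.single_eq_of_ne, mul_zero, add_zero,
    one_ne_zero]
  linear_combination ((1 + y 1) ^ 2 * u 0) * Real.sin_sq_add_cos_sq (y 0)

theorem norm_ringParam_sq (y : Euc d) : ‖ringParam y‖ ^ 2 = tubeSq y + 1 + 2 * y 1 := by
  simp only [← real_inner_self_eq_norm_sq, tubeSq, ringParam, inner_add_left, inner_add_right,
    real_inner_smul_left, real_inner_smul_right, inner_single_right, inner_single_left]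
  simp only [PiLp.single_eq_same, mul_one, ne_eq, zero_ne_one, not_false_eq_true,
    PiLp.single_eq_of_ne, mul_zero, add_zero, one_ne_zero]
  linear_combination ((1 + y 1) ^ 2) * Real.sin_sq_add_cos_sq (y 0)

theorem one_add_coord_one_nonneg {y : Euc d} (hy : tubeSq y ≤ 1) : 0 ≤ 1 + y 1 := by
  nlinarith [coord_one_sq_le_tubeSq y]

theorem radius_ringParam {y : Euc d} (hy : tubeSq y ≤ 1) : radius (ringParam y) = 1 + y 1 := by
  have hsq : ((1 + y 1) * Real.sin (y 0)) ^ 2 + ((1 + y 1) * Real.cos (y 0)) ^ 2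
      = (1 + y 1) ^ 2 := by
    linear_combination ((1 + y 1) ^ 2) * Real.sin_sq_add_cos_sq (y 0)
  rw [radius, ringParam_apply_zero, ringParam_apply_one, hsq,
    Real.sqrt_sq (one_add_coord_one_nonneg hy)]

theorem ringSq_ringParam {y : Euc d} (hy : tubeSq y ≤ 1) : ringSq (ringParam y) = tubeSq y := by
  rw [ringSq, radius_ringParam hy, norm_ringParam_sq]
  ring

theorem exists_polar (m : Euc d) : ∃ θ : ℝ,
    |θ| ≤ Real.pi ∧ radius m * Real.sin θ = m 0 ∧ radius m * Real.cos θ = m 1 := by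
  let z : ℂ := ⟨m 1, m 0⟩
  have hz : ‖z‖ = radius m := by
    rw [Complex.norm_def, Complex.normSq_apply, radius]
    congr 1
    ring
  exact ⟨z.arg, Complex.abs_arg_le_pi z, hz ▸ Complex.norm_mul_sin_arg z,
    hz ▸ Complex.norm_mul_cos_arg z⟩

theorem exists_ringParam_eq (m : Euc d) :
    ∃ y : Euc d, |y 0| ≤ Real.pi ∧ tubeSq y = ringSq m ∧ ringParam y = m := by
  obtain ⟨θ, hθ, hsin, hcos⟩ := exists_polar m
  let y : Euc d := m + (θ - m 0) • EuclideanSpace.single 0 (1 : ℝ)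
    + (radius m - 1 - m 1) • EuclideanSpace.single 1 (1 : ℝ)
  have hy0 : y 0 = θ := by simp [y]
  have hy1 : y 1 = radius m - 1 := by simp [y]
  have hym : ringParam y = m := by
    ext i
    by_cases h0 : i = 0
    · subst h0; rw [ringParam_apply_zero, hy0, hy1, ← hsin]; ring
    by_cases h1 : i = 1
    · subst h1; rw [ringParam_apply_one, hy0, hy1, ← hcos]; ring
    · rw [ringParam_apply_of_ne y h0 h1]; simp [y, h0, h1]
  refine ⟨y, hy0 ▸ hθ, ?_, hym⟩
  have hnorm := norm_ringParam_sq y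
  rw [hym, hy1] at hnorm
  rw [ringSq]
  linarith

theorem ringForm_ringParam {ε : ℝ} {y : Euc d} (hy : tubeSq y ≤ 1 / 64) (u v : Euc d) :
    ringForm ε (ringParam y) (fderiv ℝ ringParam y u) (fderiv ℝ ringParam y v) =
      inner ℝ u v + (circleProfile (d + 2) ε (tubeSq y) ^ 2 - 1) * (u 0 * v 0) := by
  have hy1 : tubeSq y ≤ 1 := by linarith
  have hradius : 0 < 1 + y 1 := by nlinarith [coord_one_sq_le_tubeSq y]
  rw [ringForm_apply, inner_fderiv_ringParam, angularForm_fderiv_ringParam,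
    angularForm_fderiv_ringParam, ringCoeff, ringSq_ringParam hy1, radius_ringParam hy1,
    ringCutoff_of_le hy]
  field_simp
  ring

end Euc

end RingParam

section Straightening

variable {d : ℕ}

namespace Euc

/-- A diffeomorphism of Euclidean space that agrees with the tubular coordinates `ringParam` near
the origin and with a translation outside the unit ball. -/
structure Straightening (d : ℕ) where
  /-- The diffeomorphism. -/
  toFun : Euc d → Euc d
  /-- The inverse diffeomorphism. -/
  inv : Euc d → Euc d
  /-- The radius of the ball where it agrees with `ringParam`. -/
  rad : ℝ
  rad_pos : 0 < rad
  contDiff : ContDiff ℝ ∞ toFun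
  contDiff_inv : ContDiff ℝ ∞ inv
  left_inv : ∀ y, inv (toFun y) = y
  right_inv : ∀ z, toFun (inv z) = z
  eq_ringParam : ∀ y, ‖y‖ < rad → toFun y = ringParam y
  eq_translation : ∀ y, 1 ≤ ‖y‖ → toFun y = y + EuclideanSpace.single 1 1
  norm_fderiv_le : ∀ y u, ‖fderiv ℝ toFun y u‖ ≤ 2 * ‖u‖

theorem fderiv_ringParam_sub_translation_zero :
    fderiv ℝ (fun y : Euc d ↦ ringParam y - (y + EuclideanSpace.single 1 1)) 0 = 0 := by
  have hdiff := (contDiff_ringParam (d := d)).differentiable (by simp) 0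
  refine (hdiff.hasFDerivAt.sub ((hasFDerivAt_id 0).add_const _)).fderiv.trans ?_
  ext1 u
  simp [fderiv_ringParam]

theorem nonempty_straightening (d : ℕ) : Nonempty (Straightening d) := by
  let e : Euc d := EuclideanSpace.single 1 1
  obtain ⟨S, r, hr, hS, hSR, hS1, hS'⟩ := exists_extension_norm_fderiv_le
    (R := fun y : Euc d ↦ ringParam y - (y + e))
    (contDiff_ringParam.sub (contDiff_id.add contDiff_const)) (by simp [e, ringParam_zero])
    fderiv_ringParam_sub_translation_zero one_half_pos one_pos
  have hlip : LipschitzWith 2⁻¹ fun y ↦ e + S y :=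
    lipschitzWith_of_nnnorm_fderiv_le ((hS.differentiable (by simp)).const_add e) fun y ↦ by
      rw [fderiv_const_add, ← NNReal.coe_le_coe]
      simpa using hS' y
  let H := homeomorphIdAdd (by norm_num) hlip
  refine ⟨⟨H, H.symm, r, hr, contDiff_id.add (contDiff_const.add hS),
    contDiff_homeomorphIdAdd_symm _ _ (by simp) (contDiff_const.add hS), H.symm_apply_apply,
    H.apply_symm_apply, fun y hy ↦ ?_, fun y hy ↦ ?_, fun y u ↦ ?_⟩⟩
  · rw [homeomorphIdAdd_apply, hSR y hy]
    abel
  · rw [homeomorphIdAdd_apply, hS1 y hy, add_zero]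
  · have hfderiv : fderiv ℝ H y u = u + fderiv ℝ S y u := DFunLike.congr_fun
      ((hasFDerivAt_id y).add ((hS.differentiable (by simp) y).hasFDerivAt.const_add e)).fderiv u
    calc ‖fderiv ℝ H y u‖ ≤ ‖u‖ + ‖fderiv ℝ S y u‖ := hfderiv ▸ norm_add_le _ _
      _ ≤ ‖u‖ + 1 / 2 * ‖u‖ := by gcongr; exact (fderiv ℝ S y).le_of_opNorm_le (hS' y) u
      _ ≤ 2 * ‖u‖ := by linarith [norm_nonneg u]

end Euc

end Straightening

section WarpedMetric

theorem linearIndependent_map_pair {E F : Type*} [AddCommGroup E] [Module ℝ E] [AddCommGroup F]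
    [Module ℝ F] {L : E →ₗ[ℝ] F} (hL : Function.Injective L) {u v : E}
    (h : LinearIndependent ℝ ![u, v]) : LinearIndependent ℝ ![L u, L v] := by
  rw [LinearIndependent.pair_iff] at h ⊢
  exact fun s t hst ↦ h s t (hL (by simpa using hst))

variable {d : ℕ}

namespace Euc

/-- The warped product form `Φ(tubeSq)² dy₀² + dy₁² + ⋯`, where `Φ` is `powerProfile (d + 2)`: the
model of `ringForm` near the collapsed circle, rescaled to size one. -/
def warpedForm (d : ℕ) (y : Euc d) : Euc d →L[ℝ] Euc d →L[ℝ] ℝ :=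
  innerForm + (powerProfile (d + 2) (tubeSq y) ^ 2 - 1) •
    (EuclideanSpace.proj 0 : Euc d →L[ℝ] ℝ).smulRight (EuclideanSpace.proj 0 : Euc d →L[ℝ] ℝ)

theorem warpedForm_apply (y u v : Euc d) : warpedForm d y u v =
    inner ℝ u v + (powerProfile (d + 2) (tubeSq y) ^ 2 - 1) * (u 0 * v 0) := by
  simp [warpedForm, innerForm_apply]

theorem contDiff_warpedForm : ContDiff ℝ ∞ (warpedForm d) := by
  rw [contDiff_bilinear_iff]
  intro u v
  simp only [warpedForm_apply]
  exact contDiff_const.add (((((contDiff_powerProfile (d + 2)).comp contDiff_tubeSq).pow 2).sub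
    contDiff_const).mul contDiff_const)

theorem warpedForm_self_pos (y : Euc d) {u : Euc d} (hu : u ≠ 0) : 0 < warpedForm d y u u := by
  rw [warpedForm_apply, real_inner_self_eq_norm_sq]
  have hcoeff : 0 ≤ powerProfile (d + 2) (tubeSq y) ^ 2 - 1 :=
    sub_nonneg.2 (one_le_pow₀ (one_le_powerProfile _ _))
  exact add_pos_of_pos_of_nonneg (by positivity) (mul_nonneg hcoeff (mul_self_nonneg _))

/-- The warped product metric with form `warpedForm`. -/
def warpedMetric (d : ℕ) : SmoothMetric (Euc d) :=
  SmoothMetric.ofField (warpedForm d) contDiff_warpedForm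
    (fun y u v ↦ by simp only [warpedForm_apply, real_inner_comm, mul_comm])
    fun y _ hu ↦ warpedForm_self_pos y hu

theorem warpedMetric_form (y u v : Euc d) : (warpedMetric d).form y u v =
    inner ℝ u v + (powerProfile (d + 2) (tubeSq y) ^ 2 - 1) * (u 0 * v 0) :=
  warpedForm_apply y u v

theorem fderiv_axisScale_add (a b : ℝ) (z x : Euc d) :
    fderiv ℝ (fun y ↦ axisScale a b y + z) x = axisScale a b := by
  rw [fderiv_add_const]
  exact (axisScale a b).fderiv

theorem axisScale_axisScale_inv {a b : ℝ} (ha : a ≠ 0) (hb : b ≠ 0) (x : Euc d) :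
    axisScale a b (axisScale a⁻¹ b⁻¹ x) = x := by
  rw [axisScale_axisScale, mul_inv_cancel₀ ha, mul_inv_cancel₀ hb, axisScale_one_one]

theorem axisScale_inv_axisScale {a b : ℝ} (ha : a ≠ 0) (hb : b ≠ 0) (x : Euc d) :
    axisScale a⁻¹ b⁻¹ (axisScale a b x) = x := by
  rw [axisScale_axisScale, inv_mul_cancel₀ ha, inv_mul_cancel₀ hb, axisScale_one_one]

theorem injective_axisScale {a b : ℝ} (ha : a ≠ 0) (hb : b ≠ 0) :
    Function.Injective (axisScale a b : Euc d →L[ℝ] Euc d) :=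
  Function.LeftInverse.injective (g := axisScale a⁻¹ b⁻¹) (axisScale_inv_axisScale ha hb)

theorem tubeSq_add_smul_single (y : Euc d) (c : ℝ) :
    tubeSq (y + c • EuclideanSpace.single 0 (1 : ℝ)) = tubeSq y := by
  simp only [tubeSq, ← real_inner_self_eq_norm_sq, inner_add_left, inner_add_right,
    real_inner_smul_left, real_inner_smul_right, inner_single_right, inner_single_left,
    PiLp.add_apply, PiLp.smul_apply, PiLp.single_eq_same, smul_eq_mul]
  ring

theorem isHomothetyAt_warpedMetric {a b c : ℝ} {x : Euc d}
    (h : ∀ᶠ y in nhds x, powerProfile (d + 2) (b ^ 2 * tubeSq y) * a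
      = b * powerProfile (d + 2) (tubeSq y)) :
    IsHomothetyAt (warpedMetric d).field (warpedMetric d).field
      (fun y ↦ axisScale a b y + c • EuclideanSpace.single 0 (1 : ℝ)) b x := by
  filter_upwards [h] with y hy u v
  rw [fderiv_axisScale_add, ← SmoothMetric.form_eq_field, ← SmoothMetric.form_eq_field,
    warpedMetric_form, warpedMetric_form, tubeSq_add_smul_single, tubeSq_axisScale,
    inner_axisScale_axisScale, axisScale_apply_zero, axisScale_apply_zero]
  linear_combination (powerProfile (d + 2) (b ^ 2 * tubeSq y) * a
    + b * powerProfile (d + 2) (tubeSq y)) * (u 0 * v 0) * hy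

theorem sectionalCurvature_warpedMetric_axisScale {a b c : ℝ} (hb : b ≠ 0) {x : Euc d}
    (h : ∀ᶠ y in nhds x, powerProfile (d + 2) (b ^ 2 * tubeSq y) * a
      = b * powerProfile (d + 2) (tubeSq y)) (u v : Euc d) :
    (warpedMetric d).sectionalCurvature (axisScale a b x + c • EuclideanSpace.single 0 (1 : ℝ))
      (axisScale a b u) (axisScale a b v) = (warpedMetric d).sectionalCurvature x u v / b ^ 2 := by
  simpa only [fderiv_axisScale_add] using SmoothMetric.sectionalCurvature_of_isHomothetyAt
    ((axisScale a b).contDiff.add contDiff_const) hb (isHomothetyAt_warpedMetric (c := c) h) u v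

theorem isCompact_slice (d : ℕ) (s : ℝ) : IsCompact {x : Euc d | x 0 = 0 ∧ tubeSq x ≤ s} := by
  have hclosed : IsClosed {x : Euc d | x 0 = 0 ∧ tubeSq x ≤ s} :=
    (isClosed_singleton.preimage (contDiff_coord 0).continuous).inter
      (isClosed_Iic.preimage contDiff_tubeSq.continuous)
  refine (isCompact_closedBall (0 : Euc d) √s).of_isClosed_subset hclosed ?_
  rintro x ⟨hx0, hx⟩
  rw [mem_closedBall_zero_iff]
  exact Real.le_sqrt_of_sq_le (by simpa [tubeSq, hx0] using hx)

theorem abs_sectionalCurvature_warpedMetric_le_of_slice {C s a b : ℝ}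
    (hC : ∀ x : Euc d, x 0 = 0 ∧ tubeSq x ≤ s → ∀ u v, LinearIndependent ℝ ![u, v] →
      |(warpedMetric d).sectionalCurvature x u v| ≤ C)
    (ha : a ≠ 0) (hb : 0 < b) {x : Euc d} (hx : tubeSq x / b ^ 2 ≤ s)
    (hscale : ∀ᶠ t in nhds (tubeSq x / b ^ 2), powerProfile (d + 2) (b ^ 2 * t) * a
      = b * powerProfile (d + 2) t) {u v : Euc d} (huv : LinearIndependent ℝ ![u, v]) :
    |(warpedMetric d).sectionalCurvature x u v| ≤ C / b ^ 2 := by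
  let x' : Euc d := axisScale a⁻¹ b⁻¹ (x + (-x 0) • EuclideanSpace.single 0 (1 : ℝ))
  have hx'0 : x' 0 = 0 := by
    simp only [x', axisScale_apply_zero, PiLp.add_apply, PiLp.smul_apply, PiLp.single_eq_same,
      smul_eq_mul]
    ring
  have hx' : tubeSq x' = tubeSq x / b ^ 2 := by
    simp only [x', tubeSq_axisScale, tubeSq_add_smul_single]
    field_simp
  have hxx' : axisScale a b x' + x 0 • EuclideanSpace.single 0 (1 : ℝ) = x := by
    simp only [x', axisScale_axisScale_inv ha hb.ne']
    module
  have hcurv := sectionalCurvature_warpedMetric_axisScale (c := x 0) hb.ne' (x := x')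
    (contDiff_tubeSq.continuous.continuousAt.eventually (by rwa [hx']))
    (axisScale a⁻¹ b⁻¹ u) (axisScale a⁻¹ b⁻¹ v)
  rw [hxx', axisScale_axisScale_inv ha hb.ne', axisScale_axisScale_inv ha hb.ne'] at hcurv
  rw [hcurv, abs_div, abs_of_pos (by positivity : 0 < b ^ 2)]
  gcongr
  exact hC x' ⟨hx'0, hx'.trans_le hx⟩ _ _ (linearIndependent_map_pair
    (L := (axisScale a⁻¹ b⁻¹ : Euc d →L[ℝ] Euc d).toLinearMap)
    (injective_axisScale (inv_ne_zero ha) (inv_ne_zero hb.ne')) huv)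

-- Where `Φ(s) = s ^ p`, the metric is invariant, up to homothety, under anisotropic scalings; these
-- bring every point to the compact slice `y₀ = 0`, `tubeSq ≤ 9`.
theorem exists_sectionalCurvature_warpedMetric_bound (d : ℕ) : ∃ C : ℝ, 0 < C ∧
    ∀ x u v : Euc d, LinearIndependent ℝ ![u, v] →
      |(warpedMetric d).sectionalCurvature x u v| ≤ C / (1 + tubeSq x) := by
  obtain ⟨C, hC, hbound⟩ := (warpedMetric d).exists_sectionalCurvature_bound (isCompact_slice d 9)
  refine ⟨10 * C, by positivity, fun x u v huv ↦ ?_⟩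
  have hx0 := tubeSq_nonneg x
  rcases le_or_gt (tubeSq x) 9 with hnear | hfar
  · refine (abs_sectionalCurvature_warpedMetric_le_of_slice hbound one_ne_zero one_pos
      (by simpa using hnear) (by simp) huv).trans ?_
    rw [one_pow, div_one, le_div_iff₀ (by positivity)]
    nlinarith
  · set b : ℝ := √(tubeSq x) / 3 with hb
    have hb2 : b ^ 2 = tubeSq x / 9 := by
      rw [hb, div_pow, Real.sq_sqrt hx0]
      norm_num
    have hb0 : 0 < b := by positivity
    have hquot : tubeSq x / b ^ 2 = 9 := by rw [hb2]; field_simp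
    refine (abs_sectionalCurvature_warpedMetric_le_of_slice hbound
      (a := b / (b ^ 2) ^ (d + 2)) (b := b) (by positivity) hb0 hquot.le ?_ huv).trans ?_
    · rw [hquot]
      filter_upwards [lt_mem_nhds (show (4 : ℝ) < 9 by norm_num)] with s hs
      rw [powerProfile_of_four_le _ hs.le, powerProfile_of_four_le _ (by nlinarith), mul_pow]
      field_simp
    · rw [hb2, le_div_iff₀ (by positivity), div_mul_eq_mul_div, div_le_iff₀ (by positivity)]
      nlinarith

end Euc

end WarpedMetric

section GlobalMetric

variable {d : ℕ}

namespace Euc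

/-- The radius of the tube around the collapsed circle of level `k`, relative to the size of the
level. It tends to zero, which is what makes the volume growth slow. -/
def tubeRad (k : ℕ) : ℝ := 1 / (32 * (k + 1))

theorem tubeRad_pos (k : ℕ) : 0 < tubeRad k := by unfold tubeRad; positivity

theorem tubeRad_le (k : ℕ) : tubeRad k ≤ 1 / 32 := by
  unfold tubeRad
  apply one_div_le_one_div_of_le (by norm_num)
  have : (0 : ℝ) ≤ k := k.cast_nonneg
  linarith

theorem tubeRad_sq_lt (k : ℕ) : tubeRad k ^ 2 < 1 / 64 := by
  nlinarith [tubeRad_pos k, tubeRad_le k]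

/-- The factor by which the metric of level `k` contracts the core circle of its tube. -/
def circleLen (d k : ℕ) : ℝ := (tubeRad k ^ 2) ^ (d + 2)

theorem circleLen_pos (d k : ℕ) : 0 < circleLen d k := by
  have := tubeRad_pos k; unfold circleLen; positivity

theorem circleLen_le_sq (d k : ℕ) : circleLen d k ≤ tubeRad k ^ 2 :=
  pow_le_of_le_one (by positivity) (by nlinarith [tubeRad_pos k, tubeRad_le k]) (by simp)

theorem circleLen_le (d k : ℕ) : circleLen d k ≤ tubeRad k := by
  nlinarith [tubeRad_pos k, tubeRad_le k, circleLen_le_sq d k]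

theorem norm_axisScale_le {a b : ℝ} (hb : 0 ≤ b) (hab : b ≤ a) (x : Euc d) :
    ‖axisScale a b x‖ ≤ a * ‖x‖ := by
  have ha : 0 ≤ a := hb.trans hab
  refine le_of_sq_le_sq ?_ (by positivity)
  have htube : b ^ 2 * tubeSq x ≤ a ^ 2 * tubeSq x := by
    gcongr
    exact tubeSq_nonneg x
  have haxis : ‖axisScale a b x‖ ^ 2 = a ^ 2 * x 0 ^ 2 + b ^ 2 * tubeSq x := by
    rw [← tubeSq_axisScale a, tubeSq, axisScale_apply_zero]
    ring
  have hnorm : ‖x‖ ^ 2 = x 0 ^ 2 + tubeSq x := by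
    rw [tubeSq]
    ring
  rw [mul_pow, haxis, hnorm]
  linarith

theorem circleLen_le_one (d k : ℕ) : circleLen d k ≤ 1 := by
  linarith [circleLen_le d k, tubeRad_le k]

namespace Straightening

variable (S : Straightening d)

/-- The factor by which the ball of each level shrinks along the circle of the next level. It is
small enough for the ball to fit into the domain where the straightening is `ringParam`. -/
def ratio : ℝ := min S.rad 1 / 8

theorem ratio_pos : 0 < S.ratio := by
  have := S.rad_pos; unfold ratio; positivity

theorem ratio_le : S.ratio ≤ 1 / 8 := by
  unfold ratio; linarith [min_le_right S.rad 1]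

theorem ratio_lt_rad : 4 * S.ratio < S.rad := by
  have := S.rad_pos
  unfold ratio; linarith [min_le_left S.rad 1]

theorem ratio_mul_circleLen_le (k : ℕ) : S.ratio * circleLen d k ≤ tubeRad k / 8 := by
  have := mul_le_mul S.ratio_le (circleLen_le d k) (circleLen_pos d k).le (by norm_num)
  linarith

/-- The size of level `k`: the ball of level `k + 1` is larger than that of level `k` by the factor
that compensates the contraction of the circle. -/
def scale : ℕ → ℝ
  | 0 => 1
  | k + 1 => scale k / (S.ratio * circleLen d (k + 1))

theorem scale_pos (k : ℕ) : 0 < S.scale k := by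
  induction k with
  | zero => exact one_pos
  | succ k ih => exact div_pos ih (mul_pos S.ratio_pos (circleLen_pos d _))

theorem scale_succ_mul (k : ℕ) :
    S.scale (k + 1) * (S.ratio * circleLen d (k + 1)) = S.scale k := by
  have := S.ratio_pos
  have := circleLen_pos d (k + 1)
  simp only [scale]; field_simp

/-- The linear coordinates of level `k`. The ball of level `k` is the set where they have norm less
than four. -/
def coords (k : ℕ) : Euc d →L[ℝ] Euc d := axisScale (S.ratio ^ k) (S.scale k)⁻¹

theorem coords_succ (k : ℕ) (x : Euc d) : S.coords (k + 1) x =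
    axisScale S.ratio (S.ratio * circleLen d (k + 1)) (S.coords k x) := by
  have hscale := S.scale_pos (k + 1)
  have hratio := S.ratio_pos
  have hlen := circleLen_pos d (k + 1)
  rw [coords, coords, axisScale_axisScale, ← pow_succ', ← S.scale_succ_mul k]
  congr 2
  field_simp

theorem coords_zero (x : Euc d) : S.coords 0 x = x := by
  simp [coords, scale, axisScale_one_one]

theorem norm_coords_succ_le (k : ℕ) (x : Euc d) :
    ‖S.coords (k + 1) x‖ ≤ S.ratio * ‖S.coords k x‖ := by
  rw [coords_succ]
  exact norm_axisScale_le (mul_pos S.ratio_pos (circleLen_pos d _)).le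
    (mul_le_of_le_one_right S.ratio_pos.le (circleLen_le_one d _)) _

theorem norm_coords_succ_lt {k : ℕ} {x : Euc d} (h : ‖S.coords k x‖ < 4) :
    ‖S.coords (k + 1) x‖ < 1 := by
  nlinarith [S.norm_coords_succ_le k x, S.ratio_le, S.ratio_pos, norm_nonneg (S.coords k x)]

theorem norm_coords_lt_of_lt {j k : ℕ} (hjk : j < k) {x : Euc d} (h : ‖S.coords j x‖ < 4) :
    ‖S.coords k x‖ < 1 := by
  induction k, hjk using Nat.le_induction with
  | base => exact S.norm_coords_succ_lt h
  | succ k _ ih => exact S.norm_coords_succ_lt (ih.trans (by norm_num))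

theorem norm_coords_lt_of_le {j k : ℕ} (hjk : j ≤ k) {x : Euc d} (h : ‖S.coords j x‖ < 4) :
    ‖S.coords k x‖ < 4 := by
  rcases hjk.eq_or_lt with rfl | hlt
  · exact h
  · exact (S.norm_coords_lt_of_lt hlt h).trans (by norm_num)

theorem norm_coords_le (k : ℕ) (x : Euc d) : ‖S.coords k x‖ ≤ S.ratio ^ k * ‖x‖ := by
  induction k with
  | zero => simp [coords_zero]
  | succ k ih =>
    have := S.ratio_pos
    calc ‖S.coords (k + 1) x‖ ≤ S.ratio * ‖S.coords k x‖ := S.norm_coords_succ_le k x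
      _ ≤ S.ratio * (S.ratio ^ k * ‖x‖) := by gcongr
      _ = S.ratio ^ (k + 1) * ‖x‖ := by ring

theorem exists_norm_coords_lt (x : Euc d) : ∃ k, ‖S.coords k x‖ < 4 := by
  have hlim : Tendsto (fun k ↦ S.ratio ^ k * ‖x‖) atTop (nhds 0) := by
    simpa using (tendsto_pow_atTop_nhds_zero_of_lt_one S.ratio_pos.le
      (S.ratio_le.trans_lt (by norm_num))).mul_const ‖x‖
  obtain ⟨k, hk⟩ := (hlim.eventually_lt_const four_pos).exists
  exact ⟨k, (S.norm_coords_le k x).trans_lt hk⟩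

/-- The nonlinear coordinates of level `k`, in which the core of the tube is the unit circle. -/
def ringCoords (k : ℕ) (x : Euc d) : Euc d := S.toFun (S.coords k x)

theorem contDiff_ringCoords (k : ℕ) : ContDiff ℝ ∞ (S.ringCoords k) :=
  S.contDiff.comp (S.coords k).contDiff

theorem fderiv_ringCoords (k : ℕ) (x u : Euc d) : fderiv ℝ (S.ringCoords k) x u =
    fderiv ℝ S.toFun (S.coords k x) (S.coords k u) :=
  DFunLike.congr_fun ((S.contDiff.differentiable (by simp) (S.coords k x)).hasFDerivAt.comp x
    (S.coords k).hasFDerivAt).fderiv u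

theorem injective_fderiv (y : Euc d) : Function.Injective (fderiv ℝ S.toFun y) := by
  have hcomp : HasFDerivAt (S.inv ∘ S.toFun) _ y :=
    (S.contDiff_inv.differentiable (by simp) (S.toFun y)).hasFDerivAt.comp y
      (S.contDiff.differentiable (by simp) y).hasFDerivAt
  rw [show S.inv ∘ S.toFun = id from funext S.left_inv] at hcomp
  exact Function.LeftInverse.injective (g := fderiv ℝ S.inv (S.toFun y))
    (DFunLike.congr_fun (hcomp.unique (hasFDerivAt_id y)))

theorem coords_injective (k : ℕ) : Function.Injective (S.coords k) :=
  injective_axisScale (pow_pos S.ratio_pos k).ne' (inv_pos.2 (S.scale_pos k)).ne'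

theorem injective_fderiv_ringCoords (k : ℕ) (x : Euc d) :
    Function.Injective (fderiv ℝ (S.ringCoords k) x) := by
  intro u v h
  rw [fderiv_ringCoords, fderiv_ringCoords] at h
  exact S.coords_injective k (S.injective_fderiv _ h)

/-- The metric of level `k`: the metric `ringForm` with a tube of radius `tubeRad k`, rescaled by
`scale k` and read in the coordinates `ringCoords k`. -/
def levelForm (k : ℕ) (x : Euc d) : Euc d →L[ℝ] Euc d →L[ℝ] ℝ :=
  S.scale k ^ 2 • (ringForm (tubeRad k) (S.ringCoords k x)).bilinearComp
    (fderiv ℝ (S.ringCoords k) x) (fderiv ℝ (S.ringCoords k) x)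

theorem levelForm_apply (k : ℕ) (x u v : Euc d) : S.levelForm k x u v =
    S.scale k ^ 2 * ringForm (tubeRad k) (S.ringCoords k x)
      (fderiv ℝ (S.ringCoords k) x u) (fderiv ℝ (S.ringCoords k) x v) := by
  simp [levelForm]

theorem levelForm_symm (k : ℕ) (x u v : Euc d) : S.levelForm k x u v = S.levelForm k x v u := by
  rw [levelForm_apply, levelForm_apply, ringForm_symm]

theorem levelForm_self_pos (k : ℕ) (x : Euc d) {u : Euc d} (hu : u ≠ 0) :
    0 < S.levelForm k x u u := by
  rw [levelForm_apply]
  refine mul_pos (pow_pos (S.scale_pos k) 2)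
    (ringForm_self_pos (tubeRad_pos k) (tubeRad_le k) _ ?_)
  rwa [Ne, map_eq_zero_iff _ (S.injective_fderiv_ringCoords k x)]

theorem levelForm_self_nonneg (k : ℕ) (x u : Euc d) : 0 ≤ S.levelForm k x u u := by
  rcases eq_or_ne u 0 with rfl | hu
  · simp
  · exact (S.levelForm_self_pos k x hu).le

theorem contDiff_levelForm (k : ℕ) : ContDiff ℝ ∞ (S.levelForm k) := by
  rw [contDiff_bilinear_iff]
  intro u v
  simp only [levelForm_apply]
  have hderiv : ∀ u, ContDiff ℝ ∞ fun x ↦ fderiv ℝ (S.ringCoords k) x u := fun u ↦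
    ((S.contDiff_ringCoords k).fderiv_right (m := ∞) (by simp)).clm_apply contDiff_const
  have hring : ContDiff ℝ ∞ fun x ↦ ringForm (tubeRad k) (S.ringCoords k x) :=
    (contDiff_ringForm (tubeRad k)).comp (S.contDiff_ringCoords k)
  exact contDiff_const.mul ((hring.clm_apply (hderiv u)).clm_apply (hderiv v))

theorem levelForm_self_le (k : ℕ) (x u : Euc d) :
    S.levelForm k x u u ≤ 4 * (S.scale k ^ 2 * ‖S.coords k u‖ ^ 2) := by
  have hderiv := S.norm_fderiv_le (S.coords k x) (S.coords k u)
  rw [← fderiv_ringCoords] at hderiv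
  calc S.levelForm k x u u ≤ S.scale k ^ 2 * ‖fderiv ℝ (S.ringCoords k) x u‖ ^ 2 := by
        rw [levelForm_apply]
        gcongr
        exact ringForm_self_le (tubeRad_pos k) (tubeRad_le k) _ _
    _ ≤ S.scale k ^ 2 * (2 * ‖S.coords k u‖) ^ 2 := by gcongr
    _ = 4 * (S.scale k ^ 2 * ‖S.coords k u‖ ^ 2) := by ring

theorem fderiv_of_one_lt {y : Euc d} (hy : 1 < ‖y‖) (u : Euc d) : fderiv ℝ S.toFun y u = u := by
  have h : S.toFun =ᶠ[nhds y] fun y ↦ y + EuclideanSpace.single 1 1 := by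
    filter_upwards [continuous_norm.continuousAt.eventually (lt_mem_nhds hy)] with z hz
    exact S.eq_translation z hz.le
  rw [h.fderiv_eq, fderiv_add_const, fderiv_fun_id, ContinuousLinearMap.id_apply]

theorem fderiv_of_lt_rad {y : Euc d} (hy : ‖y‖ < S.rad) :
    fderiv ℝ S.toFun y = fderiv ℝ ringParam y := by
  have h : S.toFun =ᶠ[nhds y] ringParam := by
    filter_upwards [continuous_norm.continuousAt.eventually (gt_mem_nhds hy)] with z hz
    exact S.eq_ringParam z hz
  exact h.fderiv_eq

theorem one_le_ringSq_of_three_le {y : Euc d} (hy : 3 ≤ ‖y‖) : 1 ≤ ringSq (S.toFun y) := by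
  apply ringSq_of_norm_ge
  rw [S.eq_translation y (by linarith)]
  have htri := norm_sub_norm_le y (-EuclideanSpace.single 1 (1 : ℝ))
  rw [sub_neg_eq_add, norm_neg, PiLp.norm_single, norm_one] at htri
  linarith

theorem levelForm_of_three_le {k : ℕ} {x : Euc d} (h : 3 ≤ ‖S.coords k x‖) (u v : Euc d) :
    S.levelForm k x u v = S.scale k ^ 2 * inner ℝ (S.coords k u) (S.coords k v) := by
  have hring : 1 / 16 ≤ ringSq (S.ringCoords k x) :=
    le_trans (by norm_num) (S.one_le_ringSq_of_three_le h)
  rw [levelForm_apply, ringForm_of_ge _ hring, fderiv_ringCoords, fderiv_ringCoords,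
    S.fderiv_of_one_lt (by linarith), S.fderiv_of_one_lt (by linarith)]

theorem norm_coords_succ_lt_rad {k : ℕ} {x : Euc d} (h : ‖S.coords k x‖ < 4) :
    ‖S.coords (k + 1) x‖ < S.rad := by
  nlinarith [S.norm_coords_succ_le k x, S.ratio_lt_rad, S.ratio_pos]

theorem tubeSq_coords_succ_le {k : ℕ} {x : Euc d} (h : ‖S.coords k x‖ < 4) :
    tubeSq (S.coords (k + 1) x) ≤ tubeRad (k + 1) ^ 2 / 4 := by
  have htube : tubeSq (S.coords k x) ≤ 16 := by
    unfold tubeSq; nlinarith [norm_nonneg (S.coords k x), sq_nonneg (S.coords k x 0)]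
  have hcontract := S.ratio_mul_circleLen_le (k + 1)
  have hcontract_pos := mul_pos S.ratio_pos (circleLen_pos d (k + 1))
  rw [coords_succ, tubeSq_axisScale]
  calc (S.ratio * circleLen d (k + 1)) ^ 2 * tubeSq (S.coords k x)
      ≤ (tubeRad (k + 1) / 8) ^ 2 * 16 := by
        gcongr
        exact tubeSq_nonneg _
    _ = _ := by ring

theorem levelForm_succ_of_lt {k : ℕ} {x : Euc d} (h : ‖S.coords k x‖ < 4) (u v : Euc d) :
    S.levelForm (k + 1) x u v = S.scale k ^ 2 * inner ℝ (S.coords k u) (S.coords k v) := by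
  have hrad := S.norm_coords_succ_lt_rad h
  have ht := S.tubeSq_coords_succ_le h
  have hr0 := tubeRad_pos (k + 1)
  have hr1 := tubeRad_le (k + 1)
  rw [levelForm_apply, fderiv_ringCoords, fderiv_ringCoords, ringCoords,
    S.fderiv_of_lt_rad hrad, S.eq_ringParam _ hrad, ringForm_ringParam (by nlinarith),
    circleProfile_of_le _ hr0 (by nlinarith), ← circleLen, coords_succ, coords_succ,
    inner_axisScale_axisScale, axisScale_apply_zero, axisScale_apply_zero, ← S.scale_succ_mul k]
  ring

theorem scale_sq_mul_le_succ (k : ℕ) (u : Euc d) :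
    S.scale k ^ 2 * ‖S.coords k u‖ ^ 2 ≤ S.scale (k + 1) ^ 2 * ‖S.coords (k + 1) u‖ ^ 2 := by
  have hcircle : (circleLen d (k + 1) * S.coords k u 0) ^ 2 ≤ S.coords k u 0 ^ 2 := by
    rw [mul_pow]
    exact mul_le_of_le_one_left (sq_nonneg _)
      (pow_le_one₀ (circleLen_pos d _).le (circleLen_le_one d _))
  have hdiff := mul_nonneg (sq_nonneg (S.scale (k + 1) * S.ratio)) (sub_nonneg.2 hcircle)
  rw [coords_succ, ← real_inner_self_eq_norm_sq (axisScale _ _ _), inner_axisScale_axisScale,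
    real_inner_self_eq_norm_sq, ← S.scale_succ_mul k]
  linarith

theorem scale_sq_mul_le {j k : ℕ} (hjk : j ≤ k) (u : Euc d) :
    S.scale j ^ 2 * ‖S.coords j u‖ ^ 2 ≤ S.scale k ^ 2 * ‖S.coords k u‖ ^ 2 := by
  induction k, hjk using Nat.le_induction with
  | base => exact le_rfl
  | succ k _ ih => exact ih.trans (S.scale_sq_mul_le_succ k u)

open Classical in
/-- The level of a point: the index of the first ball that contains it. -/
def level (x : Euc d) : ℕ := Nat.find (S.exists_norm_coords_lt x)

open Classical in
theorem norm_coords_level_lt (x : Euc d) : ‖S.coords (S.level x) x‖ < 4 :=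
  Nat.find_spec (S.exists_norm_coords_lt x)

open Classical in
theorem level_le {k : ℕ} {x : Euc d} (h : ‖S.coords k x‖ < 4) : S.level x ≤ k :=
  Nat.find_min' _ h

theorem four_le_norm_coords {k : ℕ} {x : Euc d} (h : k < S.level x) : 4 ≤ ‖S.coords k x‖ := by
  by_contra! hlt
  exact absurd (S.level_le hlt) (by omega)

/-- The metric that is `levelForm k` on the difference of the balls of levels `k` and `k - 1`. -/
def globalForm (x : Euc d) : Euc d →L[ℝ] Euc d →L[ℝ] ℝ := S.levelForm (S.level x) x

theorem levelForm_succ_eq {k : ℕ} {x : Euc d} (h : 3 ≤ ‖S.coords k x‖) (h' : ‖S.coords k x‖ < 4) :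
    S.levelForm (k + 1) x = S.levelForm k x := by
  ext u v
  rw [S.levelForm_of_three_le h, S.levelForm_succ_of_lt h']

theorem eventually_norm_coords_level_lt (x : Euc d) :
    ∀ᶠ y in nhds x, ‖S.coords (S.level x) y‖ < 4 :=
  (S.coords _).continuous.norm.continuousAt.eventually_lt_const (S.norm_coords_level_lt x)

theorem eventually_three_lt_norm_coords (x : Euc d) :
    ∀ᶠ y in nhds x, ∀ k < S.level x, 3 < ‖S.coords k y‖ := by
  refine (Set.finite_lt_nat (S.level x)).eventually_all.2 fun k hk ↦ ?_
  exact (S.coords k).continuous.norm.continuousAt.eventually_const_lt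
    (lt_of_lt_of_le (by norm_num) (S.four_le_norm_coords hk))

theorem globalForm_eventuallyEq (x : Euc d) :
    S.globalForm =ᶠ[nhds x] S.levelForm (S.level x) := by
  filter_upwards [S.eventually_norm_coords_level_lt x, S.eventually_three_lt_norm_coords x]
    with y hlt hgt
  rcases (S.level_le hlt).eq_or_lt with heq | hlevel
  · rw [globalForm, heq]
  · have hthree := hgt _ hlevel
    have hsucc : S.level x = S.level y + 1 := by
      by_contra hne
      have := S.norm_coords_lt_of_lt (Nat.lt_succ_self _) (S.norm_coords_level_lt y)
      linarith [hgt (S.level y + 1) (by omega)]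
    rw [globalForm, hsucc, S.levelForm_succ_eq hthree.le (S.norm_coords_level_lt y)]

/-- The smooth Riemannian metric glued from all levels. -/
def metric : SmoothMetric (Euc d) :=
  SmoothMetric.ofField S.globalForm
    (contDiff_iff_contDiffAt.2 fun x ↦
      (S.contDiff_levelForm _).contDiffAt.congr_of_eventuallyEq (S.globalForm_eventuallyEq x))
    (fun _ _ _ ↦ S.levelForm_symm _ _ _ _)
    (fun _ _ hu ↦ S.levelForm_self_pos _ _ hu)

theorem metric_form (x u v : Euc d) : S.metric.form x u v = S.levelForm (S.level x) x u v := rfl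

theorem metric_form_eventuallyEq (x : Euc d) :
    ∀ᶠ y in nhds x, ∀ u v, S.metric.form y u v = S.levelForm (S.level x) y u v := by
  filter_upwards [S.globalForm_eventuallyEq x] with y hy u v
  exact DFunLike.congr_fun (DFunLike.congr_fun hy u) v

theorem metric_form_self_le {k : ℕ} {x : Euc d} (h : ‖S.coords k x‖ < 4) (u : Euc d) :
    S.metric.form x u u ≤ 4 * (S.scale k ^ 2 * ‖S.coords k u‖ ^ 2) := by
  rw [metric_form]
  refine (S.levelForm_self_le _ x u).trans ?_
  gcongr 4 * ?_
  exact S.scale_sq_mul_le (S.level_le h) u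

theorem metric_form_self_le_levelForm {k : ℕ} {x : Euc d} (h : ‖S.coords k x‖ < 4) (u : Euc d) :
    S.metric.form x u u ≤ 4 * S.levelForm k x u u := by
  rcases (S.level_le h).eq_or_lt with heq | hlt
  · rw [metric_form, heq]
    linarith [S.levelForm_self_nonneg k x u]
  · obtain ⟨j, rfl⟩ : ∃ j, k = j + 1 := ⟨k - 1, by omega⟩
    have hj := S.norm_coords_lt_of_le (show S.level x ≤ j by omega) (S.norm_coords_level_lt x)
    rw [S.levelForm_succ_of_lt hj, real_inner_self_eq_norm_sq]
    exact S.metric_form_self_le hj u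

end Straightening

end Euc

end GlobalMetric

section TubeCoordinates

variable {d : ℕ}

namespace Euc

theorem tubeSq_smul (t : ℝ) (y : Euc d) : tubeSq (t • y) = t ^ 2 * tubeSq y := by
  simp only [tubeSq, norm_smul, mul_pow, Real.norm_eq_abs, sq_abs, PiLp.smul_apply, smul_eq_mul]
  ring

theorem tubeSq_add_mul_sq_pos {a : ℝ} (ha : 0 < a) {u : Euc d} (hu : u ≠ 0) :
    0 < tubeSq u + a * u 0 ^ 2 := by
  have htube := tubeSq_nonneg u
  by_cases h0 : u 0 = 0
  · have hnorm : 0 < ‖u‖ ^ 2 := by positivity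
    simpa [tubeSq, h0] using hnorm
  · positivity

namespace Straightening

variable (S : Straightening d)

/-- The inverse of the linear coordinates of level `k`. -/
def coordsInv (k : ℕ) : Euc d →L[ℝ] Euc d := axisScale (S.ratio ^ k)⁻¹ (S.scale k)

theorem coords_coordsInv (k : ℕ) (x : Euc d) : S.coords k (S.coordsInv k x) = x := by
  have := axisScale_axisScale_inv (pow_pos S.ratio_pos k).ne' (inv_pos.2 (S.scale_pos k)).ne' x
  rwa [inv_inv] at this

theorem coordsInv_coords (k : ℕ) (x : Euc d) : S.coordsInv k (S.coords k x) = x :=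
  S.coords_injective k (S.coords_coordsInv k _)

/-- Tubular coordinates around the core circle of level `k`. -/
def tubeParam (k : ℕ) (y : Euc d) : Euc d := S.coordsInv k (S.inv (ringParam y))

theorem contDiff_tubeParam (k : ℕ) : ContDiff ℝ ∞ (S.tubeParam k) :=
  (S.coordsInv k).contDiff.comp (S.contDiff_inv.comp contDiff_ringParam)

theorem ringCoords_tubeParam (k : ℕ) (y : Euc d) :
    S.ringCoords k (S.tubeParam k y) = ringParam y := by
  rw [ringCoords, tubeParam, coords_coordsInv, S.right_inv]

theorem toFun_zero : S.toFun 0 = ringParam 0 := S.eq_ringParam 0 (by simpa using S.rad_pos)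

theorem tubeParam_zero (k : ℕ) : S.tubeParam k 0 = 0 := by
  rw [tubeParam, ← S.toFun_zero, S.left_inv, map_zero]

theorem exists_tubeParam_eq (k : ℕ) (x : Euc d) :
    ∃ y : Euc d, |y 0| ≤ Real.pi ∧ tubeSq y = ringSq (S.ringCoords k x) ∧ S.tubeParam k y = x := by
  obtain ⟨y, hangle, htube, hy⟩ := exists_ringParam_eq (S.ringCoords k x)
  refine ⟨y, hangle, htube, ?_⟩
  rw [tubeParam, hy, ringCoords, S.left_inv, coordsInv_coords]

theorem fderiv_ringCoords_tubeParam (k : ℕ) (y u : Euc d) :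
    fderiv ℝ (S.ringCoords k) (S.tubeParam k y) (fderiv ℝ (S.tubeParam k) y u) =
      fderiv ℝ ringParam y u := by
  have hcomp : ringParam = S.ringCoords k ∘ S.tubeParam k :=
    funext fun y ↦ (S.ringCoords_tubeParam k y).symm
  rw [hcomp, fderiv_comp y ((S.contDiff_ringCoords k).differentiable (by simp) _)
    ((S.contDiff_tubeParam k).differentiable (by simp) _)]
  rfl

theorem levelForm_tubeParam (k : ℕ) {y : Euc d} (hy : tubeSq y ≤ 1 / 64) (u v : Euc d) :
    S.levelForm k (S.tubeParam k y) (fderiv ℝ (S.tubeParam k) y u)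
      (fderiv ℝ (S.tubeParam k) y v) = S.scale k ^ 2 *
        (inner ℝ u v + (circleProfile (d + 2) (tubeRad k) (tubeSq y) ^ 2 - 1) * (u 0 * v 0)) := by
  rw [levelForm_apply, fderiv_ringCoords_tubeParam, fderiv_ringCoords_tubeParam,
    ringCoords_tubeParam, ringForm_ringParam hy]

theorem levelForm_tubeParam_self (k : ℕ) {y : Euc d} (hy : tubeSq y ≤ 1 / 64) (u : Euc d) :
    S.levelForm k (S.tubeParam k y) (fderiv ℝ (S.tubeParam k) y u)
      (fderiv ℝ (S.tubeParam k) y u) = S.scale k ^ 2 *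
        (tubeSq u + circleProfile (d + 2) (tubeRad k) (tubeSq y) ^ 2 * u 0 ^ 2) := by
  rw [S.levelForm_tubeParam k hy, real_inner_self_eq_norm_sq, tubeSq.eq_def u]
  ring

theorem injective_fderiv_tubeParam (k : ℕ) {y : Euc d} (hy : tubeSq y ≤ 1 / 64) :
    Function.Injective (fderiv ℝ (S.tubeParam k) y) := by
  refine (injective_iff_map_eq_zero _).2 fun u hu ↦ ?_
  by_contra hne
  have hpos := mul_pos (pow_pos (S.scale_pos k) 2) (tubeSq_add_mul_sq_pos
    (pow_pos (circleProfile_pos (d + 2) (tubeRad_pos k) (tubeSq y)) 2) hne)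
  rw [← S.levelForm_tubeParam_self k hy, hu, map_zero] at hpos
  exact hpos.false

theorem surjective_fderiv_tubeParam (k : ℕ) {y : Euc d} (hy : tubeSq y ≤ 1 / 64) :
    Function.Surjective (fderiv ℝ (S.tubeParam k) y) :=
  (LinearMap.injective_iff_surjective
    (f := (fderiv ℝ (S.tubeParam k) y : Euc d →ₗ[ℝ] Euc d))).1 (S.injective_fderiv_tubeParam k hy)

theorem norm_coords_lt_three {k : ℕ} {x : Euc d} (h : ringSq (S.ringCoords k x) < 1) :
    ‖S.coords k x‖ < 3 :=
  lt_of_not_ge fun hthree ↦ h.not_ge (S.one_le_ringSq_of_three_le hthree)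

theorem ringSq_ringCoords_le_of_level_lt {k : ℕ} {x : Euc d} (h : S.level x < k) :
    ringSq (S.ringCoords k x) ≤ tubeRad k ^ 2 / 4 := by
  obtain ⟨j, rfl⟩ : ∃ j, k = j + 1 := ⟨k - 1, by omega⟩
  have hj := S.norm_coords_lt_of_le (show S.level x ≤ j by omega) (S.norm_coords_level_lt x)
  have htube := S.tubeSq_coords_succ_le hj
  rwa [ringCoords, S.eq_ringParam _ (S.norm_coords_succ_lt_rad hj),
    ringSq_ringParam (by nlinarith [tubeRad_le (j + 1), tubeRad_pos (j + 1)])]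

theorem level_eq_of_ringSq {k : ℕ} {x : Euc d} (h : tubeRad k ^ 2 / 4 < ringSq (S.ringCoords k x))
    (h' : ringSq (S.ringCoords k x) < 1) : S.level x = k :=
  le_antisymm (S.level_le ((S.norm_coords_lt_three h').trans (by norm_num)))
    (le_of_not_gt fun hlt ↦ h.not_ge (S.ringSq_ringCoords_le_of_level_lt hlt))

end Straightening

end Euc

end TubeCoordinates

section DistanceUpperBound

variable {d : ℕ}

namespace Euc

theorem circleProfile_tubeRad_le (k : ℕ) {s q : ℝ} (hs : 0 ≤ s) (hsq : s ≤ q ^ 2) (hq : 0 ≤ q)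
    (hq' : q ≤ 1 / 8) : circleProfile (d + 2) (tubeRad k) s ≤ tubeRad k + q := by
  have hpos := tubeRad_pos k
  have hle := tubeRad_le k
  have hprofile := circleProfile_le (p := d + 2) (by simp) hpos hs (by nlinarith)
  nlinarith

namespace Straightening

variable (S : Straightening d)

theorem pow_le_scale (k : ℕ) : 8 ^ k ≤ S.scale k := by
  induction k with
  | zero => simp [scale]
  | succ k ih =>
    have hcontract : S.ratio * circleLen d (k + 1) ≤ 1 / 8 := by
      linarith [S.ratio_mul_circleLen_le (k + 1), tubeRad_le (k + 1)]
    rw [scale, le_div_iff₀ (mul_pos S.ratio_pos (circleLen_pos d _))]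
    calc (8 : ℝ) ^ (k + 1) * (S.ratio * circleLen d (k + 1)) ≤ 8 ^ (k + 1) * (1 / 8) := by gcongr
      _ = 8 ^ k := by rw [pow_succ]; ring
      _ ≤ S.scale k := ih

theorem pow_le_scale_mul_tubeRad (k : ℕ) : 8 ^ k / 32 ≤ S.scale k * tubeRad k := by
  cases k with
  | zero => norm_num [scale, tubeRad]
  | succ k =>
    have hcontract := mul_le_mul_of_nonneg_left (S.ratio_mul_circleLen_le (k + 1))
      (S.scale_pos (k + 1)).le
    have hpow : (0 : ℝ) < 8 ^ k := by positivity
    rw [S.scale_succ_mul] at hcontract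
    rw [pow_succ]
    linarith [S.pow_le_scale k]

theorem edist_zero_le_of_norm_coords_lt {k : ℕ} {x : Euc d} (h : ‖S.coords k x‖ < 4) :
    S.metric.edist 0 x ≤ ENNReal.ofReal (8 * S.scale k) := by
  have hderiv (t : ℝ) : deriv (fun t : ℝ ↦ t • x) t = x := by
    simpa using ((hasDerivAt_id t).smul_const x).deriv
  have hscale := S.scale_pos k
  have hdist := S.metric.edist_le_of_path (γ := fun t : ℝ ↦ t • x) (by fun_prop)
    (c := 8 * S.scale k) (by positivity) fun t ht ↦ by
    have hball : ‖S.coords k (t • x)‖ < 4 := by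
      rw [map_smul, norm_smul, Real.norm_of_nonneg ht.1]
      exact (mul_le_of_le_one_left (norm_nonneg _) ht.2).trans_lt h
    rw [hderiv]
    calc S.metric.form (t • x) x x ≤ 4 * (S.scale k ^ 2 * ‖S.coords k x‖ ^ 2) :=
          S.metric_form_self_le hball x
      _ ≤ 4 * (S.scale k ^ 2 * 4 ^ 2) := by gcongr
      _ = (8 * S.scale k) ^ 2 := by ring
  simpa using hdist

theorem hasDerivAt_tubeParam_smul (k : ℕ) (y : Euc d) (t : ℝ) :
    HasDerivAt (fun t : ℝ ↦ S.tubeParam k (t • y)) (fderiv ℝ (S.tubeParam k) (t • y) y) t := by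
  have hray : HasDerivAt (fun t : ℝ ↦ t • y) y t := by
    simpa using (hasDerivAt_id t).smul_const y
  exact ((S.contDiff_tubeParam k).differentiable (by simp) _).hasFDerivAt.comp_hasDerivAt t hray

theorem metric_form_tubeParam_smul_le (k : ℕ) {y : Euc d} (hangle : |y 0| ≤ Real.pi)
    (hy : tubeSq y < 1 / 64) {t : ℝ} (ht : t ∈ Set.Icc (0 : ℝ) 1) :
    S.metric.form (S.tubeParam k (t • y)) (fderiv ℝ (S.tubeParam k) (t • y) y)
      (fderiv ℝ (S.tubeParam k) (t • y) y) ≤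
        (10 * (S.scale k * (tubeRad k + √(tubeSq y)))) ^ 2 := by
  set q := √(tubeSq y)
  have hq : 0 ≤ q := Real.sqrt_nonneg _
  have hq_sq : q ^ 2 = tubeSq y := Real.sq_sqrt (tubeSq_nonneg y)
  have hray : tubeSq (t • y) ≤ tubeSq y := by
    rw [tubeSq_smul]
    exact mul_le_of_le_one_left (tubeSq_nonneg y) (pow_le_one₀ ht.1 ht.2)
  have hball : ‖S.coords k (S.tubeParam k (t • y))‖ < 4 := by
    refine (S.norm_coords_lt_three ?_).trans (by norm_num)
    rw [ringCoords_tubeParam, ringSq_ringParam (by linarith)]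
    linarith
  have hprofile_pos := circleProfile_pos (d + 2) (tubeRad_pos k) (tubeSq (t • y))
  have hprofile := circleProfile_tubeRad_le (d := d) k (tubeSq_nonneg (t • y))
    (hray.trans hq_sq.ge) hq (by nlinarith)
  have hrad := tubeRad_pos k
  have hangle_sq : y 0 ^ 2 ≤ 4 ^ 2 := sq_le_sq' (by linarith [neg_le_of_abs_le hangle,
    Real.pi_le_four]) (by linarith [le_of_abs_le hangle, Real.pi_le_four])
  calc S.metric.form (S.tubeParam k (t • y)) _ _
      ≤ 4 * (S.scale k ^ 2 * (tubeSq y +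
          circleProfile (d + 2) (tubeRad k) (tubeSq (t • y)) ^ 2 * y 0 ^ 2)) := by
        rw [← S.levelForm_tubeParam_self k (by linarith)]
        exact S.metric_form_self_le_levelForm hball _
    _ ≤ 4 * (S.scale k ^ 2 * ((tubeRad k + q) ^ 2 + (tubeRad k + q) ^ 2 * 4 ^ 2)) := by
        rw [← hq_sq]
        gcongr
        linarith
    _ = 68 * (S.scale k * (tubeRad k + q)) ^ 2 := by ring
    _ ≤ (10 * (S.scale k * (tubeRad k + q))) ^ 2 := by
        linarith [sq_nonneg (S.scale k * (tubeRad k + q))]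

theorem edist_zero_le_of_ringSq_lt {k : ℕ} {x : Euc d}
    (h : ringSq (S.ringCoords k x) < 1 / 64) : S.metric.edist 0 x ≤
      ENNReal.ofReal (10 * (S.scale k * (tubeRad k + √(ringSq (S.ringCoords k x))))) := by
  obtain ⟨y, hangle, htube, rfl⟩ := S.exists_tubeParam_eq k x
  rw [← htube] at h ⊢
  have hcurve : ContDiff ℝ 1 fun t : ℝ ↦ S.tubeParam k (t • y) :=
    ((S.contDiff_tubeParam k).of_le (by simp)).comp (by fun_prop : ContDiff ℝ 1 fun t : ℝ ↦ t • y)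
  have hscale := S.scale_pos k
  have hrad := tubeRad_pos k
  have hdist := S.metric.edist_le_of_path hcurve
    (c := 10 * (S.scale k * (tubeRad k + √(tubeSq y)))) (by positivity) fun t ht ↦ by
      rw [(S.hasDerivAt_tubeParam_smul k y t).deriv]
      exact S.metric_form_tubeParam_smul_le k hangle h ht
  simpa [tubeParam_zero] using hdist

end Straightening

end Euc

end DistanceUpperBound

section DistanceLowerBound

variable {d : ℕ}

/-- A smooth function equal to `0` for `s ≤ 1 / 4` and to `1` for `1 ≤ s`. -/
def stepProfile (s : ℝ) : ℝ := Real.smoothTransition ((s - 1 / 4) * (4 / 3))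

theorem contDiff_stepProfile : ContDiff ℝ ∞ stepProfile :=
  Real.smoothTransition.contDiff.comp (by fun_prop)

theorem stepProfile_of_le {s : ℝ} (hs : s ≤ 1 / 4) : stepProfile s = 0 :=
  Real.smoothTransition.zero_of_nonpos (by linarith)

theorem stepProfile_of_ge {s : ℝ} (hs : 1 ≤ s) : stepProfile s = 1 :=
  Real.smoothTransition.one_of_one_le (by linarith)

theorem stepProfile_nonneg (s : ℝ) : 0 ≤ stepProfile s := Real.smoothTransition.nonneg _

theorem stepProfile_le_one (s : ℝ) : stepProfile s ≤ 1 := Real.smoothTransition.le_one _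

theorem exists_abs_deriv_stepProfile_le :
    ∃ A : ℝ, 0 < A ∧ ∀ s ∈ Set.Icc (0 : ℝ) 1, |deriv stepProfile s| ≤ A := by
  obtain ⟨A, hA⟩ := (isCompact_Icc (a := (0 : ℝ)) (b := 1)).exists_bound_of_continuousOn
    (contDiff_stepProfile.continuous_deriv (by simp)).continuousOn
  exact ⟨max A 1, by positivity, fun s hs ↦ (hA s hs).trans (le_max_left _ _)⟩

namespace Euc

theorem sq_inner_sub_le (y u : Euc d) :
    (inner ℝ y u - y 0 * u 0) ^ 2 ≤ tubeSq y * tubeSq u := by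
  have hcauchy := real_inner_mul_inner_self_le (axisScale 0 1 y) (axisScale 0 1 u)
  simp only [inner_axisScale_axisScale] at hcauchy
  simp only [tubeSq, ← real_inner_self_eq_norm_sq]
  linarith

theorem fderiv_tubeSq (y u : Euc d) :
    fderiv ℝ tubeSq y u = 2 * (inner ℝ y u - y 0 * u 0) := by
  have hcoord : HasFDerivAt (fun y : Euc d ↦ y 0) (EuclideanSpace.proj 0 : Euc d →L[ℝ] ℝ) y :=
    (EuclideanSpace.proj 0 : Euc d →L[ℝ] ℝ).hasFDerivAt
  have hsub := ((hasStrictFDerivAt_norm_sq y).hasFDerivAt.sub (hcoord.pow 2)).fderiv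
  refine (DFunLike.congr_fun hsub u).trans ?_
  simp only [Nat.add_one_sub_one, pow_one, nsmul_eq_mul, Nat.cast_ofNat, sub_apply, smul_apply,
    coe_innerSL_apply, PiLp.proj_apply, smul_eq_mul]
  ring

theorem fderiv_stepProfile_tubeSq_div (r : ℝ) (y u : Euc d) :
    fderiv ℝ (fun z ↦ stepProfile (tubeSq z / r)) y u =
      deriv stepProfile (tubeSq y / r) * (2 * (inner ℝ y u - y 0 * u 0) / r) := by
  have hstep : HasDerivAt stepProfile _ (tubeSq y / r) :=
    (contDiff_stepProfile.differentiable (by simp) _).hasDerivAt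
  have htube : HasFDerivAt (fun z : Euc d ↦ tubeSq z / r) (r⁻¹ • fderiv ℝ tubeSq y) y := by
    simpa only [div_eq_mul_inv] using
      (contDiff_tubeSq.differentiable (by simp) y).hasFDerivAt.mul_const r⁻¹
  refine (DFunLike.congr_fun (hstep.comp_hasFDerivAt y htube).fderiv u).trans ?_
  simp only [smul_apply, smul_eq_mul, fderiv_tubeSq]
  ring

theorem fderiv_stepProfile_tubeSq_div_sq_le {A ε : ℝ} (hε : 0 < ε)
    (hA : ∀ s ∈ Set.Icc (0 : ℝ) 1, |deriv stepProfile s| ≤ A) {y : Euc d} (hy : tubeSq y ≤ ε ^ 2)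
    (u : Euc d) :
    (ε * fderiv ℝ (fun z ↦ stepProfile (tubeSq z / ε ^ 2)) y u) ^ 2 ≤
      (2 * A) ^ 2 * tubeSq u := by
  have hderiv : deriv stepProfile (tubeSq y / ε ^ 2) ^ 2 ≤ A ^ 2 := by
    rw [← sq_abs]
    gcongr
    exact hA _ ⟨div_nonneg (tubeSq_nonneg y) (sq_nonneg _), (div_le_one (by positivity)).2 hy⟩
  have hcauchy : (inner ℝ y u - y 0 * u 0) ^ 2 ≤ ε ^ 2 * tubeSq u :=
    (sq_inner_sub_le y u).trans (mul_le_mul_of_nonneg_right hy (tubeSq_nonneg u))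
  rw [fderiv_stepProfile_tubeSq_div]
  calc (ε * (deriv stepProfile (tubeSq y / ε ^ 2) *
          (2 * (inner ℝ y u - y 0 * u 0) / ε ^ 2))) ^ 2
      = 4 * (deriv stepProfile (tubeSq y / ε ^ 2) ^ 2 *
          ((inner ℝ y u - y 0 * u 0) ^ 2 / ε ^ 2)) := by
        field_simp
        ring
    _ ≤ 4 * (A ^ 2 * tubeSq u) := by
        gcongr
        exact (div_le_iff₀' (by positivity)).2 hcauchy
    _ = (2 * A) ^ 2 * tubeSq u := by ring

namespace Straightening

variable (S : Straightening d)

/-- A function with bounded gradient that vanishes at the origin and equals the radius of the tube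
of level `k` outside this tube: it bounds the distance to the origin from below there. -/
def tubeBump (k : ℕ) (x : Euc d) : ℝ :=
  S.scale k * tubeRad k * stepProfile (ringSq (S.ringCoords k x) / tubeRad k ^ 2)

theorem tubeBump_nonneg (k : ℕ) (x : Euc d) : 0 ≤ S.tubeBump k x :=
  mul_nonneg (mul_pos (S.scale_pos k) (tubeRad_pos k)).le (stepProfile_nonneg _)

theorem tubeBump_le (k : ℕ) (x : Euc d) : S.tubeBump k x ≤ S.scale k * tubeRad k :=
  mul_le_of_le_one_right (mul_pos (S.scale_pos k) (tubeRad_pos k)).le (stepProfile_le_one _)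

theorem tubeBump_of_le {k : ℕ} {x : Euc d} (h : ringSq (S.ringCoords k x) ≤ tubeRad k ^ 2 / 4) :
    S.tubeBump k x = 0 := by
  have hratio : ringSq (S.ringCoords k x) / tubeRad k ^ 2 ≤ 1 / 4 :=
    (div_le_iff₀ (pow_pos (tubeRad_pos k) 2)).2 (by linarith)
  rw [tubeBump, stepProfile_of_le hratio, mul_zero]

theorem tubeBump_of_ge {k : ℕ} {x : Euc d} (h : tubeRad k ^ 2 ≤ ringSq (S.ringCoords k x)) :
    S.tubeBump k x = S.scale k * tubeRad k := by
  rw [tubeBump, stepProfile_of_ge ((one_le_div (pow_pos (tubeRad_pos k) 2)).2 h), mul_one]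

theorem tubeBump_zero (k : ℕ) : S.tubeBump k 0 = 0 := by
  have htube : tubeSq (0 : Euc d) = 0 := by simp [tubeSq]
  refine S.tubeBump_of_le ?_
  rw [ringCoords, map_zero, S.toFun_zero, ringSq_ringParam (by rw [htube]; norm_num), htube]
  positivity

theorem contDiff_tubeBump (k : ℕ) : ContDiff ℝ ∞ (S.tubeBump k) := by
  refine contDiff_iff_contDiffAt.2 fun x ↦ ?_
  by_cases h : radius (S.ringCoords k x) = 0
  · have hring : 1 / 64 < ringSq (S.ringCoords k x) := by
      have := sq_le_ringSq (S.ringCoords k x)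
      rw [h] at this
      linarith
    have hconst : S.tubeBump k =ᶠ[nhds x] fun _ ↦ S.scale k * tubeRad k := by
      filter_upwards [(continuous_ringSq.comp
        (S.contDiff_ringCoords k).continuous).continuousAt.eventually_const_lt hring] with z hz
      exact S.tubeBump_of_ge ((tubeRad_sq_lt k).trans hz).le
    exact contDiffAt_const.congr_of_eventuallyEq hconst
  · exact contDiffAt_const.mul (contDiff_stepProfile.contDiffAt.comp x
      (((contDiffAt_ringSq h).comp x (S.contDiff_ringCoords k).contDiffAt).div_const _))

theorem fderiv_tubeBump_of_le {k : ℕ} {x : Euc d}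
    (h : ringSq (S.ringCoords k x) ≤ tubeRad k ^ 2 / 4) : fderiv ℝ (S.tubeBump k) x = 0 :=
  IsLocalMin.fderiv_eq_zero (Eventually.of_forall fun z ↦
    (S.tubeBump_of_le h).trans_le (S.tubeBump_nonneg k z))

theorem fderiv_tubeBump_of_ge {k : ℕ} {x : Euc d}
    (h : tubeRad k ^ 2 ≤ ringSq (S.ringCoords k x)) : fderiv ℝ (S.tubeBump k) x = 0 :=
  IsLocalMax.fderiv_eq_zero (Eventually.of_forall fun z ↦
    (S.tubeBump_le k z).trans_eq (S.tubeBump_of_ge h).symm)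

theorem fderiv_tubeBump_tubeParam (k : ℕ) {y : Euc d} (hy : tubeSq y < 1) (u : Euc d) :
    fderiv ℝ (S.tubeBump k) (S.tubeParam k y) (fderiv ℝ (S.tubeParam k) y u) =
      S.scale k * tubeRad k * fderiv ℝ (fun z ↦ stepProfile (tubeSq z / tubeRad k ^ 2)) y u := by
  have hcomp : S.tubeBump k ∘ S.tubeParam k =ᶠ[nhds y]
      fun z ↦ S.scale k * tubeRad k * stepProfile (tubeSq z / tubeRad k ^ 2) := by
    filter_upwards [contDiff_tubeSq.continuous.continuousAt.eventually_lt_const hy] with z hz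
    rw [Function.comp_apply, tubeBump, ringCoords_tubeParam, ringSq_ringParam hz.le]
  have hstep : DifferentiableAt ℝ (fun z : Euc d ↦ stepProfile (tubeSq z / tubeRad k ^ 2)) y :=
    (contDiff_stepProfile.comp (contDiff_tubeSq.div_const _)).differentiable (by simp) y
  have hchain := fderiv_comp y ((S.contDiff_tubeBump k).differentiable (by simp) _)
    ((S.contDiff_tubeParam k).differentiable (by simp) y)
  rw [hcomp.fderiv_eq, fderiv_const_mul hstep] at hchain
  exact (DFunLike.congr_fun hchain u).symm

theorem fderiv_tubeBump_sq_le {A : ℝ} (hA : ∀ s ∈ Set.Icc (0 : ℝ) 1, |deriv stepProfile s| ≤ A)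
    (k : ℕ) (x u : Euc d) :
    (fderiv ℝ (S.tubeBump k) x u) ^ 2 ≤ (2 * A) ^ 2 * S.metric.form x u u := by
  have hconst (h : fderiv ℝ (S.tubeBump k) x = 0) :
      (fderiv ℝ (S.tubeBump k) x u) ^ 2 ≤ (2 * A) ^ 2 * S.metric.form x u u := by
    simpa [h] using mul_nonneg (sq_nonneg (2 * A)) (S.metric.form_self_nonneg x u)
  rcases le_or_gt (ringSq (S.ringCoords k x)) (tubeRad k ^ 2 / 4) with hle | hgt
  · exact hconst (S.fderiv_tubeBump_of_le hle)
  rcases le_or_gt (tubeRad k ^ 2) (ringSq (S.ringCoords k x)) with hge | hlt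
  · exact hconst (S.fderiv_tubeBump_of_ge hge)
  have hrad := tubeRad_sq_lt k
  rw [metric_form, S.level_eq_of_ringSq hgt (by linarith)]
  obtain ⟨y, -, htube, rfl⟩ := S.exists_tubeParam_eq k x
  rw [← htube] at hlt
  obtain ⟨u, rfl⟩ := S.surjective_fderiv_tubeParam k (by linarith : tubeSq y ≤ 1 / 64) u
  rw [S.levelForm_tubeParam_self k (by linarith), S.fderiv_tubeBump_tubeParam k (by linarith)]
  calc (S.scale k * tubeRad k * fderiv ℝ (fun z ↦ stepProfile (tubeSq z / tubeRad k ^ 2)) y u) ^ 2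
      = S.scale k ^ 2 *
          (tubeRad k * fderiv ℝ (fun z ↦ stepProfile (tubeSq z / tubeRad k ^ 2)) y u) ^ 2 := by
        ring
    _ ≤ S.scale k ^ 2 * ((2 * A) ^ 2 * tubeSq u) := by
        gcongr
        exact fderiv_stepProfile_tubeSq_div_sq_le (tubeRad_pos k) hA hlt.le u
    _ = (2 * A) ^ 2 * (S.scale k ^ 2 * tubeSq u) := by ring
    _ ≤ _ := by
        gcongr
        exact le_add_of_nonneg_right (by positivity)

theorem exists_ball_subset_tube : ∃ c : ℝ, 0 < c ∧ ∀ k,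
    S.metric.ball 0 (c * (S.scale k * tubeRad k)) ⊆
      {x | ringSq (S.ringCoords k x) < tubeRad k ^ 2} := by
  obtain ⟨A, hA_pos, hA⟩ := exists_abs_deriv_stepProfile_le
  refine ⟨(2 * A)⁻¹, by positivity, fun k x hx ↦ ?_⟩
  rw [Set.mem_ofPred_eq, ← not_le]
  intro hge
  have hrad : 0 < S.scale k * tubeRad k := mul_pos (S.scale_pos k) (tubeRad_pos k)
  have hbump := S.metric.enorm_sub_le_mul_edist ((S.contDiff_tubeBump k).of_le (by simp))
    (by positivity : 0 ≤ 2 * A) (S.fderiv_tubeBump_sq_le hA k) 0 x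
  rw [S.tubeBump_zero, S.tubeBump_of_ge hge, sub_zero, Real.enorm_of_nonneg hrad.le] at hbump
  refine (hbump.trans_lt (?_ : _ < ENNReal.ofReal (S.scale k * tubeRad k))).false
  calc ENNReal.ofReal (2 * A) * S.metric.edist 0 x
      < ENNReal.ofReal (2 * A) * ENNReal.ofReal ((2 * A)⁻¹ * (S.scale k * tubeRad k)) :=
        ENNReal.mul_lt_mul_right (by simpa using hA_pos) ENNReal.ofReal_ne_top hx
    _ = ENNReal.ofReal (S.scale k * tubeRad k) := by
        rw [← ENNReal.ofReal_mul (by positivity), mul_inv_cancel_left₀ (by positivity)]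

theorem isCompact_norm_coords_le (k : ℕ) (r : ℝ) : IsCompact {x | ‖S.coords k x‖ ≤ r} := by
  have himage : {x | ‖S.coords k x‖ ≤ r} = S.coordsInv k '' Metric.closedBall 0 r := by
    ext x
    constructor
    · exact fun hx ↦ ⟨S.coords k x, by simpa using hx, S.coordsInv_coords k x⟩
    · rintro ⟨y, hy, rfl⟩
      simpa [coords_coordsInv] using hy
  rw [himage]
  exact (isCompact_closedBall 0 r).image (S.coordsInv k).continuous

theorem tendsto_scale_mul_tubeRad : Tendsto (fun k ↦ S.scale k * tubeRad k) atTop atTop :=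
  tendsto_atTop_mono S.pow_le_scale_mul_tubeRad
    ((tendsto_pow_atTop_atTop_of_one_lt (by norm_num)).atTop_div_const (by norm_num))

theorem metric_isComplete : S.metric.IsComplete := by
  obtain ⟨c, hc, hsub⟩ := S.exists_ball_subset_tube
  refine S.metric.isComplete_of_ball_subset_compact 0 fun r ↦ ?_
  obtain ⟨k, hk⟩ := (S.tendsto_scale_mul_tubeRad.eventually_ge_atTop (r / c)).exists
  refine ⟨{x | ‖S.coords k x‖ ≤ 3}, S.isCompact_norm_coords_le k 3, fun x hx ↦ ?_⟩
  have htube := hsub k (lt_of_lt_of_le hx (ENNReal.ofReal_le_ofReal ((div_le_iff₀' hc).1 hk)))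
  exact (S.norm_coords_lt_three (htube.trans ((tubeRad_sq_lt k).trans (by norm_num)))).le

end Straightening

end Euc

end DistanceLowerBound

section CurvatureDecay

theorem linearIndependent_of_map_pair {E F : Type*} [AddCommGroup E] [Module ℝ E]
    [AddCommGroup F] [Module ℝ F] (L : E →ₗ[ℝ] F) {u v : E}
    (h : LinearIndependent ℝ ![L u, L v]) : LinearIndependent ℝ ![u, v] := by
  rw [LinearIndependent.pair_iff] at h ⊢
  intro s t hst
  apply h s t
  rw [← map_smul, ← map_smul, ← map_add, hst, map_zero]

theorem SmoothMetric.hasQuadraticCurvatureDecay_of_bound {n : ℕ}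
    {g : SmoothMetric (EuclideanSpace ℝ (Fin n))} {C : ℝ} {x₀ : EuclideanSpace ℝ (Fin n)}
    (hC : 0 < C) (h : ∀ x u v, LinearIndependent ℝ ![u, v] →
      |g.sectionalCurvature x u v| * (1 + g.dist x₀ x ^ 2) ≤ C)
    (m₀ : EuclideanSpace ℝ (Fin n)) : g.HasQuadraticCurvatureDecay m₀ := by
  set D := g.dist m₀ x₀
  refine ⟨2 * (D ^ 2 + 1) * C, by positivity, fun m hm u v huv ↦ ?_⟩
  have hpos := g.dist_pos hm.symm
  have hdist : g.dist m₀ m ^ 2 ≤ 2 * (D ^ 2 + 1) * (1 + g.dist x₀ m ^ 2) := by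
    calc g.dist m₀ m ^ 2 ≤ (D + g.dist x₀ m) ^ 2 := by
          gcongr
          exact g.dist_triangle m₀ x₀ m
      _ ≤ 2 * (D ^ 2 + g.dist x₀ m ^ 2) := add_sq_le
      _ ≤ _ := by nlinarith [sq_nonneg (D * g.dist x₀ m)]
  rw [le_div_iff₀ (by positivity)]
  calc |g.sectionalCurvature m u v| * g.dist m₀ m ^ 2
      ≤ |g.sectionalCurvature m u v| * (2 * (D ^ 2 + 1) * (1 + g.dist x₀ m ^ 2)) := by gcongr
    _ = 2 * (D ^ 2 + 1) * (|g.sectionalCurvature m u v| * (1 + g.dist x₀ m ^ 2)) := by ring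
    _ ≤ 2 * (D ^ 2 + 1) * C := by gcongr; exact h m u v huv

variable {d : ℕ}

namespace Euc

/-- The metric with form `ringForm (1 / 32)`. Away from its core circle it is the model of every
level, since `ringForm ε` depends on `ε` only near that circle. -/
def ringMetric (d : ℕ) : SmoothMetric (Euc d) :=
  SmoothMetric.ofField (ringForm (1 / 32)) (contDiff_ringForm _) (ringForm_symm _)
    (fun m _ hu ↦ ringForm_self_pos (by norm_num) le_rfl m hu)

theorem ringMetric_form (m u v : Euc d) :
    (ringMetric d).form m u v = ringForm (1 / 32) m u v := rfl

namespace Straightening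

variable (S : Straightening d)

/-- Tubular coordinates around the core circle of level `k`, rescaled so that the metric becomes
a multiple of the fixed metric `warpedMetric d`. -/
def scaledTubeParam (k : ℕ) (w : Euc d) : Euc d :=
  S.tubeParam k (axisScale (tubeRad k / circleLen d k) (tubeRad k) w)

theorem contDiff_scaledTubeParam (k : ℕ) : ContDiff ℝ ∞ (S.scaledTubeParam k) :=
  (S.contDiff_tubeParam k).comp (axisScale _ _).contDiff

theorem surjective_axisScale_tubeRad (d k : ℕ) : Function.Surjective
    (axisScale (tubeRad k / circleLen d k) (tubeRad k) : Euc d →L[ℝ] Euc d) :=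
  fun y ↦ ⟨_, axisScale_axisScale_inv (div_pos (tubeRad_pos k) (circleLen_pos d k)).ne'
    (tubeRad_pos k).ne' y⟩

theorem fderiv_scaledTubeParam (k : ℕ) (w u : Euc d) : fderiv ℝ (S.scaledTubeParam k) w u =
    fderiv ℝ (S.tubeParam k) (axisScale (tubeRad k / circleLen d k) (tubeRad k) w)
      (axisScale (tubeRad k / circleLen d k) (tubeRad k) u) :=
  DFunLike.congr_fun ((((S.contDiff_tubeParam k).differentiable (by simp) _).hasFDerivAt.comp w
    (axisScale _ _).hasFDerivAt).fderiv) u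

theorem surjective_fderiv_scaledTubeParam {k : ℕ} {w : Euc d}
    (hw : tubeRad k ^ 2 * tubeSq w < 1 / 64) :
    Function.Surjective (fderiv ℝ (S.scaledTubeParam k) w) := by
  rw [← tubeSq_axisScale (tubeRad k / circleLen d k)] at hw
  intro v
  obtain ⟨u, rfl⟩ := ((S.surjective_fderiv_tubeParam k hw.le).comp
    (surjective_axisScale_tubeRad d k)) v
  exact ⟨u, S.fderiv_scaledTubeParam k w u⟩

theorem exists_scaledTubeParam_eq (k : ℕ) (x : Euc d) : ∃ w : Euc d,
    tubeRad k ^ 2 * tubeSq w = ringSq (S.ringCoords k x) ∧ S.scaledTubeParam k w = x := by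
  obtain ⟨y, -, htube, hy⟩ := S.exists_tubeParam_eq k x
  obtain ⟨w, rfl⟩ := surjective_axisScale_tubeRad d k y
  exact ⟨w, by rw [← htube, tubeSq_axisScale], hy⟩

theorem levelForm_scaledTubeParam {k : ℕ} {w : Euc d} (hw : tubeRad k ^ 2 * tubeSq w < 1 / 64)
    (u v : Euc d) : S.levelForm k (S.scaledTubeParam k w) (fderiv ℝ (S.scaledTubeParam k) w u)
      (fderiv ℝ (S.scaledTubeParam k) w v) =
        (S.scale k * tubeRad k) ^ 2 * (warpedMetric d).form w u v := by
  have hrad := tubeRad_pos k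
  have hlen := circleLen_pos d k
  have hprofile : circleProfile (d + 2) (tubeRad k) (tubeRad k ^ 2 * tubeSq w) =
      circleLen d k * powerProfile (d + 2) (tubeSq w) := by
    rw [circleProfile, circleLen, mul_div_cancel_left₀ _ (by positivity)]
  rw [fderiv_scaledTubeParam, fderiv_scaledTubeParam, scaledTubeParam, S.levelForm_tubeParam k
    (by rw [tubeSq_axisScale]; exact hw.le), tubeSq_axisScale, hprofile, warpedMetric_form,
    inner_axisScale_axisScale, axisScale_apply_zero, axisScale_apply_zero]
  field_simp
  ring

theorem isHomothetyAt_scaledTubeParam {k : ℕ} {w : Euc d}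
    (hw : tubeRad k ^ 2 * tubeSq w < 1 / 64) (hlevel : S.level (S.scaledTubeParam k w) = k) :
    IsHomothetyAt (warpedMetric d).field S.metric.field (S.scaledTubeParam k)
      (S.scale k * tubeRad k) w := by
  have hform := (S.contDiff_scaledTubeParam k).continuous.continuousAt.eventually
    (S.metric_form_eventuallyEq (S.scaledTubeParam k w))
  have htube : ∀ᶠ z : Euc d in nhds w, tubeRad k ^ 2 * tubeSq z < 1 / 64 :=
    (continuous_const.mul contDiff_tubeSq.continuous).continuousAt.eventually_lt_const hw
  rw [hlevel] at hform
  filter_upwards [hform, htube] with z hz hz_tube u v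
  rw [← SmoothMetric.form_eq_field, ← SmoothMetric.form_eq_field, hz,
    S.levelForm_scaledTubeParam hz_tube]

theorem exists_curvature_bound_of_ringSq_lt (d : ℕ) : ∃ C : ℝ, 0 < C ∧
    ∀ (S : Straightening d) (x : Euc d), ringSq (S.ringCoords (S.level x) x) < 1 / 64 →
      ∀ u v : Euc d, LinearIndependent ℝ ![u, v] →
        |S.metric.sectionalCurvature x u v| ≤ C / (S.scale (S.level x) ^ 2 *
          (tubeRad (S.level x) ^ 2 + ringSq (S.ringCoords (S.level x) x))) := by
  obtain ⟨C, hC, hbound⟩ := exists_sectionalCurvature_warpedMetric_bound d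
  refine ⟨C, hC, fun S x ↦ ?_⟩
  generalize hlevel : S.level x = k
  intro hx u v huv
  obtain ⟨w, hw, rfl⟩ := S.exists_scaledTubeParam_eq k x
  rw [← hw] at hx ⊢
  obtain ⟨u, rfl⟩ := S.surjective_fderiv_scaledTubeParam hx u
  obtain ⟨v, rfl⟩ := S.surjective_fderiv_scaledTubeParam hx v
  have hscale := mul_pos (S.scale_pos k) (tubeRad_pos k)
  rw [SmoothMetric.sectionalCurvature_of_isHomothetyAt
    (contDiff_infty.1 (S.contDiff_scaledTubeParam k) 3) hscale.ne'
    (S.isHomothetyAt_scaledTubeParam hx hlevel), abs_div, abs_of_pos (pow_pos hscale 2)]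
  have huv' := linearIndependent_of_map_pair
    (fderiv ℝ (S.scaledTubeParam k) w : Euc d →ₗ[ℝ] Euc d) huv
  calc _ ≤ C / (1 + tubeSq w) / (S.scale k * tubeRad k) ^ 2 := by
        gcongr
        exact hbound w u v huv'
    _ = _ := by rw [div_div]; congr 1; ring

theorem isHomothetyAt_ringCoords {x : Euc d}
    (hx : 1 / 64 ≤ ringSq (S.ringCoords (S.level x) x)) :
    IsHomothetyAt S.metric.field (ringMetric d).field (S.ringCoords (S.level x))
      (S.scale (S.level x))⁻¹ x := by
  have hring : ∀ᶠ z in nhds x, 1 / 256 < ringSq (S.ringCoords (S.level x) z) :=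
    (continuous_ringSq.comp (S.contDiff_ringCoords _).continuous).continuousAt.eventually_const_lt
      (lt_of_lt_of_le (by norm_num) hx)
  have hscale := S.scale_pos (S.level x)
  filter_upwards [hring, S.metric_form_eventuallyEq x] with z hz hform u v
  rw [← SmoothMetric.form_eq_field, ← SmoothMetric.form_eq_field, hform, levelForm_apply,
    ringMetric_form, ringForm_eq_of_ge (by norm_num) le_rfl (tubeRad_pos (S.level x))
      (tubeRad_le _) hz.le]
  field_simp

theorem exists_curvature_bound_of_le_ringSq : ∃ C : ℝ, 0 < C ∧
    ∀ x : Euc d, 1 / 64 ≤ ringSq (S.ringCoords (S.level x) x) →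
      ∀ u v : Euc d, LinearIndependent ℝ ![u, v] →
        |S.metric.sectionalCurvature x u v| ≤ C / S.scale (S.level x) ^ 2 := by
  obtain ⟨C, hC, hbound⟩ := (ringMetric d).exists_sectionalCurvature_bound
    ((isCompact_closedBall (0 : Euc d) 4).image S.contDiff.continuous)
  refine ⟨C, hC, fun x hx u v huv ↦ ?_⟩
  have hscale := S.scale_pos (S.level x)
  have hmem : S.ringCoords (S.level x) x ∈ S.toFun '' Metric.closedBall 0 4 :=
    ⟨_, mem_closedBall_zero_iff.2 (S.norm_coords_level_lt x).le, rfl⟩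
  have hK := hbound _ hmem _ _ (linearIndependent_map_pair
    (L := (fderiv ℝ (S.ringCoords (S.level x)) x : Euc d →ₗ[ℝ] Euc d))
    (S.injective_fderiv_ringCoords (S.level x) x) huv)
  have hhom := SmoothMetric.sectionalCurvature_of_isHomothetyAt
    (contDiff_infty.1 (S.contDiff_ringCoords (S.level x)) 3) (inv_ne_zero hscale.ne')
    (S.isHomothetyAt_ringCoords hx) u v
  rw [le_div_iff₀ (by positivity)]
  calc |S.metric.sectionalCurvature x u v| * S.scale (S.level x) ^ 2
      = |S.metric.sectionalCurvature x u v / (S.scale (S.level x))⁻¹ ^ 2| := by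
        rw [inv_pow, div_inv_eq_mul, abs_mul, abs_of_pos (pow_pos hscale 2)]
    _ ≤ C := by rw [← hhom]; exact hK

theorem dist_zero_sq_le_of_ringSq_lt {k : ℕ} {x : Euc d}
    (h : ringSq (S.ringCoords k x) < 1 / 64) : S.metric.dist 0 x ^ 2 ≤
      200 * (S.scale k ^ 2 * (tubeRad k ^ 2 + ringSq (S.ringCoords k x))) := by
  set q := √(ringSq (S.ringCoords k x))
  have hq : q ^ 2 = ringSq (S.ringCoords k x) := Real.sq_sqrt (ringSq_nonneg _)
  have hscale := S.scale_pos k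
  have hrad := tubeRad_pos k
  have hdist := S.metric.dist_le_of_edist_le (by positivity) (S.edist_zero_le_of_ringSq_lt h)
  have hnonneg := S.metric.dist_nonneg 0 x
  rw [← hq]
  calc S.metric.dist 0 x ^ 2 ≤ (10 * (S.scale k * (tubeRad k + q))) ^ 2 := by gcongr
    _ = 100 * (S.scale k ^ 2 * (tubeRad k + q) ^ 2) := by ring
    _ ≤ 100 * (S.scale k ^ 2 * (2 * (tubeRad k ^ 2 + q ^ 2))) := by gcongr; exact add_sq_le
    _ = _ := by ring

theorem dist_zero_sq_le_of_norm_coords_lt {k : ℕ} {x : Euc d} (h : ‖S.coords k x‖ < 4) :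
    S.metric.dist 0 x ^ 2 ≤ 64 * S.scale k ^ 2 := by
  have hdist := S.metric.dist_le_of_edist_le (mul_pos (by norm_num) (S.scale_pos k)).le
    (S.edist_zero_le_of_norm_coords_lt h)
  calc S.metric.dist 0 x ^ 2 ≤ (8 * S.scale k) ^ 2 :=
        pow_le_pow_left₀ (S.metric.dist_nonneg 0 x) hdist 2
    _ = _ := by ring

theorem one_le_sq_scale_mul_add (k : ℕ) {s : ℝ} (hs : 0 ≤ s) :
    1 ≤ 1024 * (S.scale k ^ 2 * (tubeRad k ^ 2 + s)) := by
  have hpow : (1 : ℝ) ≤ 8 ^ k := one_le_pow₀ (by norm_num)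
  have hscale : 1 / 32 ≤ S.scale k * tubeRad k := by linarith [S.pow_le_scale_mul_tubeRad k]
  nlinarith [mul_nonneg (sq_nonneg (S.scale k)) hs]

theorem exists_curvature_radius : ∃ C : ℝ, 0 < C ∧ ∀ x : Euc d, ∃ R > 0,
    1 + S.metric.dist 0 x ^ 2 ≤ 1224 * R ∧ ∀ u v : Euc d, LinearIndependent ℝ ![u, v] →
      |S.metric.sectionalCurvature x u v| ≤ C / R := by
  obtain ⟨C₁, hC₁, hnear⟩ := exists_curvature_bound_of_ringSq_lt d
  obtain ⟨C₂, -, hfar⟩ := S.exists_curvature_bound_of_le_ringSq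
  refine ⟨max C₁ C₂, lt_max_of_lt_left hC₁, fun x ↦ ?_⟩
  have hscale := S.scale_pos (S.level x)
  rcases lt_or_ge (ringSq (S.ringCoords (S.level x) x)) (1 / 64) with hx | hx
  · have hring := ringSq_nonneg (S.ringCoords (S.level x) x)
    have hrad := tubeRad_pos (S.level x)
    refine ⟨_, by positivity, ?_, fun u v huv ↦ (hnear S x hx u v huv).trans
      (div_le_div_of_nonneg_right (le_max_left _ _) (by positivity))⟩
    linarith [S.dist_zero_sq_le_of_ringSq_lt hx, S.one_le_sq_scale_mul_add (S.level x) hring]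
  · refine ⟨_, by positivity, ?_, fun u v huv ↦ (hfar x hx u v huv).trans
      (div_le_div_of_nonneg_right (le_max_right _ _) (by positivity))⟩
    have hone : 1 ≤ S.scale (S.level x) ^ 2 :=
      one_le_pow₀ ((one_le_pow₀ (by norm_num)).trans (S.pow_le_scale _))
    linarith [S.dist_zero_sq_le_of_norm_coords_lt (S.norm_coords_level_lt x)]

theorem hasQuadraticCurvatureDecay (m₀ : Euc d) : S.metric.HasQuadraticCurvatureDecay m₀ := by
  obtain ⟨C, hC, hbound⟩ := S.exists_curvature_radius
  refine SmoothMetric.hasQuadraticCurvatureDecay_of_bound (C := C * 1224) (x₀ := 0) (by positivity)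
    (fun x u v huv ↦ ?_) m₀
  obtain ⟨R, hR, hdist, hK⟩ := hbound x
  calc _ ≤ C / R * (1224 * R) := by gcongr; exact hK u v huv
    _ = C * 1224 := by field_simp

end Straightening

end Euc

end CurvatureDecay

section Volume

theorem det_bilinear_pullback {n : ℕ}
    (B : EuclideanSpace ℝ (Fin n) →L[ℝ] EuclideanSpace ℝ (Fin n) →L[ℝ] ℝ)
    (L : EuclideanSpace ℝ (Fin n) →L[ℝ] EuclideanSpace ℝ (Fin n)) :
    (Matrix.of fun i j ↦ B (L (EuclideanSpace.single i 1)) (L (EuclideanSpace.single j 1))).det =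
      L.det ^ 2 *
        (Matrix.of fun i j ↦ B (EuclideanSpace.single i 1) (EuclideanSpace.single j 1)).det := by
  let b := (EuclideanSpace.basisFun (Fin n) ℝ).toBasis
  let β : LinearMap.BilinForm ℝ (EuclideanSpace ℝ (Fin n)) := B.toLinearMap₁₂
  have hb (i : Fin n) : b i = EuclideanSpace.single i 1 := by simp [b]
  have hB : Matrix.of (fun i j ↦ B (EuclideanSpace.single i 1) (EuclideanSpace.single j 1)) =
      LinearMap.BilinForm.toMatrix b β := by
    ext i j
    rw [LinearMap.BilinForm.toMatrix_apply, hb, hb]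
    rfl
  have hBL : (Matrix.of fun i j ↦ B (L (EuclideanSpace.single i 1))
      (L (EuclideanSpace.single j 1))) = LinearMap.BilinForm.toMatrix b (β.comp L L) := by
    ext i j
    rw [LinearMap.BilinForm.toMatrix_apply, hb, hb]
    rfl
  have hL : (LinearMap.toMatrix b b (L : _ →ₗ[ℝ] _)).det = L.det := LinearMap.det_toMatrix b _
  rw [hB, hBL, LinearMap.BilinForm.toMatrix_comp b, Matrix.det_mul, Matrix.det_mul,
    Matrix.det_transpose, hL]
  ring

theorem SmoothMetric.volume_le_of_sqrt_det_gram_le {n : ℕ}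
    (g : SmoothMetric (EuclideanSpace ℝ (Fin n))) {A : Set (EuclideanSpace ℝ (Fin n))}
    (hA : MeasurableSet A) {Ψ : EuclideanSpace ℝ (Fin n) → EuclideanSpace ℝ (Fin n)}
    (hΨ : Differentiable ℝ Ψ) (hinj : Set.InjOn Ψ A) {c : ℝ} (hc : 0 ≤ c)
    (h : ∀ x ∈ A, √(g.gram x).det ≤ c * |(fderiv ℝ Ψ x).det|) :
    g.volume A ≤ ENNReal.ofReal c * MeasureTheory.volume (Ψ '' A) := by
  rw [SmoothMetric.volume, withDensity_apply _ hA]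
  calc ∫⁻ x in A, ENNReal.ofReal √(g.gram x).det
      ≤ ∫⁻ x in A, ENNReal.ofReal c * ENNReal.ofReal |(fderiv ℝ Ψ x).det| := by
        refine setLIntegral_mono' hA fun x hx ↦ ?_
        rw [← ENNReal.ofReal_mul hc]
        exact ENNReal.ofReal_le_ofReal (h x hx)
    _ = ENNReal.ofReal c * MeasureTheory.volume (Ψ '' A) := by
        rw [lintegral_const_mul' _ _ ENNReal.ofReal_ne_top,
          lintegral_abs_det_fderiv_eq_addHaar_image _ hA
            (fun x _ ↦ (hΨ x).hasFDerivAt.hasFDerivWithinAt) hinj]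

variable {d : ℕ}

namespace Euc

theorem sum_angularForm_single_sq (m : Euc d) :
    ∑ i, angularForm m (EuclideanSpace.single i 1) ^ 2 = radius m ^ 2 := by
  have hne (i : Fin d) : (1 : Fin (d + 2)) ≠ i.succ.succ := by
    rw [← Fin.succ_zero_eq_one, Ne, Fin.succ_inj]
    exact (Fin.succ_ne_zero i).symm
  rw [radius_sq, add_comm (m 0 ^ 2)]
  simp [angularForm_apply, Fin.sum_univ_succ, hne, (Fin.succ_ne_zero _).symm]

theorem det_ringForm (ε : ℝ) (m : Euc d) : (Matrix.of fun i j ↦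
    ringForm ε m (EuclideanSpace.single i 1) (EuclideanSpace.single j 1)).det =
      1 + ringCoeff ε m * radius m ^ 2 := by
  let a (i : Fin (d + 2)) : ℝ := angularForm m (EuclideanSpace.single i 1)
  have hrank_one : (Matrix.of fun i j ↦
      ringForm ε m (EuclideanSpace.single i 1) (EuclideanSpace.single j 1)) =
      1 + Matrix.replicateCol Unit (ringCoeff ε m • a) * Matrix.replicateRow Unit a := by
    ext i j
    simp [a, ringForm_apply, Matrix.one_apply, Matrix.mul_apply, inner_single_right, eq_comm]
  rw [hrank_one, Matrix.det_one_add_replicateCol_mul_replicateRow, dotProduct_smul, smul_eq_mul,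
    ← sum_angularForm_single_sq]
  simp only [dotProduct, sq, a]

theorem one_add_ringCoeff_mul_le {ε : ℝ} (hε : 0 < ε) (hε' : ε ≤ 1 / 32) {m : Euc d}
    (h : ringSq m ≤ ε ^ 2) :
    1 + ringCoeff ε m * radius m ^ 2 ≤ (2 * (ε ^ 2) ^ (d + 2)) ^ 2 := by
  have hring : ringSq m < 1 / 64 := by nlinarith
  have hradius := radius_gt_of_ringSq_lt (hring.trans (by norm_num))
  rw [ringCoeff, ringCutoff_of_le hring.le, circleProfile_of_le _ hε h]
  set η := (ε ^ 2) ^ (d + 2)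
  have hcancel : 1 + 1 * (η ^ 2 - radius m ^ 2) / radius m ^ 4 * radius m ^ 2 =
      η ^ 2 / radius m ^ 2 := by field_simp; ring
  have hquarter : 1 / 4 ≤ radius m ^ 2 := by nlinarith
  rw [hcancel, div_le_iff₀ (by positivity)]
  nlinarith [mul_le_mul_of_nonneg_left hquarter (sq_nonneg η)]

namespace Straightening

variable (S : Straightening d)

theorem det_gram (x : Euc d) : (S.metric.gram x).det =
    (S.scale (S.level x) ^ (d + 2) * (fderiv ℝ (S.ringCoords (S.level x)) x).det) ^ 2 *
      (1 + ringCoeff (tubeRad (S.level x)) (S.ringCoords (S.level x) x) *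
        radius (S.ringCoords (S.level x) x) ^ 2) := by
  have hgram : S.metric.gram x = S.scale (S.level x) ^ 2 • Matrix.of fun i j ↦
      ringForm (tubeRad (S.level x)) (S.ringCoords (S.level x) x)
        (fderiv ℝ (S.ringCoords (S.level x)) x (EuclideanSpace.single i 1))
        (fderiv ℝ (S.ringCoords (S.level x)) x (EuclideanSpace.single j 1)) := by
    ext i j
    exact S.levelForm_apply (S.level x) x _ _
  rw [hgram, Matrix.det_smul, det_bilinear_pullback, det_ringForm, Fintype.card_fin]
  ring

theorem injective_ringCoords (k : ℕ) : Function.Injective (S.ringCoords k) :=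
  (Function.LeftInverse.injective S.left_inv).comp (S.coords_injective k)

/-- The Euclidean volume of the region in which the model of every level lives. -/
def modelVolume : ℝ≥0∞ := volume (S.toFun '' Metric.closedBall 0 4)

theorem modelVolume_ne_top : S.modelVolume ≠ ⊤ :=
  ((isCompact_closedBall (0 : Euc d) 4).image S.contDiff.continuous).measure_lt_top.ne

theorem volume_le_of_forall_level_eq {A : Set (Euc d)} (hA : MeasurableSet A) {k : ℕ}
    (hlevel : ∀ x ∈ A, S.level x = k) {b : ℝ} (hb : 0 ≤ b)
    (h : ∀ x ∈ A, 1 + ringCoeff (tubeRad k) (S.ringCoords k x) *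
      radius (S.ringCoords k x) ^ 2 ≤ b ^ 2) :
    S.metric.volume A ≤ ENNReal.ofReal (S.scale k ^ (d + 2) * b) * S.modelVolume := by
  have hscale := pow_pos (S.scale_pos k) (d + 2)
  refine (S.metric.volume_le_of_sqrt_det_gram_le hA
    ((S.contDiff_ringCoords k).differentiable (by simp)) (S.injective_ringCoords k).injOn
    (mul_nonneg hscale.le hb) fun x hx ↦ ?_).trans ?_
  · rw [S.det_gram, hlevel x hx, Real.sqrt_mul (sq_nonneg _), Real.sqrt_sq_eq_abs, abs_mul,
      abs_of_pos hscale, mul_right_comm]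
    gcongr
    exact Real.sqrt_le_iff.2 ⟨hb, h x hx⟩
  · refine mul_le_mul_right (measure_mono ?_) _
    rintro _ ⟨x, hx, rfl⟩
    exact ⟨S.coords k x, mem_closedBall_zero_iff.2
      (hlevel x hx ▸ S.norm_coords_level_lt x).le, rfl⟩

theorem level_le_iff {k : ℕ} {x : Euc d} : S.level x ≤ k ↔ ‖S.coords k x‖ < 4 :=
  ⟨fun h ↦ S.norm_coords_lt_of_le h (S.norm_coords_level_lt x), S.level_le⟩

theorem measurable_level : Measurable S.level := by
  refine measurable_of_Iic fun k ↦ ?_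
  simp only [Set.preimage, Set.mem_Iic, level_le_iff]
  exact (isOpen_lt (S.coords k).continuous.norm continuous_const).measurableSet

theorem volume_level_eq_le (k : ℕ) : S.metric.volume {x | S.level x = k} ≤
    ENNReal.ofReal (S.scale k ^ (d + 2)) * S.modelVolume := by
  have hvol := S.volume_le_of_forall_level_eq (S.measurable_level (measurableSet_singleton k))
    (fun x hx ↦ hx) zero_le_one (fun x _ ↦ by
      linarith [(ringCoeff_mul_radius_sq_mem_Ioc (tubeRad_pos k) (tubeRad_le k)
        (S.ringCoords k x)).2])
  rwa [mul_one] at hvol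

theorem two_mul_scale_pow_le (k : ℕ) :
    2 * S.scale k ^ (d + 2) ≤ S.scale (k + 1) ^ (d + 2) * circleLen d (k + 1) := by
  have hratio := S.ratio_pos
  have hlen := circleLen_pos d (k + 1)
  have hscale := S.scale_pos (k + 1)
  have hcontract : (S.ratio * circleLen d (k + 1)) ^ (d + 2) ≤ S.ratio * circleLen d (k + 1) :=
    pow_le_of_le_one (by positivity)
      (mul_le_one₀ (S.ratio_le.trans (by norm_num)) hlen.le (circleLen_le_one d (k + 1))) (by simp)
  rw [← S.scale_succ_mul k, mul_pow, mul_left_comm]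
  gcongr
  nlinarith [S.ratio_le]

theorem volume_level_le_le (k : ℕ) : S.metric.volume {x | S.level x ≤ k} ≤
    ENNReal.ofReal (2 * S.scale k ^ (d + 2)) * S.modelVolume := by
  have hscale (k : ℕ) : 0 < S.scale k ^ (d + 2) := pow_pos (S.scale_pos k) _
  induction k with
  | zero =>
    simp only [Nat.le_zero]
    refine (S.volume_level_eq_le 0).trans ?_
    gcongr
    linarith [hscale 0]
  | succ k ih =>
    have hcover : {x | S.level x ≤ k + 1} = {x | S.level x ≤ k} ∪ {x | S.level x = k + 1} :=
      Set.ext fun x ↦ Nat.le_add_one_iff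
    rw [hcover]
    refine (measure_union_le _ _).trans ((add_le_add ih (S.volume_level_eq_le (k + 1))).trans ?_)
    rw [← add_mul, ← ENNReal.ofReal_add (by linarith [hscale k]) (hscale (k + 1)).le]
    gcongr
    nlinarith [S.two_mul_scale_pow_le k, circleLen_le_one d (k + 1), hscale (k + 1)]

theorem volume_tube_le (k : ℕ) :
    S.metric.volume {x | ringSq (S.ringCoords (k + 1) x) < tubeRad (k + 1) ^ 2} ≤
      ENNReal.ofReal (3 * (S.scale (k + 1) ^ (d + 2) * circleLen d (k + 1))) * S.modelVolume := by
  have hscale := S.scale_pos (k + 1)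
  have hscale' := S.scale_pos k
  have hlen := circleLen_pos d (k + 1)
  set tube := {x | ringSq (S.ringCoords (k + 1) x) < tubeRad (k + 1) ^ 2}
  have hmeas : MeasurableSet ({x | S.level x = k + 1} ∩ tube) :=
    (S.measurable_level (measurableSet_singleton (k + 1))).inter
      (isOpen_lt (continuous_ringSq.comp (S.contDiff_ringCoords (k + 1)).continuous)
        continuous_const).measurableSet
  have hcover : tube ⊆ {x | S.level x ≤ k} ∪ ({x | S.level x = k + 1} ∩ tube) := by
    intro x hx
    have hlevel : S.level x ≤ k + 1 := S.level_le ((S.norm_coords_lt_three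
      (hx.trans ((tubeRad_sq_lt (k + 1)).trans (by norm_num)))).trans (by norm_num))
    exact (Nat.le_add_one_iff.1 hlevel).imp id fun h ↦ ⟨h, hx⟩
  have houter := S.volume_le_of_forall_level_eq hmeas (fun x hx ↦ hx.1)
    (b := 2 * circleLen d (k + 1)) (by positivity)
    (fun x hx ↦ one_add_ringCoeff_mul_le (tubeRad_pos (k + 1)) (tubeRad_le (k + 1)) hx.2.le)
  refine (measure_mono hcover).trans ((measure_union_le _ _).trans
    ((add_le_add (S.volume_level_le_le k) houter).trans ?_))
  rw [← add_mul, ← ENNReal.ofReal_add (by positivity) (by positivity)]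
  gcongr
  linarith [S.two_mul_scale_pow_le k]

end Straightening

end Euc

end Volume

section SlowVolumeGrowth

theorem SmoothMetric.hasSlowVolumeGrowth_of_tendsto {n : ℕ}
    {g : SmoothMetric (EuclideanSpace ℝ (Fin n))} {m₀ : EuclideanSpace ℝ (Fin n)} {r : ℕ → ℝ}
    (hr : Tendsto r atTop atTop)
    (h : Tendsto (fun k ↦ g.volume (g.ball m₀ (r k)) / ENNReal.ofReal (r k ^ n)) atTop (nhds 0)) :
    g.HasSlowVolumeGrowth m₀ := by
  refine le_antisymm (le_of_forall_gt_imp_ge_of_dense fun δ hδ ↦ ?_) bot_le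
  exact liminf_le_of_frequently_le'
    (hr.frequently ((h.eventually_lt_const hδ).mono fun _ ↦ le_of_lt).frequently)

variable {d : ℕ}

namespace Euc

theorem tendsto_tubeRad : Tendsto tubeRad atTop (nhds 0) := by
  have hlim := (tendsto_one_div_add_atTop_nhds_zero_nat (𝕜 := ℝ)).const_mul (1 / 32)
  rw [mul_zero] at hlim
  refine hlim.congr fun k ↦ ?_
  unfold tubeRad
  field_simp

namespace Straightening

variable (S : Straightening d)

theorem volume_ball_div_le {c : ℝ} (hc : 0 < c) {m₀ : Euc d} {k : ℕ}
    (hball : S.metric.ball 0 (c * (S.scale (k + 1) * tubeRad (k + 1))) ⊆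
      {x | ringSq (S.ringCoords (k + 1) x) < tubeRad (k + 1) ^ 2})
    (hdist : S.metric.dist 0 m₀ ≤ c / 2 * (S.scale (k + 1) * tubeRad (k + 1))) :
    S.metric.volume (S.metric.ball m₀ (c / 2 * (S.scale (k + 1) * tubeRad (k + 1)))) /
      ENNReal.ofReal ((c / 2 * (S.scale (k + 1) * tubeRad (k + 1))) ^ (d + 2)) ≤
        ENNReal.ofReal (3 * (2 / c) ^ (d + 2) * tubeRad (k + 1) ^ (d + 2)) * S.modelVolume := by
  have hscale := S.scale_pos (k + 1)
  have hrad := tubeRad_pos (k + 1)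
  have hcenter := S.metric.ball_subset_ball (x := 0) (y := m₀)
    (s := c / 2 * (S.scale (k + 1) * tubeRad (k + 1)))
    (t := c * (S.scale (k + 1) * tubeRad (k + 1))) (by positivity) (by linarith)
  rw [ENNReal.div_le_iff (ENNReal.ofReal_pos.2 (by positivity)).ne' ENNReal.ofReal_ne_top,
    mul_right_comm, ← ENNReal.ofReal_mul (by positivity)]
  refine ((measure_mono (hcenter.trans hball)).trans (S.volume_tube_le k)).trans_eq ?_
  congr 2
  simp only [circleLen, div_pow, mul_pow]
  field_simp
  ring

theorem hasSlowVolumeGrowth (m₀ : Euc d) : S.metric.HasSlowVolumeGrowth m₀ := by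
  obtain ⟨c, hc, hball⟩ := S.exists_ball_subset_tube
  have hr : Tendsto (fun k ↦ c / 2 * (S.scale (k + 1) * tubeRad (k + 1))) atTop atTop :=
    (S.tendsto_scale_mul_tubeRad.comp (tendsto_add_atTop_nat 1)).const_mul_atTop (half_pos hc)
  have hlim : Tendsto (fun k ↦ ENNReal.ofReal
      (3 * (2 / c) ^ (d + 2) * tubeRad (k + 1) ^ (d + 2)) * S.modelVolume) atTop (nhds 0) := by
    have hrad := ((tendsto_tubeRad.comp (tendsto_add_atTop_nat 1)).pow (d + 2)).const_mul
      (3 * (2 / c) ^ (d + 2))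
    simpa using ENNReal.Tendsto.mul_const (ENNReal.tendsto_ofReal hrad)
      (Or.inr S.modelVolume_ne_top)
  refine SmoothMetric.hasSlowVolumeGrowth_of_tendsto hr (tendsto_of_tendsto_of_tendsto_of_le_of_le'
    tendsto_const_nhds hlim (Eventually.of_forall fun _ ↦ bot_le) ?_)
  filter_upwards [hr.eventually_ge_atTop (S.metric.dist 0 m₀)] with k hk
  exact S.volume_ball_div_le hc (hball (k + 1)) hk

end Straightening

end Euc

end SlowVolumeGrowth

end

theorem proposition4 (n : ℕ) (hn : 1 < n) :
    ∃ g : SmoothMetric (EuclideanSpace ℝ (Fin n)), g.IsComplete ∧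
      ∀ m₀ : EuclideanSpace ℝ (Fin n),
        g.HasQuadraticCurvatureDecay m₀ ∧ g.HasSlowVolumeGrowth m₀ := by
  obtain ⟨d, rfl⟩ : ∃ d, n = d + 2 := ⟨n - 2, by omega⟩
  obtain ⟨S⟩ := Euc.nonempty_straightening d
  exact ⟨S.metric, S.metric_isComplete, fun m₀ ↦
    ⟨S.hasQuadraticCurvatureDecay m₀, S.hasSlowVolumeGrowth m₀⟩⟩
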